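/- **Setting.** Let $\Delta\subset\mathbb R\times[0,m]\subset\mathbb C$ ($m\ge 1$) be a standard domain with punctures $p_0$ (at $-\infty$) and $p_1,\dots,p_m$ (at $+\infty$): the strip $\mathbb R\times[0,m]$ with $m-1$ horizontal slits removed, the $j$-th slit being a strip of width $\epsilon\in(0,1)$ around height $j$ that starts with a half-circle whose tip is $(\tau_j,j)$ and goes to $+\infty$. Let $\mu=(\mu_0,\dots,\mu_m)$ be weight vectors $\mu_i\in(-\pi/2,\pi/2)^n$, and let ${\bf w}$ be an associated weight function: a smooth map from $\Delta$ to the invertible $n\times n$ matrices that equals $\operatorname{Diag}(e^{\mu_i^1|\tau|},\dots,e^{\mu_i^n|\tau|})$ near $p_i$, where $\tau$ is the longitudinal coordinate of the end, normalized to width one. Put $\mathcal H_{k,\mu}=\{f:\ {\bf w}f\in H^k(\Delta,\mathbb C^n)\}$ with $\|f\|_{k,\mu}=\|{\bf w}f\|_{H^k}$. For $A:\Delta\to GL(n,\mathbb C)$ with $A|_{\partial\Delta}$ unitary let $\mathcal H_{2,\mu}[A]$ be the real subspace of all $v\in\mathcal H_{2,\mu}$ with $v(z)\in A(z)\mathbb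 R^n$ on $\partial\Delta$ and $\bar\partial v|_{\partial\Delta}=0$ (in the sense of traces), let $\mathcal H_{1,\mu}[0]=\{f\in\mathcal H_{1,\mu}: f|_{\partial\Delta}=0\}$, and let $\bar\partial_A:\mathcal H_{2,\mu}[A]\to\mathcal H_{1,\mu}[0]$, $\bar\partial_A v=\partial_\tau v+i\,\partial_t v$. Put $\|A\|_{C^2}=\sum_{|\alpha|\le2}\sup_{z\in\Delta}\max_{j,k}|\partial^\alpha a_{jk}(z)|$. A family $A_\lambda:\Delta\to GL(n,\mathbb C)$, $\lambda\in[0,1]$, is $C^2$-admissible (for ${\bf w}$) if each $A_\lambda$ is smooth up to the boundary, takes values in $U(n)$ on $\partial\Delta$, satisfies $\bar\partial A_\lambda|_{\partial\Delta}=0$ and $\|A_\lambda\|_{C^2}<\infty$, each $\bar\partial_{A_\lambda}$ is Fredholm, and $\lambda\mapsto A_\lambda$ is continuous in the $C^2$-norm. **Proposition.** Let $A_\lambda$, $\lambda\in[0,1]$, be a $C^2$-admissible family which near the punctures does not mix directions with different weights: there is a neighbourhood of the punctures such that, for all $\lambda$, $(A_\lambda)_{jk}=0$ near $p_i$ whenever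 $\mu_i^j\ne\mu_i^k$. Assume that $\bar\partial_{A_0}$ is surjective. Then there are $\lambda_0\in(0,1]$ and $C\ge0$, depending only on $\Delta$, ${\bf w}$ and the family $\{A_\lambda\}$, such that for every basis $(v_1,\dots,v_k)$ of $\operatorname{Ker}\bar\partial_{A_0}$ (over $\mathbb R$) there are, for all $\lambda\in[0,\lambda_0]$, bases $(v_1^\lambda,\dots,v_k^\lambda)$ of $\operatorname{Ker}\bar\partial_{A_\lambda}$ with $$\|v_i^\lambda-v_i\|_{2,\mu}\le C\,\|A_\lambda-A_0\|_{C^2}\,\|v_i\|_{2,\mu},\qquad i=1,\dots,k.$$ Moreover, the kernels $\operatorname{Ker}\bar\partial_{A_\lambda}$, $\lambda\in[0,\lambda_0]$, form a vector bundle over $[0,\lambda_0]$ with the topology induced from $[0,\lambda_0]\times\mathcal H_{2,\mu}$, and $(v_1^\lambda,\dots,v_k^\lambda)$ is a global frame: the map $(\lambda,c)\mapsto(\lambda,\sum_i c_iv_i^\lambda)$ is a homeomorphism from $[0,\lambda_0]\times\mathbb R^k$ onto $\{(\lambda,v): v\in\operatorname{Ker}\bar\partial_{A_\lambda}\}$.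 -/

import Mathlib

open MeasureTheory Set Filter Topology
open scoped ENNReal NNReal ContDiff Matrix

noncomputable section

namespace KernelFamily

/-! ### Standard domains -/

/-- The data of a standard domain with `r + 2` punctures: `r` horizontal slits of width `ε`
removed from `ℝ × [0, r + 1]`.  The `j`-th slit (`j = 0, …, r - 1`) starts at
`(tip j, j + 1)` and goes to `+∞`. -/
structure StandardDomain where
  /-- number of slits -/
  r : ℕ
  /-- real parts of the boundary minima -/
  tip : Fin r → ℝ
  /-- width of the slits -/
  ε : ℝ
  ε_pos : 0 < ε
  ε_lt_one : ε < 1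

namespace StandardDomain

/-- The `j`-th (open) slit: the strip of width `ε` around the ray
`{s + (j + 1) i : s ≥ tip j + ε / 2}` ending in a half-circle whose leftmost point is
`tip j + (j + 1) i`. -/
def slit (D : StandardDomain) (j : Fin D.r) : Set ℂ :=
  {z | ∃ s : ℝ, D.tip j + D.ε / 2 ≤ s ∧ dist z ⟨s, (j : ℝ) + 1⟩ < D.ε / 2}

/-- The standard domain `Δ`, a closed subset of the plane. Its boundary is `frontier D.carrier`. -/
def carrier (D : StandardDomain) : Set ℂ :=
  {z | 0 ≤ z.im ∧ z.im ≤ (D.r : ℝ) + 1 ∧ ∀ j, z ∉ D.slit j}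

/-- The interior of the standard domain. -/
def inner (D : StandardDomain) : Set ℂ := interior D.carrier

/-- Lebesgue measure on the standard domain. -/
def vol (D : StandardDomain) : Measure ℂ := volume.restrict D.inner

/-- The punctures `p_0` (at `-∞`) and `p_1, …, p_{r + 1}` (at `+∞`, from bottom to top). -/
abbrev Puncture (D : StandardDomain) : Type := Fin (D.r + 2)

/-- The direction going out to infinity in the end of the puncture `p_i`. -/
def outward (D : StandardDomain) (i : D.Puncture) (z : ℂ) : ℝ :=
  if i = 0 then -z.re else z.re

/-- The part of the end at the puncture `p_i` that lies beyond `R`.  It is a half-infinite strip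
when `R` is large. -/
def endPart (D : StandardDomain) (i : D.Puncture) (R : ℝ) : Set ℂ :=
  {z ∈ D.carrier | R ≤ D.outward i z ∧
    (i = 0 ∨ (((i : ℕ) : ℝ) - 1 ≤ z.im ∧ z.im ≤ ((i : ℕ) : ℝ)))}

/-- The width of the strip-like end at the puncture `p_i`. -/
def width (D : StandardDomain) (i : D.Puncture) : ℝ :=
  if i = 0 then (D.r : ℝ) + 1
  else 1 - (if (i : ℕ) = 1 then 0 else D.ε / 2) - (if (i : ℕ) = D.r + 1 then 0 else D.ε / 2)

end StandardDomain

/-- The fibre `ℂⁿ`. -/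
abbrev Cn (n : ℕ) : Type := EuclideanSpace ℂ (Fin n)

/-- Complex `n × n` matrices. -/
abbrev Mat (n : ℕ) : Type := Matrix (Fin n) (Fin n) ℂ

/-- The action of a matrix on `ℂⁿ`. -/
def act {n : ℕ} (M : Mat n) (x : Cn n) : Cn n := Matrix.toEuclideanLin M x

/-! ### Classical and weak partial derivatives -/

/-- Multi-indices of order at most `k` in two variables. -/
def multiIndices (k : ℕ) : Finset (ℕ × ℕ) :=
  ((Finset.range (k + 1)) ×ˢ (Finset.range (k + 1))).filter (fun α => α.1 + α.2 ≤ k)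

/-- Classical directional derivative. -/
def dirDeriv {G : Type*} [NormedAddCommGroup G] [NormedSpace ℝ G] (e : ℂ) (φ : ℂ → G) : ℂ → G :=
  fun z => fderiv ℝ φ z e

/-- The classical partial derivative `∂_τ ^ α₁ ∂_t ^ α₂ φ` in the coordinates `z = τ + i t`. -/
def pderiv {G : Type*} [NormedAddCommGroup G] [NormedSpace ℝ G] (α : ℕ × ℕ) (φ : ℂ → G) : ℂ → G :=
  (dirDeriv 1)^[α.1] ((dirDeriv Complex.I)^[α.2] φ)

/-- `g` is the weak partial derivative of `f` of multi-index `α` on the interior of `Δ`, tested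
against the smooth compactly supported functions on the plane with support in `S`.
For `S` the interior of `Δ` this is the usual weak derivative. For `S` the whole plane it says that
the extension of `g` by zero is the weak derivative of the extension of `f` by zero. -/
def IsWeakDeriv {F : Type*} [NormedAddCommGroup F] [NormedSpace ℝ F] (D : StandardDomain)
    (S : Set ℂ) (α : ℕ × ℕ) (f g : ℂ → F) : Prop :=
  LocallyIntegrableOn f S D.vol ∧ LocallyIntegrableOn g S D.vol ∧
    ∀ φ : ℂ → ℝ, ContDiff ℝ ∞ φ → HasCompactSupport φ → tsupport φ ⊆ S →
      ∫ z, pderiv α φ z • f z ∂D.vol = (-1 : ℝ) ^ (α.1 + α.2) • ∫ z, φ z • g z ∂D.vol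

/-- `f` (of class `H¹` up to the boundary) vanishes on the boundary of `Δ` in the sense of traces:
Green's formula holds without boundary term against all test functions on the plane. -/
def HasZeroTrace {F : Type*} [NormedAddCommGroup F] [NormedSpace ℝ F] (D : StandardDomain)
    (f : ℂ → F) : Prop :=
  (∃ g : ℂ → F, IsWeakDeriv D univ (1, 0) f g) ∧ (∃ g : ℂ → F, IsWeakDeriv D univ (0, 1) f g)

/-- The Sobolev class `H_k` on `Δ`: weak derivatives up to order `k` are square integrable. -/
def MemSobolev {F : Type*} [NormedAddCommGroup F] [NormedSpace ℝ F] (D : StandardDomain)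
    (k : ℕ) (f : ℂ → F) : Prop :=
  ∀ α ∈ multiIndices k, ∃ g : ℂ → F, MemLp g 2 D.vol ∧ IsWeakDeriv D D.inner α f g

section WeakDerivLemmas

variable {F : Type*} [NormedAddCommGroup F] [NormedSpace ℝ F]

theorem contDiff_dirDeriv {G : Type*} [NormedAddCommGroup G] [NormedSpace ℝ G] (e : ℂ)
    {φ : ℂ → G} (h : ContDiff ℝ ∞ φ) : ContDiff ℝ ∞ (dirDeriv e φ) :=
  (h.fderiv_right (m := ∞) (by simp)).clm_apply contDiff_const

theorem contDiff_iterate {G : Type*} [NormedAddCommGroup G] [NormedSpace ℝ G] (e : ℂ)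
    (k : ℕ) {φ : ℂ → G} (h : ContDiff ℝ ∞ φ) : ContDiff ℝ ∞ ((dirDeriv e)^[k] φ) := by
  induction k with
  | zero => simpa using h
  | succ k ih => rw [Function.iterate_succ_apply']; exact contDiff_dirDeriv e ih

theorem contDiff_pderiv {G : Type*} [NormedAddCommGroup G] [NormedSpace ℝ G] (α : ℕ × ℕ)
    {φ : ℂ → G} (h : ContDiff ℝ ∞ φ) : ContDiff ℝ ∞ (pderiv α φ) :=
  contDiff_iterate _ _ (contDiff_iterate _ _ h)

theorem tsupport_dirDeriv {G : Type*} [NormedAddCommGroup G] [NormedSpace ℝ G] (e : ℂ)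
    (φ : ℂ → G) : tsupport (dirDeriv e φ) ⊆ tsupport φ := by
  refine closure_minimal (fun z hz => ?_) (isClosed_tsupport φ)
  apply support_fderiv_subset ℝ (f := φ)
  intro h0
  exact hz (by simp [dirDeriv, h0])

theorem tsupport_iterate {G : Type*} [NormedAddCommGroup G] [NormedSpace ℝ G] (e : ℂ) (k : ℕ)
    (φ : ℂ → G) : tsupport ((dirDeriv e)^[k] φ) ⊆ tsupport φ := by
  induction k with
  | zero => simp
  | succ k ih => rw [Function.iterate_succ_apply']; exact (tsupport_dirDeriv e _).trans ih

theorem tsupport_pderiv {G : Type*} [NormedAddCommGroup G] [NormedSpace ℝ G] (α : ℕ × ℕ)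
    (φ : ℂ → G) : tsupport (pderiv α φ) ⊆ tsupport φ :=
  (tsupport_iterate _ _ _).trans (tsupport_iterate _ _ _)

theorem integrable_smul_of_locallyIntegrableOn {m : Measure ℂ} {S : Set ℂ} {f : ℂ → F} {ψ : ℂ → ℝ}
    (hf : LocallyIntegrableOn f S m) (hψ : Continuous ψ) {K : Set ℂ} (hK : IsCompact K)
    (hψK : tsupport ψ ⊆ K) (hKS : K ⊆ S) : Integrable (fun z => ψ z • f z) m := by
  have h1 : IntegrableOn f K m := hf.integrableOn_compact_subset hKS hK
  have h2 : IntegrableOn (fun z => ψ z • f z) K m := h1.continuousOn_smul hψ.continuousOn hK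
  rwa [integrableOn_iff_integrable_of_support_subset] at h2
  intro z hz
  apply hψK
  apply subset_tsupport
  intro h0
  exact hz (by simp [h0])

variable {D : StandardDomain} {S : Set ℂ} {α : ℕ × ℕ}

theorem IsWeakDeriv.zero : IsWeakDeriv D S α (fun _ => (0 : F)) (fun _ => 0) :=
  ⟨(locallyIntegrable_zero).locallyIntegrableOn S, (locallyIntegrable_zero).locallyIntegrableOn S,
    by simp⟩

theorem IsWeakDeriv.add {f g f' g' : ℂ → F} (h : IsWeakDeriv D S α f g)
    (h' : IsWeakDeriv D S α f' g') :
    IsWeakDeriv D S α (fun z => f z + f' z) (fun z => g z + g' z) := by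
  refine ⟨h.1.add h'.1, h.2.1.add h'.2.1, fun φ hφ hc hs => ?_⟩
  have hp := (contDiff_pderiv α hφ).continuous
  simp only [smul_add]
  rw [integral_add, integral_add, h.2.2 φ hφ hc hs, h'.2.2 φ hφ hc hs, smul_add]
  · exact integrable_smul_of_locallyIntegrableOn h.2.1 hφ.continuous hc subset_rfl hs
  · exact integrable_smul_of_locallyIntegrableOn h'.2.1 hφ.continuous hc subset_rfl hs
  · exact integrable_smul_of_locallyIntegrableOn h.1 hp hc (tsupport_pderiv α φ) hs
  · exact integrable_smul_of_locallyIntegrableOn h'.1 hp hc (tsupport_pderiv α φ) hs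

theorem IsWeakDeriv.const_smul {f g : ℂ → F} (c : ℝ) (h : IsWeakDeriv D S α f g) :
    IsWeakDeriv D S α (fun z => c • f z) (fun z => c • g z) := by
  refine ⟨h.1.smul c, h.2.1.smul c, fun φ hφ hc hs => ?_⟩
  have e1 : ∀ z, pderiv α φ z • c • f z = c • (pderiv α φ z • f z) := fun z => smul_comm _ _ _
  have e2 : ∀ z, φ z • c • g z = c • (φ z • g z) := fun z => smul_comm _ _ _
  simp only [e1, e2]
  rw [integral_smul, integral_smul, h.2.2 φ hφ hc hs, smul_comm]

theorem IsWeakDeriv.congr {f g f' g' : ℂ → F} (h : IsWeakDeriv D S α f g)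
    (hf : f =ᵐ[D.vol] f') (hg : g =ᵐ[D.vol] g') : IsWeakDeriv D S α f' g' := by
  refine ⟨fun x hx => ?_, fun x hx => ?_, fun φ hφ hc hs => ?_⟩
  · obtain ⟨T, hT, hi⟩ := h.1 x hx
    exact ⟨T, hT, hi.congr_fun_ae (ae_restrict_of_ae hf)⟩
  · obtain ⟨T, hT, hi⟩ := h.2.1 x hx
    exact ⟨T, hT, hi.congr_fun_ae (ae_restrict_of_ae hg)⟩
  · have := h.2.2 φ hφ hc hs
    have e1 : ∫ z, pderiv α φ z • f z ∂D.vol = ∫ z, pderiv α φ z • f' z ∂D.vol :=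
      integral_congr_ae (hf.mono fun z hz => congrArg (pderiv α φ z • ·) hz)
    have e2 : ∫ z, φ z • g z ∂D.vol = ∫ z, φ z • g' z ∂D.vol :=
      integral_congr_ae (hg.mono fun z hz => congrArg (φ z • ·) hz)
    rw [← e1, ← e2]
    exact this

theorem IsWeakDeriv.unique [CompleteSpace F] {f g g' : ℂ → F}
    (h : IsWeakDeriv D D.inner α f g) (h' : IsWeakDeriv D D.inner α f g') : g =ᵐ[D.vol] g' := by
  have hopen : IsOpen D.inner := isOpen_interior
  have key : ∀ᵐ z ∂D.vol, z ∈ D.inner → (fun z => g z - g' z) z = 0 := by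
    refine hopen.ae_eq_zero_of_integral_contDiff_smul_eq_zero (h.2.1.sub h'.2.1) ?_
    intro φ hφ hc hs
    simp only [smul_sub]
    rw [integral_sub, sub_eq_zero]
    · have := (h.2.2 φ hφ hc hs).symm.trans (h'.2.2 φ hφ hc hs)
      exact smul_right_injective F (pow_ne_zero _ (by norm_num : (-1 : ℝ) ≠ 0)) this
    · exact integrable_smul_of_locallyIntegrableOn h.2.1 hφ.continuous hc subset_rfl hs
    · exact integrable_smul_of_locallyIntegrableOn h'.2.1 hφ.continuous hc subset_rfl hs
  have hmem : ∀ᵐ z ∂D.vol, z ∈ D.inner := ae_restrict_mem hopen.measurableSet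
  filter_upwards [key, hmem] with z h1 h2
  exact sub_eq_zero.1 (h1 h2)

theorem IsWeakDeriv.self_of_zero [CompleteSpace F] {f g : ℂ → F}
    (h : IsWeakDeriv D D.inner (0, 0) f g) : f =ᵐ[D.vol] g := by
  have h' : IsWeakDeriv D D.inner (0, 0) f f := ⟨h.1, h.1, fun φ _ _ _ => by simp [pderiv]⟩
  exact h'.unique h

theorem HasZeroTrace.zero : HasZeroTrace D (fun _ => (0 : F)) :=
  ⟨⟨_, IsWeakDeriv.zero⟩, ⟨_, IsWeakDeriv.zero⟩⟩

theorem HasZeroTrace.add {f f' : ℂ → F} (h : HasZeroTrace D f) (h' : HasZeroTrace D f') :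
    HasZeroTrace D (fun z => f z + f' z) := by
  obtain ⟨⟨a, ha⟩, ⟨b, hb⟩⟩ := h
  obtain ⟨⟨a', ha'⟩, ⟨b', hb'⟩⟩ := h'
  exact ⟨⟨_, ha.add ha'⟩, ⟨_, hb.add hb'⟩⟩

theorem HasZeroTrace.const_smul {f : ℂ → F} (c : ℝ) (h : HasZeroTrace D f) :
    HasZeroTrace D (fun z => c • f z) := by
  obtain ⟨⟨a, ha⟩, ⟨b, hb⟩⟩ := h
  exact ⟨⟨_, ha.const_smul c⟩, ⟨_, hb.const_smul c⟩⟩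

theorem HasZeroTrace.congr {f f' : ℂ → F} (h : HasZeroTrace D f) (hf : f =ᵐ[D.vol] f') :
    HasZeroTrace D f' := by
  obtain ⟨⟨a, ha⟩, ⟨b, hb⟩⟩ := h
  exact ⟨⟨_, ha.congr hf ae_eq_rfl⟩, ⟨_, hb.congr hf ae_eq_rfl⟩⟩

theorem MemSobolev.zero {k : ℕ} : MemSobolev D k (fun _ => (0 : F)) :=
  fun _ _ => ⟨_, MemLp.zero', IsWeakDeriv.zero⟩

theorem MemSobolev.add {k : ℕ} {f f' : ℂ → F} (h : MemSobolev D k f) (h' : MemSobolev D k f') :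
    MemSobolev D k (fun z => f z + f' z) := fun α hα => by
  obtain ⟨g, hg, hw⟩ := h α hα
  obtain ⟨g', hg', hw'⟩ := h' α hα
  exact ⟨_, hg.add hg', hw.add hw'⟩

theorem MemSobolev.const_smul {k : ℕ} {f : ℂ → F} (c : ℝ) (h : MemSobolev D k f) :
    MemSobolev D k (fun z => c • f z) := fun α hα => by
  obtain ⟨g, hg, hw⟩ := h α hα
  exact ⟨_, hg.const_smul c, hw.const_smul c⟩

theorem MemSobolev.congr {k : ℕ} {f f' : ℂ → F} (h : MemSobolev D k f) (hf : f =ᵐ[D.vol] f') :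
    MemSobolev D k f' := fun α hα => by
  obtain ⟨g, hg, hw⟩ := h α hα
  exact ⟨g, hg, hw.congr hf ae_eq_rfl⟩

end WeakDerivLemmas

theorem act_add {n : ℕ} (M : Mat n) (x y : Cn n) : act M (x + y) = act M x + act M y :=
  map_add _ _ _

theorem act_real_smul {n : ℕ} (M : Mat n) (c : ℝ) (x : Cn n) : act M (c • x) = c • act M x :=
  LinearMap.map_smul_of_tower _ _ _

theorem act_zero {n : ℕ} (M : Mat n) : act M (0 : Cn n) = 0 := map_zero _

theorem act_injective {n : ℕ} {M : Mat n} (hM : IsUnit M) {x : Cn n} (h : act M x = 0) :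
    x = 0 := by
  obtain ⟨u, rfl⟩ := hM
  have h1 : (u : Mat n) *ᵥ x.ofLp = 0 := by
    have := congrArg WithLp.ofLp h
    simpa [act, Matrix.toLpLin_apply] using this
  have h2 : ((↑u⁻¹ : Mat n) * (u : Mat n)) *ᵥ x.ofLp = 0 := by
    rw [← Matrix.mulVec_mulVec, h1, Matrix.mulVec_zero]
  rw [Units.inv_mul, Matrix.one_mulVec] at h2
  ext i
  simpa using congrFun h2 i

/-! ### Weights and weighted Sobolev spaces -/

/-- A weight function associated to the weight vectors `μ`: a smooth map to invertible matrices
that equals `Diag (exp (μ_i^1 |τ|), …, exp (μ_i^n |τ|))` in a neighbourhood of each puncture `p_i`.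
Here `τ` is the longitudinal coordinate on the end, normalized so that the strip has width one;
`c` is the position of the origin of this coordinate. -/
structure Weight (D : StandardDomain) {n : ℕ} (μ : D.Puncture → Fin n → ℝ) where
  /-- the underlying matrix valued function -/
  toFun : ℂ → Mat n
  smooth : ∀ j k, ContDiff ℝ ∞ (fun z => toFun z j k)
  isUnit : ∀ z ∈ D.carrier, IsUnit (toFun z)
  weight_mem : ∀ i j, μ i j ∈ Ioo (-(Real.pi / 2)) (Real.pi / 2)
  eq_diag : ∀ i, ∃ c R : ℝ, ∀ z ∈ D.endPart i R,
    toFun z = Matrix.diagonal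
      (fun j => ((Real.exp (μ i j * |(D.outward i z - c) / D.width i|) : ℝ) : ℂ))

variable {D : StandardDomain} {n : ℕ} {μ : D.Puncture → Fin n → ℝ}

/-- The weighted Sobolev space `H_{k,μ}(Δ, ℂⁿ)`, as a real vector space of functions modulo
equality almost everywhere: all `f` such that `w f` is in `H_k`. (As `w` is smooth with
invertible values, such an `f` is automatically locally in `H_k`.) -/
def weightedSubmodule (w : Weight D μ) (k : ℕ) : Submodule ℝ (ℂ →ₘ[D.vol] Cn n) where
  carrier := {f | MemSobolev D k (fun z => act (w.toFun z) (f z))}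
  zero_mem' := by
    refine MemSobolev.zero.congr ?_
    filter_upwards [AEEqFun.coeFn_zero (β := Cn n) (μ := D.vol)] with z hz
    simp [hz, act_zero]
  add_mem' := by
    intro f g hf hg
    refine (MemSobolev.add hf hg).congr ?_
    filter_upwards [AEEqFun.coeFn_add f g] with z hz
    simp [hz, act_add]
  smul_mem' := by
    intro c f hf
    refine (MemSobolev.const_smul c hf).congr ?_
    filter_upwards [AEEqFun.coeFn_smul c f] with z hz
    rw [hz, Pi.smul_apply, act_real_smul]

/-- The weighted Sobolev space `H_{k,μ}(Δ, ℂⁿ)`. -/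
def WSob (w : Weight D μ) (k : ℕ) : Type := weightedSubmodule w k

instance (w : Weight D μ) (k : ℕ) : AddCommGroup (WSob w k) :=
  inferInstanceAs (AddCommGroup (weightedSubmodule w k))

instance (w : Weight D μ) (k : ℕ) : Module ℝ (WSob w k) :=
  inferInstanceAs (Module ℝ (weightedSubmodule w k))

/-- The underlying function (class) of an element of `H_{k,μ}`. -/
def WSob.val {w : Weight D μ} {k : ℕ} : WSob w k →ₗ[ℝ] (ℂ →ₘ[D.vol] Cn n) :=
  (weightedSubmodule w k).subtype

theorem WSob.val_injective {w : Weight D μ} {k : ℕ} :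
    Function.Injective (WSob.val : WSob w k → _) := Subtype.val_injective

/-- The weak derivative of `w f` of multi-index `α`. -/
def WSob.weightedDeriv {w : Weight D μ} {k : ℕ} (f : WSob w k) (α : multiIndices k) : ℂ → Cn n :=
  (f.2 α.1 α.2).choose

theorem WSob.weightedDeriv_memLp {w : Weight D μ} {k : ℕ} (f : WSob w k) (α : multiIndices k) :
    MemLp (f.weightedDeriv α) 2 D.vol := (f.2 α.1 α.2).choose_spec.1

theorem WSob.weightedDeriv_spec {w : Weight D μ} {k : ℕ} (f : WSob w k) (α : multiIndices k) :
    IsWeakDeriv D D.inner α.1 (fun z => act (w.toFun z) (WSob.val f z)) (f.weightedDeriv α) :=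
  (f.2 α.1 α.2).choose_spec.2

/-- The family of all weak derivatives of `w f` up to order `k`, as an element of an `L²` space. -/
def WSob.jet (w : Weight D μ) (k : ℕ) :
    WSob w k →ₗ[ℝ] PiLp 2 (fun _ : multiIndices k => Lp (Cn n) 2 D.vol) where
  toFun f := WithLp.toLp 2 (fun α => (f.weightedDeriv_memLp α).toLp)
  map_add' f g := by
    ext1 α
    have h1 : IsWeakDeriv D D.inner α.1 (fun z => act (w.toFun z) (WSob.val (f + g) z))
        (fun z => f.weightedDeriv α z + g.weightedDeriv α z) := by
      refine ((f.weightedDeriv_spec α).add (g.weightedDeriv_spec α)).congr ?_ ae_eq_rfl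
      filter_upwards [AEEqFun.coeFn_add (WSob.val f) (WSob.val g)] with z hz
      rw [map_add, hz, Pi.add_apply, act_add]
    have h2 := ((f + g).weightedDeriv_spec α).unique h1
    simp only [PiLp.add_apply]
    rw [← MemLp.toLp_add]
    exact (MemLp.toLp_eq_toLp_iff _ _).2 h2
  map_smul' c f := by
    ext1 α
    have h1 : IsWeakDeriv D D.inner α.1 (fun z => act (w.toFun z) (WSob.val (c • f) z))
        (fun z => c • f.weightedDeriv α z) := by
      refine ((f.weightedDeriv_spec α).const_smul c).congr ?_ ae_eq_rfl
      filter_upwards [AEEqFun.coeFn_smul c (WSob.val f)] with z hz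
      rw [map_smul, hz, Pi.smul_apply, act_real_smul]
    have h2 := ((c • f).weightedDeriv_spec α).unique h1
    simp only [RingHom.id_apply, PiLp.smul_apply]
    rw [← MemLp.toLp_const_smul]
    exact (MemLp.toLp_eq_toLp_iff _ _).2 h2

theorem WSob.jet_injective (w : Weight D μ) (k : ℕ) : Function.Injective (WSob.jet w k) := by
  rw [← LinearMap.ker_eq_bot, LinearMap.ker_eq_bot']
  intro f hf
  have h00 : ((0, 0) : ℕ × ℕ) ∈ multiIndices k := by simp [multiIndices]
  have h1 : (f.weightedDeriv_memLp ⟨_, h00⟩).toLp = 0 := congrFun (congrArg WithLp.ofLp hf) ⟨_, h00⟩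
  have h2 := (f.weightedDeriv_memLp ⟨_, h00⟩).coeFn_toLp
  rw [h1] at h2
  have h3 := (f.weightedDeriv_spec ⟨_, h00⟩).self_of_zero
  apply WSob.val_injective
  rw [map_zero]
  apply AEEqFun.ext
  have hmem : ∀ᵐ z ∂D.vol, z ∈ D.inner := ae_restrict_mem isOpen_interior.measurableSet
  filter_upwards [h2, h3, hmem, Lp.coeFn_zero (Cn n) 2 D.vol,
    AEEqFun.coeFn_zero (β := Cn n) (μ := D.vol)] with z a b c d e
  rw [e]
  apply act_injective (w.isUnit z (interior_subset c))
  rw [b, ← a, d]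
  rfl

/-- The norm `‖f‖_{k,μ} = ‖w f‖_k`, where
`‖u‖_k = (∑_{|α| ≤ k} ‖∂^α u‖²_{L²(Δ)}) ^ (1/2)` is the standard Sobolev norm. -/
instance (w : Weight D μ) (k : ℕ) : NormedAddCommGroup (WSob w k) :=
  NormedAddCommGroup.induced _ _ (WSob.jet w k) (WSob.jet_injective w k)

instance (w : Weight D μ) (k : ℕ) : NormedSpace ℝ (WSob w k) :=
  NormedSpace.induced ℝ (WSob w k) _ (WSob.jet w k)

/-! ### The boundary value problem -/

/-- `H_{1,μ}[0]`: the elements of `H_{1,μ}` that vanish on the boundary. The bundle of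
`(0,1)`-forms is trivialized by evaluation at `∂_τ`. -/
def sobolevOne (w : Weight D μ) : Submodule ℝ (WSob w 1) where
  carrier := {f | HasZeroTrace D (WSob.val f)}
  zero_mem' := by
    refine HasZeroTrace.zero.congr ?_
    rw [map_zero]
    exact (AEEqFun.coeFn_zero (β := Cn n) (μ := D.vol)).symm
  add_mem' := by
    intro f g hf hg
    refine (HasZeroTrace.add hf hg).congr ?_
    rw [map_add]
    exact (AEEqFun.coeFn_add _ _).symm
  smul_mem' := by
    intro c f hf
    refine (HasZeroTrace.const_smul c hf).congr ?_
    rw [map_smul]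
    exact (AEEqFun.coeFn_smul c _).symm

/-- `f = ∂̄ v`, that is `f = ∂_τ v + i ∂_t v`, which is the value of `dv + i ∘ dv ∘ i` at `∂_τ`. -/
def IsDbar (D : StandardDomain) {n : ℕ} (v f : ℂ → Cn n) : Prop :=
  ∃ a b : ℂ → Cn n, IsWeakDeriv D D.inner (1, 0) v a ∧ IsWeakDeriv D D.inner (0, 1) v b ∧
    f =ᵐ[D.vol] fun z => a z + Complex.I • b z

/-- The vector `Im (Mᴴ x) ∈ ℝⁿ`. For unitary `M` it vanishes if and only if `x ∈ M ℝⁿ`. -/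
def normalPart {n : ℕ} (M : Mat n) (x : Cn n) : EuclideanSpace ℝ (Fin n) :=
  WithLp.toLp 2 (fun j => (act Mᴴ x j).im)

theorem normalPart_zero {n : ℕ} (M : Mat n) : normalPart M (0 : Cn n) = 0 := by
  ext j; simp [normalPart, act_zero]

theorem normalPart_add {n : ℕ} (M : Mat n) (x y : Cn n) :
    normalPart M (x + y) = normalPart M x + normalPart M y := by
  ext j; simp [normalPart, act_add]

theorem normalPart_smul {n : ℕ} (M : Mat n) (c : ℝ) (x : Cn n) :
    normalPart M (c • x) = c • normalPart M x := by
  ext j; simp [normalPart, act_real_smul]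

theorem normalPart_eq_zero_iff {n : ℕ} {M : Mat n} (hM : M ∈ Matrix.unitaryGroup (Fin n) ℂ)
    (x : Cn n) : normalPart M x = 0 ↔
      ∃ y : Fin n → ℝ, x = act M (WithLp.toLp 2 (fun j => ((y j : ℝ) : ℂ))) := by
  have e1 : M * Mᴴ = 1 := Matrix.mem_unitaryGroup_iff.1 hM
  have e2 : Mᴴ * M = 1 := Matrix.mem_unitaryGroup_iff'.1 hM
  constructor
  · intro h
    refine ⟨fun j => (act Mᴴ x j).re, ?_⟩
    have : (WithLp.toLp 2 (fun j => (((act Mᴴ x j).re : ℝ) : ℂ)) : Cn n) = act Mᴴ x := by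
      ext j
      have hj : (act Mᴴ x j).im = 0 := by
        have := congrArg (fun u : EuclideanSpace ℝ (Fin n) => u j) h
        simpa [normalPart] using this
      apply Complex.ext <;> simp [hj]
    rw [this]
    ext j
    simp [act, Matrix.toLpLin_apply, Matrix.mulVec_mulVec, e1]
  · rintro ⟨y, rfl⟩
    ext j
    simp [normalPart, act, Matrix.toLpLin_apply, Matrix.mulVec_mulVec, e2]

theorem IsDbar.zero : IsDbar D (fun _ => (0 : Cn n)) (fun _ => 0) :=
  ⟨_, _, IsWeakDeriv.zero, IsWeakDeriv.zero, by simp [EventuallyEq]⟩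

theorem IsDbar.add {v f v' f' : ℂ → Cn n} (h : IsDbar D v f) (h' : IsDbar D v' f') :
    IsDbar D (fun z => v z + v' z) (fun z => f z + f' z) := by
  obtain ⟨a, b, ha, hb, e⟩ := h
  obtain ⟨a', b', ha', hb', e'⟩ := h'
  refine ⟨_, _, ha.add ha', hb.add hb', ?_⟩
  filter_upwards [e, e'] with z h1 h2
  rw [h1, h2, smul_add]
  abel

theorem IsDbar.const_smul {v f : ℂ → Cn n} (c : ℝ) (h : IsDbar D v f) :
    IsDbar D (fun z => c • v z) (fun z => c • f z) := by
  obtain ⟨a, b, ha, hb, e⟩ := h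
  refine ⟨_, _, ha.const_smul c, hb.const_smul c, ?_⟩
  filter_upwards [e] with z h1
  rw [h1, smul_add, smul_comm c Complex.I (b z)]

theorem IsDbar.congr {v f v' f' : ℂ → Cn n} (h : IsDbar D v f) (hv : v =ᵐ[D.vol] v')
    (hf : f =ᵐ[D.vol] f') : IsDbar D v' f' := by
  obtain ⟨a, b, ha, hb, e⟩ := h
  exact ⟨a, b, ha.congr hv ae_eq_rfl, hb.congr hv ae_eq_rfl, hf.symm.trans e⟩

theorem IsDbar.unique {v f f' : ℂ → Cn n} (h : IsDbar D v f) (h' : IsDbar D v f') :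
    f =ᵐ[D.vol] f' := by
  obtain ⟨a, b, ha, hb, e⟩ := h
  obtain ⟨a', b', ha', hb', e'⟩ := h'
  filter_upwards [e, e', ha.unique ha', hb.unique hb'] with z h1 h2 h3 h4
  rw [h1, h2, h3, h4]

/-- `H_{2,μ}[A]`: the elements `v` of `H_{2,μ}` with `v(z) ∈ A(z) ℝⁿ` for `z` on the boundary, and
with `∂̄ v = 0` on the boundary. (For `v ∈ H_{2,μ}` one has `∂̄ v ∈ H_{1,μ}`, so that the last
condition reads `∂̄ v ∈ H_{1,μ}[0]`.) Only the restriction of `A` to the boundary matters. -/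
def sobolevTwo (w : Weight D μ) (A : ℂ → Mat n) : Submodule ℝ (WSob w 2) where
  carrier := {v | HasZeroTrace D (fun z => normalPart (A z) (WSob.val v z)) ∧
    ∃ f : sobolevOne w, IsDbar D (WSob.val v) (WSob.val f.1)}
  zero_mem' := by
    have h0 := (AEEqFun.coeFn_zero (β := Cn n) (μ := D.vol))
    refine ⟨HasZeroTrace.zero.congr ?_, 0, IsDbar.zero.congr ?_ ?_⟩
    · rw [map_zero]
      filter_upwards [h0] with z hz
      rw [hz]
      exact (normalPart_zero _).symm
    · rw [map_zero]; exact h0.symm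
    · rw [ZeroMemClass.coe_zero, map_zero]; exact h0.symm
  add_mem' := by
    rintro v v' ⟨h, f, hf⟩ ⟨h', f', hf'⟩
    refine ⟨(h.add h').congr ?_, f + f', (hf.add hf').congr ?_ ?_⟩
    · rw [map_add]
      filter_upwards [AEEqFun.coeFn_add (WSob.val v) (WSob.val v')] with z hz
      rw [hz]
      exact (normalPart_add _ _ _).symm
    · rw [map_add]; exact (AEEqFun.coeFn_add _ _).symm
    · rw [Submodule.coe_add, map_add]; exact (AEEqFun.coeFn_add _ _).symm
  smul_mem' := by
    rintro c v ⟨h, f, hf⟩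
    refine ⟨(h.const_smul c).congr ?_, c • f, (hf.const_smul c).congr ?_ ?_⟩
    · rw [map_smul]
      filter_upwards [AEEqFun.coeFn_smul c (WSob.val v)] with z hz
      rw [hz]
      exact (normalPart_smul _ _ _).symm
    · rw [map_smul]; exact (AEEqFun.coeFn_smul c _).symm
    · rw [Submodule.coe_smul, map_smul]; exact (AEEqFun.coeFn_smul c _).symm

theorem eq_of_isDbar {w : Weight D μ} {v : ℂ → Cn n} {f f' : sobolevOne w}
    (h : IsDbar D v (WSob.val f.1)) (h' : IsDbar D v (WSob.val f'.1)) : f = f' :=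
  Subtype.ext (WSob.val_injective (AEEqFun.ext (h.unique h')))

/-- The operator `∂̄_A : H_{2,μ}[A] → H_{1,μ}[0]`. -/
def dbar (w : Weight D μ) (A : ℂ → Mat n) : sobolevTwo w A →ₗ[ℝ] sobolevOne w where
  toFun v := v.2.2.choose
  map_add' v v' := by
    refine eq_of_isDbar (v + v').2.2.choose_spec
      ((v.2.2.choose_spec.add v'.2.2.choose_spec).congr ?_ ?_)
    · rw [Submodule.coe_add, map_add]; exact (AEEqFun.coeFn_add _ _).symm
    · rw [Submodule.coe_add, map_add]; exact (AEEqFun.coeFn_add _ _).symm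
  map_smul' c v := by
    refine eq_of_isDbar (c • v).2.2.choose_spec ((v.2.2.choose_spec.const_smul c).congr ?_ ?_)
    · rw [Submodule.coe_smul, map_smul]; exact (AEEqFun.coeFn_smul c _).symm
    · rw [RingHom.id_apply, Submodule.coe_smul, map_smul]; exact (AEEqFun.coeFn_smul c _).symm

theorem dbar_spec (w : Weight D μ) (A : ℂ → Mat n) (v : sobolevTwo w A) :
    IsDbar D (WSob.val v.1) (WSob.val (dbar w A v).1) := v.2.2.choose_spec

/-- `Ker ∂̄_A`, as a real subspace of `H_{2,μ}(Δ, ℂⁿ)`. -/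
def kernel (w : Weight D μ) (A : ℂ → Mat n) : Submodule ℝ (WSob w 2) :=
  (LinearMap.ker (dbar w A)).map (sobolevTwo w A).subtype

/-- The pair `(A, w)` is admissible: `∂̄_A` is a (bounded) Fredholm operator. -/
def IsAdmissible (w : Weight D μ) (A : ℂ → Mat n) : Prop :=
  ∃ T : sobolevTwo w A →L[ℝ] sobolevOne w, (T : sobolevTwo w A →ₗ[ℝ] sobolevOne w) = dbar w A ∧
    T.IsFredholm

/-! ### Families of boundary conditions -/

/-- The norm `‖A‖_{C^k} = ∑_{|α| ≤ k} sup_{z ∈ X} max_{i,j} |∂^α a_{ij}(z)|`, in `[0, ∞]`. -/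
def cNorm (k : ℕ) (X : Set ℂ) {n : ℕ} (A : ℂ → Mat n) : ℝ≥0∞ :=
  ∑ α ∈ multiIndices k, ⨆ z ∈ X, ⨆ (i : Fin n) (j : Fin n), ‖pderiv α (fun x => A x i j) z‖ₑ

/-- `C²`-admissible families `A_λ`, `λ ∈ [0, 1]`, of trivialized Lagrangian boundary conditions
with respect to a fixed weight. Each `A_λ` is a smooth map `Δ → GL(n, ℂ)` up to the boundary (that
is, the restriction of a smooth map on the plane) that takes values in `U(n)` on `∂Δ`. -/
structure IsC2Admissible (w : Weight D μ) (A : ℝ → ℂ → Mat n) : Prop where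
  smooth : ∀ l ∈ Icc (0 : ℝ) 1, ∀ i j, ContDiff ℝ ∞ (fun z => A l z i j)
  invertible : ∀ l ∈ Icc (0 : ℝ) 1, ∀ z ∈ D.carrier, IsUnit (A l z)
  unitary : ∀ l ∈ Icc (0 : ℝ) 1, ∀ z ∈ frontier D.carrier, A l z ∈ Matrix.unitaryGroup (Fin n) ℂ
  admissible : ∀ l ∈ Icc (0 : ℝ) 1, IsAdmissible w (A l)
  bounded : ∀ l ∈ Icc (0 : ℝ) 1, cNorm 2 D.carrier (A l) ≠ ⊤
  continuous : ∀ l ∈ Icc (0 : ℝ) 1,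
    Tendsto (fun l' => cNorm 2 D.carrier (A l' - A l)) (𝓝[Icc 0 1] l) (𝓝 0)
  dbar_eq_zero : ∀ l ∈ Icc (0 : ℝ) 1, ∀ z ∈ frontier D.carrier, ∀ i j,
    pderiv (1, 0) (fun x => A l x i j) z + Complex.I * pderiv (0, 1) (fun x => A l x i j) z = 0

/-- Near each puncture `p_i` the matrices `A_λ` split according to the weights: they do not mix
coordinate directions with different weights, that is, they commute with the weight function. -/
def SplitsAtPunctures (D : StandardDomain) {n : ℕ} (μ : D.Puncture → Fin n → ℝ)
    (A : ℝ → ℂ → Mat n) : Prop :=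
  ∃ R : ℝ, ∀ l ∈ Icc (0 : ℝ) 1, ∀ i, ∀ z ∈ D.endPart i R, ∀ j k, μ i j ≠ μ i k → A l z j k = 0

end KernelFamily

end

open KernelFamily

open MeasureTheory Set Filter Topology
open scoped ENNReal NNReal ContDiff Matrix

noncomputable section

/-! All operators `∂̄_A` are restrictions of one bounded operator `T : H_{2,μ} → H_{1,μ}`
(`exists_dbarFull`), so only the domain `H_{2,μ}[A_λ]`, a closed subspace of a fixed Banach space,
moves with `λ`. Multiplication by `1 + E_λ`, where `E_λ = (A_λ - A_0) u(A_0)` and `u(a) = 2a† - a† a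
a†`, carries the domain at `0` into the domain at `λ` (`change_mem_sobolevTwo`). Indeed, on the
boundary `1 + E_λ` equals `A_λ A_0⁻¹`, which moves the Lagrangian condition. Moreover `∂̄E_λ = 0`
there: by `u(a) a = 1 - (1 - a† a)²`, the polynomial `u(a)` is inverse to `a` to first order at
unitary points. Hence `∂̄(v + E_λ v)` still vanishes on the boundary. The polynomial `u` replaces
the inverse because no bound on `A_0⁻¹` inside the domain is assumed.

The estimate `‖E_λ‖ ≤ K ‖A_λ - A_0‖_{C²}` on the weighted space (`exists_changeOp_bound`) amounts to
a `C²`-bound on `w E_λ w⁻¹`. Near the punctures `E_λ` commutes with `w`, since directions of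
different weights are not mixed, and the weight cancels; the remaining part of the domain is
compact.

The rest is functional analysis (`exists_kernel_equiv`). As `∂̄_{A_0}` is Fredholm and surjective,
it has a bounded right inverse `R`. On the domain at `0` one has `T (1 + E_λ) = T S_λ` with `S_λ = 1
+ R T E_λ`, and for small `λ` this `S_λ` is an automorphism of that domain. So `(1 + E_λ) S_λ⁻¹`
maps the kernel at `0` isomorphically onto the kernel at `λ`. It differs from the identity by
`O(‖E_λ‖)` and is continuous in `λ` together with its inverse; the images of a basis form the frame.

The analytic groundwork consists of weak product rules, the vanishing of traces of products
(`hasZeroTrace_bilin_of_eq_zero_on_frontier`), and the completeness and closedness of the spaces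
involved. -/

namespace KernelFamily

set_option maxSynthPendingDepth 3

/-! ### Partial derivatives and `C^k`-bounds of smooth functions. -/

section Calculus

variable {G G' G'' : Type*} [NormedAddCommGroup G] [NormedSpace ℝ G]
  [NormedAddCommGroup G'] [NormedSpace ℝ G'] [NormedAddCommGroup G''] [NormedSpace ℝ G'']

/-- The direction of a first order partial derivative. -/
def unitDir (α : ℕ × ℕ) : ℂ := if α.1 = 1 then 1 else Complex.I

theorem pderiv_eq_dirDeriv {α : ℕ × ℕ} (hα : α.1 + α.2 = 1) (φ : ℂ → G) :
    pderiv α φ = dirDeriv (unitDir α) φ := by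
  obtain ⟨a, b⟩ := α
  obtain ⟨rfl, rfl⟩ | ⟨rfl, rfl⟩ : (a = 1 ∧ b = 0) ∨ (a = 0 ∧ b = 1) := by
    simp only at hα; omega
  · simp [pderiv, unitDir]
  · simp [pderiv, unitDir]

theorem contDiffAt_dirDeriv {e : ℂ} {a : ℂ → G} {z : ℂ} (h : ContDiffAt ℝ ∞ a z) :
    ContDiffAt ℝ ∞ (dirDeriv e a) z :=
  (h.fderiv_right (m := ∞) (by simp)).clm_apply contDiffAt_const

theorem contDiffAt_pderiv {α : ℕ × ℕ} (hα : α.1 + α.2 = 1) {a : ℂ → G} {z : ℂ}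
    (h : ContDiffAt ℝ ∞ a z) : ContDiffAt ℝ ∞ (pderiv α a) z := by
  rw [pderiv_eq_dirDeriv hα]; exact contDiffAt_dirDeriv h

theorem _root_.ContDiffAt.differentiableAt_of_top {a : ℂ → G} {z : ℂ}
    (h : ContDiffAt ℝ ∞ a z) : DifferentiableAt ℝ a z :=
  h.differentiableAt (by simp)

theorem _root_.ContDiffAt.eventually_differentiableAt_of_top {a : ℂ → G} {z : ℂ}
    (h : ContDiffAt ℝ ∞ a z) : ∀ᶠ x in 𝓝 z, DifferentiableAt ℝ a x :=
  ((h.of_le (m := 1) (by simp)).eventually (by simp)).mono fun _ hx => hx.differentiableAt (by simp)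

theorem pderiv_congr {α : ℕ × ℕ} (hα : α.1 + α.2 = 1) {a b : ℂ → G} {z : ℂ}
    (h : a =ᶠ[𝓝 z] b) : pderiv α a =ᶠ[𝓝 z] pderiv α b := by
  rw [pderiv_eq_dirDeriv hα, pderiv_eq_dirDeriv hα]
  filter_upwards [h.fderiv (𝕜 := ℝ)] with x hx
  simp [dirDeriv, hx]

theorem pderiv_add_apply {α : ℕ × ℕ} (hα : α.1 + α.2 = 1) {a b : ℂ → G} {z : ℂ}
    (ha : DifferentiableAt ℝ a z) (hb : DifferentiableAt ℝ b z) :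
    pderiv α (fun x => a x + b x) z = pderiv α a z + pderiv α b z := by
  simp only [pderiv_eq_dirDeriv hα, dirDeriv]
  rw [fderiv_fun_add ha hb]
  rfl

theorem pderiv_clm_apply (L : G →L[ℝ] G') {α : ℕ × ℕ} (hα : α.1 + α.2 = 1) {a : ℂ → G} {z : ℂ}
    (ha : DifferentiableAt ℝ a z) : pderiv α (fun x => L (a x)) z = L (pderiv α a z) := by
  simp only [pderiv_eq_dirDeriv hα, dirDeriv]
  rw [show (fun x => L (a x)) = L ∘ a from rfl, (L.hasFDerivAt.comp z ha.hasFDerivAt).fderiv]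
  rfl

theorem pderiv_bilin_apply (B : G →L[ℝ] G' →L[ℝ] G'') {α : ℕ × ℕ} (hα : α.1 + α.2 = 1)
    {a : ℂ → G} {b : ℂ → G'} {z : ℂ} (ha : DifferentiableAt ℝ a z) (hb : DifferentiableAt ℝ b z) :
    pderiv α (fun x => B (a x) (b x)) z = B (pderiv α a z) (b z) + B (a z) (pderiv α b z) := by
  simp only [pderiv_eq_dirDeriv hα, dirDeriv]
  rw [(B.hasFDerivAt_of_bilinear ha.hasFDerivAt
    hb.hasFDerivAt).fderiv]
  simp [ContinuousLinearMap.precompR, ContinuousLinearMap.precompL, add_comm]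

theorem contDiffAt_bilin (B : G →L[ℝ] G' →L[ℝ] G'') {a : ℂ → G} {b : ℂ → G'} {z : ℂ}
    (ha : ContDiffAt ℝ ∞ a z) (hb : ContDiffAt ℝ ∞ b z) :
    ContDiffAt ℝ ∞ (fun x => B (a x) (b x)) z :=
  (B.contDiff.contDiffAt.comp z ha).clm_apply hb

theorem contDiffAt_clm (L : G →L[ℝ] G') {a : ℂ → G} {z : ℂ}
    (ha : ContDiffAt ℝ ∞ a z) : ContDiffAt ℝ ∞ (fun x => L (a x)) z :=
  L.contDiff.contDiffAt.comp z ha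

theorem dirDeriv_comm {e e' : ℂ} {φ : ℂ → G} (h : ContDiff ℝ ∞ φ) :
    dirDeriv e (dirDeriv e' φ) = dirDeriv e' (dirDeriv e φ) := by
  funext z
  have hd : DifferentiableAt ℝ (fderiv ℝ φ) z :=
    (h.fderiv_right (m := ∞) (by simp)).contDiffAt.differentiableAt_of_top
  have key : ∀ u v : ℂ, dirDeriv u (dirDeriv v φ) z = fderiv ℝ (fderiv ℝ φ) z u v := by
    intro u v
    unfold dirDeriv
    rw [fderiv_clm_apply hd (differentiableAt_const _)]
    simp
  rw [key, key]
  exact ((contDiff_infty.1 h 2).contDiffAt.isSymmSndFDerivAt (by simp)) e e'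

theorem dirDeriv_pderiv_right (a b : ℕ) {φ : ℂ → G} (h : ContDiff ℝ ∞ φ) :
    dirDeriv Complex.I (pderiv (a, b) φ) = pderiv (a, b + 1) φ := by
  have h' : ContDiff ℝ ∞ ((dirDeriv Complex.I)^[b] φ) := contDiff_iterate _ _ h
  simp only [pderiv, Function.iterate_succ_apply']
  generalize (dirDeriv Complex.I)^[b] φ = ψ at h'
  induction a with
  | zero => rfl
  | succ a ih =>
    rw [Function.iterate_succ_apply', Function.iterate_succ_apply', ← ih,
      dirDeriv_comm (contDiff_iterate _ _ h')]

theorem dirDeriv_pderiv_left (a b : ℕ) (φ : ℂ → G) :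
    dirDeriv 1 (pderiv (a, b) φ) = pderiv (a + 1, b) φ := by
  simp only [pderiv, Function.iterate_succ_apply']

theorem pderiv_pderiv {α β : ℕ × ℕ} (hα : α.1 + α.2 = 1) {φ : ℂ → G} (h : ContDiff ℝ ∞ φ) :
    pderiv α (pderiv β φ) = pderiv (β + α) φ := by
  rw [pderiv_eq_dirDeriv hα]
  obtain ⟨a, b⟩ := α
  obtain ⟨c, d⟩ := β
  obtain ⟨rfl, rfl⟩ | ⟨rfl, rfl⟩ : (a = 1 ∧ b = 0) ∨ (a = 0 ∧ b = 1) := by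
    simp only at hα; omega
  · simpa [unitDir] using dirDeriv_pderiv_left c d φ
  · simpa [unitDir] using dirDeriv_pderiv_right c d h

/-- `a` is smooth at the points of `X`, where its partial derivatives of order at most `k` are
bounded by `C`. -/
def CBound (X : Set ℂ) : ℕ → (ℂ → G) → ℝ≥0 → Prop
  | 0, a, C => ∀ z ∈ X, ContDiffAt ℝ ∞ a z ∧ ‖a z‖ ≤ C
  | k + 1, a, C => (∀ z ∈ X, ContDiffAt ℝ ∞ a z ∧ ‖a z‖ ≤ C) ∧
      ∀ α : ℕ × ℕ, α.1 + α.2 = 1 → CBound X k (pderiv α a) C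

namespace CBound

variable {X Y : Set ℂ} {k : ℕ} {C C' : ℝ≥0}

theorem base {a : ℂ → G} (h : CBound X k a C) : ∀ z ∈ X, ContDiffAt ℝ ∞ a z ∧ ‖a z‖ ≤ C := by
  cases k with
  | zero => exact h
  | succ k => exact h.1

theorem smooth {a : ℂ → G} (h : CBound X k a C) {z : ℂ} (hz : z ∈ X) : ContDiffAt ℝ ∞ a z :=
  (h.base z hz).1

theorem mono {a : ℂ → G} (h : CBound X k a C) (hC : C ≤ C') (hXY : Y ⊆ X) :
    CBound Y k a C' := by
  induction k generalizing a with
  | zero => exact fun z hz => ⟨(h z (hXY hz)).1, (h z (hXY hz)).2.trans (by exact_mod_cast hC)⟩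
  | succ k ih =>
    exact ⟨fun z hz => ⟨(h.1 z (hXY hz)).1, (h.1 z (hXY hz)).2.trans (by exact_mod_cast hC)⟩,
      fun α hα => ih (h.2 α hα)⟩

theorem of_succ {a : ℂ → G} (h : CBound X (k + 1) a C) : CBound X k a C := by
  induction k generalizing a with
  | zero => exact h.1
  | succ k ih => exact ⟨h.1, fun α hα => ih (h.2 α hα)⟩

/-- Equality near each point of `X`, not only on `X`, is what makes the derivatives agree as well.
-/
theorem congr {a b : ℂ → G} (h : CBound X k a C) (hab : ∀ z ∈ X, a =ᶠ[𝓝 z] b) :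
    CBound X k b C := by
  have base : ∀ z ∈ X, ContDiffAt ℝ ∞ b z ∧ ‖b z‖ ≤ C := fun z hz =>
    ⟨(h.smooth hz).congr_of_eventuallyEq (hab z hz).symm,
      (hab z hz).self_of_nhds ▸ (h.base z hz).2⟩
  induction k generalizing a b with
  | zero => exact base
  | succ k ih =>
    refine ⟨base, fun α hα => ?_⟩
    have h2 : ∀ z ∈ X, pderiv α a =ᶠ[𝓝 z] pderiv α b := fun z hz => pderiv_congr hα (hab z hz)
    refine ih (h.2 α hα) h2 fun z hz => ?_
    exact ⟨contDiffAt_pderiv hα (base z hz).1,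
      (h2 z hz).self_of_nhds ▸ ((h.2 α hα).base z hz).2⟩

theorem union {a : ℂ → G} (h : CBound X k a C) (h' : CBound Y k a C) : CBound (X ∪ Y) k a C := by
  induction k generalizing a with
  | zero => exact fun z hz => hz.elim (h z) (h' z)
  | succ k ih => exact ⟨fun z hz => hz.elim (h.1 z) (h'.1 z), fun α hα => ih (h.2 α hα) (h'.2 α hα)⟩

theorem iUnion {ι : Type*} {X : ι → Set ℂ} {a : ℂ → G} (h : ∀ i, CBound (X i) k a C) :
    CBound {z | ∃ i, z ∈ X i} k a C := by
  induction k generalizing a with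
  | zero => exact fun z ⟨i, hz⟩ => h i z hz
  | succ k ih => exact ⟨fun z ⟨i, hz⟩ => (h i).1 z hz, fun α hα => ih fun i => (h i).2 α hα⟩

theorem add {a b : ℂ → G} (h : CBound X k a C) (h' : CBound X k b C') :
    CBound X k (fun z => a z + b z) (C + C') := by
  have base : ∀ z ∈ X, ContDiffAt ℝ ∞ (fun z => a z + b z) z ∧ ‖a z + b z‖ ≤ (C + C' : ℝ≥0) :=
    fun z hz => ⟨(h.smooth hz).add (h'.smooth hz), by
      push_cast; exact (norm_add_le _ _).trans (add_le_add (h.base z hz).2 (h'.base z hz).2)⟩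
  induction k generalizing a b with
  | zero => exact base
  | succ k ih =>
    refine ⟨base, fun α hα => ?_⟩
    have key := ih (h.2 α hα) (h'.2 α hα) fun z hz =>
      ⟨((h.2 α hα).smooth hz).add ((h'.2 α hα).smooth hz), by
        push_cast
        exact (norm_add_le _ _).trans
          (add_le_add ((h.2 α hα).base z hz).2 ((h'.2 α hα).base z hz).2)⟩
    refine key.congr fun z hz => ?_
    filter_upwards [(h.smooth hz).eventually_differentiableAt_of_top,
      (h'.smooth hz).eventually_differentiableAt_of_top]
      with x hx hx'
    exact (pderiv_add_apply hα hx hx').symm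

/-- The Leibniz rule fits the recursion of `CBound`: a first derivative of the product is a sum of
two products bounded to one order less, so the constant doubles with each order. -/
theorem bilin (B : G →L[ℝ] G' →L[ℝ] G'') {a : ℂ → G} {b : ℂ → G'} (h : CBound X k a C)
    (h' : CBound X k b C') : CBound X k (fun z => B (a z) (b z)) (2 ^ k * (‖B‖₊ * C * C')) := by
  have base : ∀ (j : ℕ) (a : ℂ → G) (b : ℂ → G'), CBound X j a C → CBound X j b C' → ∀ z ∈ X,
      ContDiffAt ℝ ∞ (fun z => B (a z) (b z)) z ∧
        ‖B (a z) (b z)‖ ≤ (2 ^ j * (‖B‖₊ * C * C') : ℝ≥0) := fun j a b ha hb z hz => by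
    refine ⟨contDiffAt_bilin B (ha.smooth hz) (hb.smooth hz), ?_⟩
    have h1 := (ha.base z hz).2
    have h2 := (hb.base z hz).2
    calc ‖B (a z) (b z)‖ ≤ ‖B‖ * ‖a z‖ * ‖b z‖ := B.le_opNorm₂ _ _
      _ ≤ ‖B‖ * C * C' := by gcongr
      _ ≤ 2 ^ j * (‖B‖ * C * C') :=
        le_mul_of_one_le_left (by positivity) (one_le_pow₀ (by norm_num))
      _ = _ := by push_cast; rfl
  induction k generalizing a b with
  | zero => exact base 0 a b h h'
  | succ k ih =>
    refine ⟨base _ a b h h', fun α hα => ?_⟩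
    have key := (ih (h.2 α hα) h'.of_succ).add (ih h.of_succ (h'.2 α hα))
    rw [← two_mul, ← mul_assoc, ← pow_succ'] at key
    refine key.congr fun z hz => ?_
    filter_upwards [(h.smooth hz).eventually_differentiableAt_of_top,
      (h'.smooth hz).eventually_differentiableAt_of_top]
      with x hx hx'
    exact (pderiv_bilin_apply B hα hx hx').symm

theorem clm (L : G →L[ℝ] G') {a : ℂ → G} (h : CBound X k a C) :
    CBound X k (fun z => L (a z)) (‖L‖₊ * C) := by
  have g0 : ∀ a : ℂ → G, (∀ z ∈ X, ContDiffAt ℝ ∞ a z ∧ ‖a z‖ ≤ C) →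
      ∀ z ∈ X, ContDiffAt ℝ ∞ (fun z => L (a z)) z ∧ ‖L (a z)‖ ≤ (‖L‖₊ * C : ℝ≥0) :=
    fun a ha z hz => ⟨contDiffAt_clm L (ha z hz).1, (L.le_opNorm _).trans (by
      push_cast; gcongr; exact (ha z hz).2)⟩
  induction k generalizing a with
  | zero => exact g0 a h
  | succ k ih =>
    refine ⟨g0 a h.1, fun α hα => (ih (h.2 α hα)).congr fun z hz => ?_⟩
    filter_upwards [(h.smooth hz).eventually_differentiableAt_of_top] with x hx
    exact (pderiv_clm_apply L hα hx).symm

theorem of_isCompact {K : Set ℂ} (hK : IsCompact K) (k : ℕ) {a : ℂ → G}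
    (h : ∀ z ∈ K, ContDiffAt ℝ ∞ a z) : ∃ C, CBound K k a C := by
  have g0 : ∀ a : ℂ → G, (∀ z ∈ K, ContDiffAt ℝ ∞ a z) →
      ∃ C : ℝ≥0, ∀ z ∈ K, ContDiffAt ℝ ∞ a z ∧ ‖a z‖ ≤ C := by
    intro a ha
    obtain ⟨C, hC⟩ := hK.exists_bound_of_continuousOn
      (fun z hz => (ha z hz).continuousAt.continuousWithinAt)
    exact ⟨C.toNNReal, fun z hz => ⟨ha z hz, (hC z hz).trans (Real.le_coe_toNNReal C)⟩⟩
  induction k generalizing a with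
  | zero => exact g0 a h
  | succ k ih =>
    obtain ⟨C₀, h0⟩ := g0 a h
    obtain ⟨C₁, h1⟩ := ih (a := pderiv (1, 0) a) fun z hz => contDiffAt_pderiv rfl (h z hz)
    obtain ⟨C₂, h2⟩ := ih (a := pderiv (0, 1) a) fun z hz => contDiffAt_pderiv rfl (h z hz)
    refine ⟨C₀ + C₁ + C₂, fun z hz => ⟨h z hz, (h0 z hz).2.trans ?_⟩, fun α hα => ?_⟩
    · exact_mod_cast (le_self_add.trans le_self_add : C₀ ≤ C₀ + C₁ + C₂)
    · obtain ⟨c, d⟩ := α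
      obtain ⟨rfl, rfl⟩ | ⟨rfl, rfl⟩ : (c = 1 ∧ d = 0) ∨ (c = 0 ∧ d = 1) := by
        simp only at hα; omega
      · exact h1.mono (le_add_self.trans le_self_add) subset_rfl
      · exact h2.mono le_add_self subset_rfl

theorem const (x : G) : CBound X k (fun _ => x) ‖x‖₊ := by
  have zero : ∀ k, CBound X k (fun _ => (0 : G)) ‖x‖₊ := by
    intro k
    induction k with
    | zero => exact fun z _ => ⟨contDiffAt_const, by simp⟩
    | succ k ih =>
      refine ⟨fun z _ => ⟨contDiffAt_const, by simp⟩, fun α hα => ih.congr fun z _ => ?_⟩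
      rw [pderiv_eq_dirDeriv hα]
      exact Eventually.of_forall fun y => by simp [dirDeriv]
  cases k with
  | zero => exact fun z _ => ⟨contDiffAt_const, by simp⟩
  | succ k =>
    refine ⟨fun z _ => ⟨contDiffAt_const, by simp⟩, fun α hα => (zero k).congr fun z _ => ?_⟩
    rw [pderiv_eq_dirDeriv hα]
    exact Eventually.of_forall fun y => by simp [dirDeriv]

end CBound

end Calculus

/-! ### Product rules and composition of weak derivatives; Sobolev bounds. -/

section WeakCalculus

variable {F F' G : Type*} [NormedAddCommGroup F] [NormedSpace ℝ F]
  [NormedAddCommGroup F'] [NormedSpace ℝ F'] [NormedAddCommGroup G] [NormedSpace ℝ G]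
  {D : StandardDomain} {S : Set ℂ} {α β : ℕ × ℕ}

theorem integrable_smul_test {f : ℂ → F} (hf : LocallyIntegrableOn f S D.vol) {φ : ℂ → ℝ}
    (hφ : Continuous φ) (hc : HasCompactSupport φ) (hs : tsupport φ ⊆ S) :
    Integrable (fun z => φ z • f z) D.vol :=
  integrable_smul_of_locallyIntegrableOn hf hφ hc subset_rfl hs

theorem IsWeakDeriv.mono {T : Set ℂ} {f g : ℂ → F} (h : IsWeakDeriv D S α f g) (hT : T ⊆ S) :
    IsWeakDeriv D T α f g :=
  ⟨h.1.mono_set hT, h.2.1.mono_set hT, fun φ hφ hc hs => h.2.2 φ hφ hc (hs.trans hT)⟩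

theorem locallyIntegrableOn_clm (L : F →L[ℝ] F') {f : ℂ → F} {m : Measure ℂ}
    (h : LocallyIntegrableOn f S m) : LocallyIntegrableOn (fun z => L (f z)) S m := fun x hx => by
  obtain ⟨T, hT, hi⟩ := h x hx
  exact ⟨T, hT, L.integrable_comp hi⟩

theorem IsWeakDeriv.clm [CompleteSpace F] [CompleteSpace F'] (L : F →L[ℝ] F') {f g : ℂ → F}
    (h : IsWeakDeriv D S α f g) :
    IsWeakDeriv D S α (fun z => L (f z)) (fun z => L (g z)) := by
  refine ⟨locallyIntegrableOn_clm L h.1, locallyIntegrableOn_clm L h.2.1, fun φ hφ hc hs => ?_⟩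
  have hp := integrable_smul_test h.1 (contDiff_pderiv α hφ).continuous
    (hc.of_isClosed_subset (isClosed_tsupport _) (tsupport_pderiv α φ))
    ((tsupport_pderiv α φ).trans hs)
  have hq := integrable_smul_test h.2.1 hφ.continuous hc hs
  simp only [← map_smul]
  rw [L.integral_comp_comm hp, L.integral_comp_comm hq, h.2.2 φ hφ hc hs, map_smul]

theorem LocallyIntegrableOn.congr_on {F : Type*} [NormedAddCommGroup F] {m : Measure ℂ}
    (hS : IsOpen S) {f f' : ℂ → F} (h : LocallyIntegrableOn f S m) (hf : EqOn f f' S) :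
    LocallyIntegrableOn f' S m := by
  intro x hx
  obtain ⟨T, hT, hi⟩ := h x hx
  have hST : S ∩ T ∈ 𝓝[S] x := inter_mem self_mem_nhdsWithin hT
  obtain ⟨U, hU, hxU, hUS⟩ := mem_nhdsWithin.1 hST
  refine ⟨U ∩ S, inter_mem (mem_nhdsWithin_of_mem_nhds (hU.mem_nhds hxU)) self_mem_nhdsWithin, ?_⟩
  refine (hi.mono_set (hUS.trans inter_subset_right)).congr_fun (fun z hz => hf hz.2)
    (hU.measurableSet.inter hS.measurableSet)

theorem IsWeakDeriv.congr_on (hS : IsOpen S) {f f' g g' : ℂ → F} (h : IsWeakDeriv D S α f g)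
    (hf : EqOn f f' S) (hg : EqOn g g' S) : IsWeakDeriv D S α f' g' := by
  refine ⟨LocallyIntegrableOn.congr_on hS h.1 hf, LocallyIntegrableOn.congr_on hS h.2.1 hg,
    fun φ hφ hc hs => ?_⟩
  have aux : ∀ (ψ : ℂ → ℝ) (u u' : ℂ → F), tsupport ψ ⊆ S → EqOn u u' S →
      (fun z => ψ z • u' z) = fun z => ψ z • u z := by
    intro ψ u u' hψ hu
    funext z
    by_cases hz : z ∈ S
    · rw [hu hz]
    · rw [image_eq_zero_of_notMem_tsupport fun h => hz (hψ h), zero_smul, zero_smul]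
  rw [aux _ _ _ ((tsupport_pderiv α φ).trans hs) hf, aux _ _ _ hs hg]
  exact h.2.2 φ hφ hc hs

theorem IsWeakDeriv.sum {ι : Type*} (s : Finset ι) {f g : ι → ℂ → F}
    (h : ∀ i ∈ s, IsWeakDeriv D S α (f i) (g i)) :
    IsWeakDeriv D S α (fun z => ∑ i ∈ s, f i z) (fun z => ∑ i ∈ s, g i z) := by
  classical
  induction s using Finset.induction_on with
  | empty => simpa using IsWeakDeriv.zero
  | insert i s hi ih =>
    simp only [Finset.sum_insert hi]
    exact (h i (Finset.mem_insert_self i s)).add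
      (ih fun j hj => h j (Finset.mem_insert_of_mem hj))

theorem contDiff_mul_test {a φ : ℂ → ℝ} (ha : ∀ z ∈ S, ContDiffAt ℝ ∞ a z)
    (hφ : ContDiff ℝ ∞ φ) (hs : tsupport φ ⊆ S) : ContDiff ℝ ∞ (fun z => φ z * a z) := by
  rw [contDiff_iff_contDiffAt]
  intro z
  by_cases hz : z ∈ tsupport φ
  · exact hφ.contDiffAt.mul (ha z (hs hz))
  · have : (fun z => φ z * a z) =ᶠ[𝓝 z] fun _ => 0 := by
      filter_upwards [(isClosed_tsupport φ).isOpen_compl.mem_nhds hz] with x hx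
      rw [image_eq_zero_of_notMem_tsupport hx, zero_mul]
    exact contDiffAt_const.congr_of_eventuallyEq this

theorem tsupport_mul_subset (φ a : ℂ → ℝ) : tsupport (fun z => φ z * a z) ⊆ tsupport φ :=
  closure_mono fun z hz h0 => hz (by simp [h0])

/-- If `φ` is a test function supported in `S`, then so is `φ a`, although `a` is smooth only at the
points of `S`. Testing against `φ a` and expanding its derivative gives the formula. -/
theorem IsWeakDeriv.smul_fun (hS : IsOpen S) (hα : α.1 + α.2 = 1) {a : ℂ → ℝ}
    (ha : ∀ z ∈ S, ContDiffAt ℝ ∞ a z) {f g : ℂ → F} (h : IsWeakDeriv D S α f g) :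
    IsWeakDeriv D S α (fun z => a z • f z) (fun z => pderiv α a z • f z + a z • g z) := by
  have hac : ContinuousOn a S := fun z hz => (ha z hz).continuousAt.continuousWithinAt
  have hdc : ContinuousOn (pderiv α a) S := fun z hz =>
    (contDiffAt_pderiv hα (ha z hz)).continuousAt.continuousWithinAt
  have i1 := h.1.continuousOn_smul hS.isLocallyClosed hac
  have i2 := h.2.1.continuousOn_smul hS.isLocallyClosed hac
  have i3 := h.1.continuousOn_smul hS.isLocallyClosed hdc
  refine ⟨i1, i3.add i2, fun φ hφ hc hs => ?_⟩
  have hcd : HasCompactSupport (pderiv α φ) :=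
    hc.of_isClosed_subset (isClosed_tsupport _) (tsupport_pderiv α φ)
  have hsd := (tsupport_pderiv α φ).trans hs
  have hm := contDiff_mul_test ha hφ hs
  have key := h.2.2 _ hm (hc.of_isClosed_subset (isClosed_tsupport _) (tsupport_mul_subset φ a))
    ((tsupport_mul_subset φ a).trans hs)
  have e1 : ∀ z, pderiv α (fun z => φ z * a z) z • f z =
      pderiv α φ z • a z • f z + φ z • pderiv α a z • f z := by
    intro z
    by_cases hz : z ∈ tsupport φ
    · have := pderiv_bilin_apply (ContinuousLinearMap.mul ℝ ℝ) hα
        (hφ.contDiffAt (x := z)).differentiableAt_of_top (ha z (hs hz)).differentiableAt_of_top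
      simp only [ContinuousLinearMap.mul_apply'] at this
      rw [this, add_smul, mul_smul, mul_smul]
    · have h1 : z ∉ tsupport (pderiv α φ) := fun h => hz (tsupport_pderiv α φ h)
      have h2 : z ∉ tsupport (pderiv α (fun z => φ z * a z)) := fun h =>
        hz (tsupport_mul_subset φ a (tsupport_pderiv α _ h))
      rw [image_eq_zero_of_notMem_tsupport h1, image_eq_zero_of_notMem_tsupport h2,
        image_eq_zero_of_notMem_tsupport hz]
      simp
  simp only [e1, mul_smul, hα, pow_one] at key ⊢
  have hpc := (contDiff_pderiv α hφ).continuous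
  have j1 := integrable_smul_test i1 hpc hcd hsd
  have j2 := integrable_smul_test i3 hφ.continuous hc hs
  have j3 := integrable_smul_test i2 hφ.continuous hc hs
  rw [integral_add j1 j2] at key
  simp only [smul_add (φ _)]
  rw [integral_add j2 j3, eq_sub_of_add_eq key, smul_add]
  simp only [neg_smul, one_smul]
  abel

theorem bilin_eq_sum [FiniteDimensional ℝ G] (B : G →L[ℝ] F →L[ℝ] F') (a : G) (x : F) :
    B a x = ∑ i, (Module.finBasis ℝ G).repr a i • B (Module.finBasis ℝ G i) x := by
  calc B a x = B (∑ i, (Module.finBasis ℝ G).repr a i • Module.finBasis ℝ G i) x := by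
        rw [Module.Basis.sum_repr]
    _ = _ := by
        simp only [map_sum, map_smul, sum_apply, smul_apply]

/-- A coordinate with respect to a fixed basis. -/
def finCoord (G : Type*) [NormedAddCommGroup G] [NormedSpace ℝ G] [FiniteDimensional ℝ G]
    (i : Fin (Module.finrank ℝ G)) : G →L[ℝ] ℝ :=
  LinearMap.toContinuousLinearMap ((Module.finBasis ℝ G).coord i)

/-- Expanding `a` in a basis of `G` reduces this to multiplication by scalar functions. -/
theorem IsWeakDeriv.bilin [CompleteSpace F] [CompleteSpace F'] [FiniteDimensional ℝ G]
    (B : G →L[ℝ] F →L[ℝ] F') (hS : IsOpen S) (hα : α.1 + α.2 = 1) {a : ℂ → G}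
    (ha : ∀ z ∈ S, ContDiffAt ℝ ∞ a z) {f g : ℂ → F} (h : IsWeakDeriv D S α f g) :
    IsWeakDeriv D S α (fun z => B (a z) (f z))
      (fun z => B (pderiv α a z) (f z) + B (a z) (g z)) := by
  set b := Module.finBasis ℝ G
  have key := IsWeakDeriv.sum Finset.univ fun i _ =>
    (h.clm (B (b i))).smul_fun hS hα (a := fun z => finCoord G i (a z))
      fun z hz => contDiffAt_clm _ (ha z hz)
  have e1 : ∀ z, B (a z) (f z) = ∑ i, finCoord G i (a z) • B (b i) (f z) := fun z =>
    bilin_eq_sum B (a z) (f z)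
  simp only [e1]
  refine key.congr_on hS (fun z _ => rfl) fun z hz => ?_
  have e2 : ∀ i, pderiv α (fun z => finCoord G i (a z)) z = finCoord G i (pderiv α a z) :=
    fun i => pderiv_clm_apply _ hα (ha z hz).differentiableAt_of_top
  simp only [e2, Finset.sum_add_distrib]
  rw [bilin_eq_sum B (pderiv α a z) (f z), bilin_eq_sum B (a z) (g z)]
  rfl

instance (D : StandardDomain) : IsLocallyFiniteMeasure D.vol :=
  inferInstanceAs (IsLocallyFiniteMeasure (volume.restrict D.inner))

theorem ae_mem_inner (D : StandardDomain) : ∀ᵐ z ∂D.vol, z ∈ D.inner :=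
  ae_restrict_mem isOpen_interior.measurableSet

theorem locallyIntegrableOn_of_memLp {F : Type*} [NormedAddCommGroup F] {f : ℂ → F}
    (h : MemLp f 2 D.vol) : LocallyIntegrableOn f S D.vol :=
  (h.locallyIntegrable (by norm_num)).locallyIntegrableOn S

theorem IsWeakDeriv.refl {f : ℂ → F} (h : LocallyIntegrableOn f S D.vol) :
    IsWeakDeriv D S (0, 0) f f := ⟨h, h, fun φ _ _ _ => by simp [pderiv]⟩

/-- Successive weak derivatives compose. -/
theorem IsWeakDeriv.comp (hα : α.1 + α.2 = 1) {f g h : ℂ → F}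
    (h1 : IsWeakDeriv D S α f g) (h2 : IsWeakDeriv D S β g h) : IsWeakDeriv D S (β + α) f h := by
  refine ⟨h1.1, h2.2.1, fun φ hφ hc hs => ?_⟩
  have hc' : HasCompactSupport (pderiv β φ) :=
    hc.of_isClosed_subset (isClosed_tsupport _) (tsupport_pderiv β φ)
  have e := h1.2.2 _ (contDiff_pderiv β hφ) hc' ((tsupport_pderiv β φ).trans hs)
  rw [pderiv_pderiv hα hφ] at e
  rw [e, h2.2.2 φ hφ hc hs, smul_smul, ← pow_add]
  congr 2
  simp only [Prod.fst_add, Prod.snd_add]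
  omega

/-- Test the first identity with `pderiv β φ` and cancel a sign. This turns higher weak derivatives
of `f` into weak derivatives of its first derivatives, the form that `SobBound` asks for. -/
theorem IsWeakDeriv.of_comp (hα : α.1 + α.2 = 1) {f g h : ℂ → F}
    (h1 : IsWeakDeriv D S α f g) (h2 : IsWeakDeriv D S (β + α) f h) : IsWeakDeriv D S β g h := by
  refine ⟨h1.2.1, h2.2.1, fun φ hφ hc hs => ?_⟩
  have hc' : HasCompactSupport (pderiv β φ) :=
    hc.of_isClosed_subset (isClosed_tsupport _) (tsupport_pderiv β φ)
  have e := h1.2.2 _ (contDiff_pderiv β hφ) hc' ((tsupport_pderiv β φ).trans hs)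
  rw [pderiv_pderiv hα hφ, h2.2.2 φ hφ hc hs, hα] at e
  have : (β + α).1 + (β + α).2 = β.1 + β.2 + 1 := by
    simp only [Prod.fst_add, Prod.snd_add]; omega
  rw [this, pow_succ, mul_smul] at e
  simp only [pow_one, neg_smul, one_smul, smul_neg, neg_inj] at e
  exact e.symm

/-- `f` is in the Sobolev class `H_k`, with weak derivatives of `L²`-norm at most `c`. -/
def SobBound (D : StandardDomain) : ℕ → (ℂ → F) → ℝ≥0 → Prop
  | 0, f, c => AEStronglyMeasurable f D.vol ∧ eLpNorm f 2 D.vol ≤ c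
  | k + 1, f, c => (AEStronglyMeasurable f D.vol ∧ eLpNorm f 2 D.vol ≤ c) ∧
      ∀ α : ℕ × ℕ, α.1 + α.2 = 1 → ∃ g, IsWeakDeriv D D.inner α f g ∧ SobBound D k g c

namespace SobBound

variable {k : ℕ} {c c' : ℝ≥0} {f g : ℂ → F}

theorem base (h : SobBound D k f c) : AEStronglyMeasurable f D.vol ∧ eLpNorm f 2 D.vol ≤ c := by
  cases k with
  | zero => exact h
  | succ k => exact h.1

theorem memLp (h : SobBound D k f c) : MemLp f 2 D.vol :=
  ⟨h.base.1, h.base.2.trans_lt ENNReal.coe_lt_top⟩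

theorem of_succ (h : SobBound D (k + 1) f c) : SobBound D k f c := by
  induction k generalizing f with
  | zero => exact h.1
  | succ k ih =>
    refine ⟨h.1, fun α hα => ?_⟩
    obtain ⟨g, hg, hb⟩ := h.2 α hα
    exact ⟨g, hg, ih hb⟩

theorem mono (h : SobBound D k f c) (hc : c ≤ c') : SobBound D k f c' := by
  induction k generalizing f with
  | zero => exact ⟨h.1, h.2.trans (by exact_mod_cast hc)⟩
  | succ k ih =>
    refine ⟨⟨h.1.1, h.1.2.trans (by exact_mod_cast hc)⟩, fun α hα => ?_⟩
    obtain ⟨g, hg, hb⟩ := h.2 α hα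
    exact ⟨g, hg, ih hb⟩

theorem congr (h : SobBound D k f c) (hfg : f =ᵐ[D.vol] g) : SobBound D k g c := by
  have b : AEStronglyMeasurable g D.vol ∧ eLpNorm g 2 D.vol ≤ c :=
    ⟨h.base.1.congr hfg, (eLpNorm_congr_ae hfg).symm.trans_le h.base.2⟩
  cases k with
  | zero => exact b
  | succ k =>
    refine ⟨b, fun α hα => ?_⟩
    obtain ⟨u, hu, hb⟩ := h.2 α hα
    exact ⟨u, hu.congr hfg ae_eq_rfl, hb⟩

theorem add (h : SobBound D k f c) (h' : SobBound D k g c') :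
    SobBound D k (fun z => f z + g z) (c + c') := by
  induction k generalizing f g with
  | zero => exact ⟨h.1.add h'.1, (eLpNorm_add_le h.1 h'.1 (by norm_num)).trans (by
      push_cast; exact add_le_add h.2 h'.2)⟩
  | succ k ih =>
    refine ⟨⟨h.1.1.add h'.1.1, (eLpNorm_add_le h.1.1 h'.1.1 (by norm_num)).trans (by
      push_cast; exact add_le_add h.1.2 h'.1.2)⟩, fun α hα => ?_⟩
    obtain ⟨u, hu, hb⟩ := h.2 α hα
    obtain ⟨u', hu', hb'⟩ := h'.2 α hα
    exact ⟨_, hu.add hu', ih hb hb'⟩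

theorem bilin [CompleteSpace F] [CompleteSpace F'] [FiniteDimensional ℝ G]
    (B : G →L[ℝ] F →L[ℝ] F') {a : ℂ → G} {C : ℝ≥0} (ha : CBound D.inner k a C)
    (h : SobBound D k f c) : SobBound D k (fun z => B (a z) (f z)) (2 ^ k * (‖B‖₊ * C * c)) := by
  have base : ∀ (j : ℕ) (a : ℂ → G) (f : ℂ → F), CBound D.inner j a C → SobBound D j f c →
      AEStronglyMeasurable (fun z => B (a z) (f z)) D.vol ∧
        eLpNorm (fun z => B (a z) (f z)) 2 D.vol ≤ (2 ^ j * (‖B‖₊ * C * c) : ℝ≥0) := by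
    intro j a f ha h
    have hac : ContinuousOn a D.inner := fun z hz =>
      (ha.smooth hz).continuousAt.continuousWithinAt
    have ham : AEStronglyMeasurable a D.vol :=
      hac.aestronglyMeasurable isOpen_interior.measurableSet
    refine ⟨B.aestronglyMeasurable_comp₂ ham h.base.1, ?_⟩
    have hb : ∀ᵐ z ∂D.vol, ‖B (a z) (f z)‖₊ ≤ (‖B‖₊ * C) * ‖f z‖₊ := by
      filter_upwards [ae_mem_inner D] with z hz
      have h2 : ‖a z‖₊ ≤ C := (ha.base z hz).2
      calc ‖B (a z) (f z)‖₊ ≤ ‖B‖₊ * ‖a z‖₊ * ‖f z‖₊ := B.le_opNorm₂ _ _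
        _ ≤ _ := by gcongr
    refine (eLpNorm_le_nnreal_smul_eLpNorm_of_ae_le_mul hb 2).trans ?_
    rw [ENNReal.smul_def, smul_eq_mul]
    calc ((‖B‖₊ * C : ℝ≥0) : ℝ≥0∞) * eLpNorm f 2 D.vol ≤ ((‖B‖₊ * C : ℝ≥0) : ℝ≥0∞) * c := by
          gcongr; exact h.base.2
      _ = ((‖B‖₊ * C * c : ℝ≥0) : ℝ≥0∞) := by push_cast; rfl
      _ ≤ _ := by
        rw [ENNReal.coe_le_coe]
        exact le_mul_of_one_le_left (by positivity) (one_le_pow₀ (by norm_num))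
  induction k generalizing a f with
  | zero => exact base 0 a f ha h
  | succ k ih =>
    refine ⟨base _ a f ha h, fun α hα => ?_⟩
    obtain ⟨u, hu, hb⟩ := h.2 α hα
    refine ⟨_, hu.bilin B isOpen_interior hα fun z hz => ha.smooth hz, ?_⟩
    have := (ih (ha.2 α hα) h.of_succ).add (ih ha.of_succ hb)
    rwa [← two_mul, ← mul_assoc, ← pow_succ'] at this

theorem exists_pderiv (h : SobBound D k f c) (hβ : β.1 + β.2 ≤ k) :
    ∃ g, AEStronglyMeasurable g D.vol ∧ eLpNorm g 2 D.vol ≤ c ∧ IsWeakDeriv D D.inner β f g := by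
  induction k generalizing f β with
  | zero =>
    obtain ⟨a, b⟩ := β
    obtain ⟨rfl, rfl⟩ : a = 0 ∧ b = 0 := by simp only at hβ; omega
    exact ⟨f, h.1, h.2, .refl (locallyIntegrableOn_of_memLp h.memLp)⟩
  | succ k ih =>
    obtain ⟨a, b⟩ := β
    rcases a with _ | a
    · rcases b with _ | b
      · exact ⟨f, h.1.1, h.1.2, .refl (locallyIntegrableOn_of_memLp h.memLp)⟩
      · obtain ⟨u, hu, hb⟩ := h.2 (0, 1) rfl
        obtain ⟨g, h1, h2, h3⟩ := ih (β := (0, b)) hb (by simp only at hβ ⊢; omega)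
        exact ⟨g, h1, h2, hu.comp rfl h3⟩
    · obtain ⟨u, hu, hb⟩ := h.2 (1, 0) rfl
      obtain ⟨g, h1, h2, h3⟩ := ih (β := (a, b)) hb (by simp only at hβ ⊢; omega)
      exact ⟨g, h1, h2, hu.comp rfl h3⟩

/-- Together with `exists_pderiv` this passes, without loss in the constant, between the multi-index
description of Sobolev classes and the recursive one, where product rules are proved by induction.
-/
theorem of_pderiv [CompleteSpace F] (h : ∀ β : ℕ × ℕ, β.1 + β.2 ≤ k → ∃ g,
    AEStronglyMeasurable g D.vol ∧ eLpNorm g 2 D.vol ≤ c ∧ IsWeakDeriv D D.inner β f g) :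
    SobBound D k f c := by
  have base : AEStronglyMeasurable f D.vol ∧ eLpNorm f 2 D.vol ≤ c := by
    obtain ⟨g, h1, h2, h3⟩ := h (0, 0) (Nat.zero_le _)
    have := h3.self_of_zero
    exact ⟨h1.congr this.symm, (eLpNorm_congr_ae this).trans_le h2⟩
  induction k generalizing f with
  | zero => exact base
  | succ k ih =>
    refine ⟨base, fun α hα => ?_⟩
    obtain ⟨u, h1, h2, h3⟩ := h α (by omega)
    refine ⟨u, h3, ih (fun β hβ => ?_) ⟨h1, h2⟩⟩
    obtain ⟨g, g1, g2, g3⟩ := h (β + α) (by simp only [Prod.fst_add, Prod.snd_add]; omega)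
    exact ⟨g, g1, g2, h3.of_comp hα g3⟩

end SobBound

end WeakCalculus

/-! ### The ends of a standard domain -/

section Geometry

variable (D : StandardDomain)

theorem isOpen_inner : IsOpen D.inner := isOpen_interior

theorem inner_subset_carrier : D.inner ⊆ D.carrier := interior_subset

theorem isOpen_slit (j : Fin D.r) : IsOpen (D.slit j) := by
  have : D.slit j =
      ⋃ s ∈ Ici (D.tip j + D.ε / 2), Metric.ball (⟨s, (j : ℝ) + 1⟩ : ℂ) (D.ε / 2) := by
    ext z; simp [StandardDomain.slit]
  rw [this]
  exact isOpen_biUnion fun s _ => Metric.isOpen_ball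

theorem isClosed_carrier : IsClosed D.carrier := by
  have : D.carrier = {z : ℂ | 0 ≤ z.im} ∩ {z : ℂ | z.im ≤ (D.r : ℝ) + 1} ∩ ⋂ j, (D.slit j)ᶜ := by
    ext z; simp [StandardDomain.carrier, and_assoc]
  rw [this]
  exact ((isClosed_le continuous_const Complex.continuous_im).inter
    (isClosed_le Complex.continuous_im continuous_const)).inter
    (isClosed_iInter fun j => (isOpen_slit D j).isClosed_compl)

/-- The part of the domain of longitudinal coordinate at most `R`. -/
def core (R : ℝ) : Set ℂ := D.carrier ∩ {z | |z.re| ≤ R}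

theorem isCompact_core (R : ℝ) : IsCompact (core D R) := by
  refine Metric.isCompact_of_isClosed_isBounded ((isClosed_carrier D).inter
    (isClosed_le (by fun_prop) continuous_const)) ?_
  refine (Metric.isBounded_closedBall (x := (0 : ℂ)) (r := R + (D.r + 1))).subset fun z hz => ?_
  rw [mem_closedBall_zero_iff]
  refine (Complex.norm_le_abs_re_add_abs_im z).trans (add_le_add hz.2 ?_)
  rw [abs_of_nonneg hz.1.1]
  exact hz.1.2.1

/-- The points in the interior of some end beyond `R`. -/
def ends (R : ℝ) : Set ℂ := {z | ∃ i : D.Puncture, D.endPart i R ∈ 𝓝 z}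

/-- To the right of all tips, the integer heights lie in slits or on the outer boundary. So an
interior point lies strictly between two consecutive integer heights, with a whole neighbourhood in
one end. -/
theorem exists_inner_subset_core_union_ends (R : ℝ) :
    ∃ R', D.inner ⊆ core D R' ∪ ends D R := by
  obtain ⟨T, hT⟩ : ∃ T, ∀ j, D.tip j + D.ε / 2 ≤ T := by
    obtain ⟨T, hT⟩ := (Set.finite_range fun j => D.tip j + D.ε / 2).bddAbove
    exact ⟨T, fun j => hT ⟨j, rfl⟩⟩
  refine ⟨max R T, fun z hz => ?_⟩
  by_cases hcore : |z.re| ≤ max R T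
  · exact Or.inl ⟨inner_subset_carrier D hz, hcore⟩
  right
  rw [not_le, lt_abs] at hcore
  have hcar := inner_subset_carrier D hz
  rcases hcore with h | h
  · have hR := (max_lt_iff.1 h).1
    have hTz := (max_lt_iff.1 h).2
    -- The strip between heights `i` and `i + 1` belongs to the puncture of index `i + 1`, index `0`
    -- being the end at `-∞`.
    set i : ℕ := ⌊z.im⌋₊ with hi
    have h0 : 0 ≤ z.im := hcar.1
    have hle : (i : ℝ) ≤ z.im := Nat.floor_le h0
    have hlt : z.im < i + 1 := Nat.lt_floor_add_one _
    have hint : interior {w : ℂ | 0 ≤ w.im ∧ w.im ≤ (D.r : ℝ) + 1} ⊆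
        {w : ℂ | 0 < w.im ∧ w.im < (D.r : ℝ) + 1} := by
      have : {w : ℂ | 0 ≤ w.im ∧ w.im ≤ (D.r : ℝ) + 1} =
          {w : ℂ | 0 ≤ w.im} ∩ {w : ℂ | w.im ≤ (D.r : ℝ) + 1} := rfl
      rw [this, interior_inter, Complex.interior_setOfPred_le_im, Complex.interior_setOfPred_im_le]
      exact fun w hw => hw
    have hz' := hint (interior_mono
      (show D.carrier ⊆ {w : ℂ | 0 ≤ w.im ∧ w.im ≤ (D.r : ℝ) + 1} from
        fun w hw => ⟨hw.1, hw.2.1⟩) hz)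
    have hiR : i < D.r + 1 := by
      have : (i : ℝ) < (D.r : ℝ) + 1 := hle.trans_lt hz'.2
      exact_mod_cast this
    -- At height exactly `i ≥ 1` the point would lie on the axis of the slit of index `i - 1`.
    have hne : (i : ℝ) < z.im := by
      refine lt_of_le_of_ne hle fun he => ?_
      have hipos : 0 < i := by
        have : (0 : ℝ) < i := he ▸ hz'.1
        exact_mod_cast this
      refine hcar.2.2 ⟨i - 1, by omega⟩ ⟨z.re, (hT _).trans hTz.le, ?_⟩
      have : (⟨z.re, (((⟨i - 1, by omega⟩ : Fin D.r) : ℕ) : ℝ) + 1⟩ : ℂ) = z := by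
        apply Complex.ext
        · rfl
        · simp only [Nat.cast_sub (Nat.succ_le_of_lt hipos)]
          rw [← he]; push_cast; ring
      rw [this, dist_self]
      linarith [D.ε_pos]
    refine ⟨⟨i + 1, by omega⟩, ?_⟩
    have ho : IsOpen (D.inner ∩ {w : ℂ | R < w.re ∧ (i : ℝ) < w.im ∧ w.im < i + 1}) := by
      refine (isOpen_inner D).inter ?_
      exact (isOpen_lt continuous_const Complex.continuous_re).inter
        ((isOpen_lt continuous_const Complex.continuous_im).inter
          (isOpen_lt Complex.continuous_im continuous_const))
    refine mem_of_superset (ho.mem_nhds ⟨hz, hR, hne, hlt⟩) fun w hw => ?_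
    refine ⟨inner_subset_carrier D hw.1, ?_, Or.inr ?_⟩
    · simp only [StandardDomain.outward, Fin.ext_iff, Fin.val_zero]
      simpa using hw.2.1.le
    · push_cast
      constructor <;> linarith [hw.2.2.1, hw.2.2.2]
  · refine ⟨0, ?_⟩
    have ho : IsOpen (D.inner ∩ {w : ℂ | w.re < -R}) :=
      (isOpen_inner D).inter (isOpen_lt Complex.continuous_re continuous_const)
    have hR : z.re < -R := by linarith [(max_lt_iff.1 h).1]
    refine mem_of_superset (ho.mem_nhds ⟨hz, hR⟩) fun w hw => ?_
    refine ⟨inner_subset_carrier D hw.1, ?_, Or.inl rfl⟩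
    simp only [StandardDomain.outward, if_true]
    have : w.re < -R := hw.2
    linarith

theorem endPart_anti (i : D.Puncture) {R R' : ℝ} (h : R ≤ R') : D.endPart i R' ⊆ D.endPart i R :=
  fun _ hz => ⟨hz.1, h.trans hz.2.1, hz.2.2⟩

end Geometry

/-! ### Matrices as operators -/

section Operators

variable {n : ℕ}

/-- Endomorphisms of `ℂⁿ`, with the operator norm. -/
abbrev Op (n : ℕ) : Type := Cn n →L[ℂ] Cn n

/-- The endomorphism given by a matrix. -/
def opOf (M : Mat n) : Op n := Matrix.toEuclideanCLM (𝕜 := ℂ) M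

theorem opOf_apply (M : Mat n) (x : Cn n) : opOf M x = act M x := rfl

theorem opOf_mul (M N : Mat n) : opOf (M * N) = opOf M * opOf N :=
  map_mul (Matrix.toEuclideanCLM (𝕜 := ℂ) (n := Fin n)) M N

theorem opOf_add (M N : Mat n) : opOf (M + N) = opOf M + opOf N :=
  map_add (Matrix.toEuclideanCLM (𝕜 := ℂ) (n := Fin n)) M N

theorem opOf_sub (M N : Mat n) : opOf (M - N) = opOf M - opOf N :=
  map_sub (Matrix.toEuclideanCLM (𝕜 := ℂ) (n := Fin n)) M N

theorem opOf_one : opOf (1 : Mat n) = 1 :=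
  map_one (Matrix.toEuclideanCLM (𝕜 := ℂ) (n := Fin n))

theorem opOf_conjTranspose (M : Mat n) : opOf Mᴴ = star (opOf M) :=
  map_star (Matrix.toEuclideanCLM (𝕜 := ℂ) (n := Fin n)) M

theorem isUnit_opOf {M : Mat n} (h : IsUnit M) : IsUnit (opOf M) :=
  h.map (Matrix.toEuclideanCLM (𝕜 := ℂ) (n := Fin n))

/-- Evaluation of an endomorphism as a bilinear map. -/
def opEval (n : ℕ) : Op n →L[ℝ] Cn n →L[ℝ] Cn n :=
  ContinuousLinearMap.restrictScalarsL ℂ (Cn n) (Cn n) ℝ ℝ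

theorem opEval_apply (a : Op n) (x : Cn n) : opEval n a x = a x := rfl

/-- Multiplication of endomorphisms as a bilinear map. -/
def opMul (n : ℕ) : Op n →L[ℝ] Op n →L[ℝ] Op n := ContinuousLinearMap.mul ℝ (Op n)

theorem opMul_apply (a b : Op n) : opMul n a b = a * b := rfl

/-- The adjoint of endomorphisms as a real linear map. -/
def opStar (n : ℕ) : Op n →L[ℝ] Op n := (starL' ℝ : Op n ≃L[ℝ] Op n)

theorem opStar_apply (a : Op n) : opStar n a = star a := rfl

/-- Multiplication by `i`. -/
def opI (n : ℕ) : Op n := Complex.I • (1 : Op n)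

theorem opI_apply (x : Cn n) : opI n x = Complex.I • x := rfl

theorem opI_comm (a : Op n) : opI n * a = a * opI n := by
  simp [opI]

/-- The endomorphism given by a diagonal matrix. -/
def opDiag (n : ℕ) : (Fin n → ℂ) →L[ℝ] Op n :=
  LinearMap.toContinuousLinearMap
    { toFun := fun d => opOf (Matrix.diagonal d)
      map_add' := fun d d' => by rw [← opOf_add, Matrix.diagonal_add]; rfl
      map_smul' := fun c d => by
        ext x j
        simp [opOf_apply, act, Matrix.toLpLin_apply, Matrix.mulVec_diagonal,
          Matrix.smul_mulVec] }

theorem opDiag_apply (d : Fin n → ℂ) : opDiag n d = opOf (Matrix.diagonal d) := rfl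

theorem opDiag_mul (d d' : Fin n → ℂ) :
    opDiag n d * opDiag n d' = opDiag n (fun j => d j * d' j) := by
  rw [opDiag_apply, opDiag_apply, ← opOf_mul, Matrix.diagonal_mul_diagonal, opDiag_apply]

theorem opDiag_one : opDiag n (fun _ => 1) = 1 := by
  rw [opDiag_apply, Matrix.diagonal_one, opOf_one]

/-- The matrix unit `E_{jk}`, times a scalar. -/
def opUnit (j k : Fin n) : ℂ →L[ℝ] Op n :=
  LinearMap.toContinuousLinearMap
    { toFun := fun c => opOf (Matrix.single j k c)
      map_add' := fun d d' => by rw [← opOf_add, Matrix.single_add]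
      map_smul' := fun c d => by
        have : c • d = (c : ℂ) * d := by simp
        rw [this]
        have h2 : Matrix.single j k ((c : ℂ) * d) = (c : ℂ) • Matrix.single j k d := by
          simp
        rw [h2]
        change Matrix.toEuclideanCLM (𝕜 := ℂ) _ = _
        rw [map_smul]
        rfl }

theorem opOf_eq_sum (M : Mat n) : opOf M = ∑ j, ∑ k, opUnit j k (M j k) := by
  conv_lhs => rw [Matrix.matrix_eq_sum_single M]
  simp only [opOf, map_sum]
  rfl

theorem contDiff_opOf {A : ℂ → Mat n} (h : ∀ j k, ContDiff ℝ ∞ (fun z => A z j k)) :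
    ContDiff ℝ ∞ (fun z => opOf (A z)) := by
  have : (fun z => opOf (A z)) = fun z => ∑ j, ∑ k, opUnit j k (A z j k) :=
    funext fun z => opOf_eq_sum (A z)
  rw [this]
  exact ContDiff.sum fun j _ => ContDiff.sum fun k _ => (opUnit j k).contDiff.comp (h j k)

/-- The operator `∂_τ + i ∂_t` on operator valued functions. -/
def opDbar (a : ℂ → Op n) (z : ℂ) : Op n := pderiv (1, 0) a z + opI n * pderiv (0, 1) a z

end Operators

variable {D : StandardDomain} {n : ℕ} {μ : D.Puncture → Fin n → ℝ}

/-! ### The weight, its inverse and its logarithmic derivative. -/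

section WeightCalculus

variable (w : Weight D μ)

/-- The weight as an operator valued function. -/
def wOp (z : ℂ) : Op n := opOf (w.toFun z)

/-- The inverse of the weight. -/
def wInv (z : ℂ) : Op n := Ring.inverse (wOp w z)

theorem contDiff_wOp : ContDiff ℝ ∞ (wOp w) := contDiff_opOf w.smooth

theorem wInv_mul_wOp {z : ℂ} (hz : z ∈ D.carrier) : wInv w z * wOp w z = 1 :=
  Ring.inverse_mul_cancel _ (isUnit_opOf (w.isUnit z hz))

theorem wOp_mul_wInv {z : ℂ} (hz : z ∈ D.carrier) : wOp w z * wInv w z = 1 :=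
  Ring.mul_inverse_cancel _ (isUnit_opOf (w.isUnit z hz))

theorem wInv_wOp_apply {z : ℂ} (hz : z ∈ D.carrier) (x : Cn n) : wInv w z (wOp w z x) = x := by
  rw [← mul_apply_eq_comp, wInv_mul_wOp w hz]; rfl

theorem wOp_wInv_apply {z : ℂ} (hz : z ∈ D.carrier) (x : Cn n) : wOp w z (wInv w z x) = x := by
  rw [← mul_apply_eq_comp, wOp_mul_wInv w hz]; rfl

theorem contDiffAt_wInv {z : ℂ} (hz : z ∈ D.carrier) : ContDiffAt ℝ ∞ (wInv w) z := by
  obtain ⟨u, hu⟩ := isUnit_opOf (w.isUnit z hz)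
  have h := contDiffAt_ringInverse ℝ (n := ∞) u
  rw [hu] at h
  exact h.comp z (contDiff_wOp w).contDiffAt

/-- Past the origin of the longitudinal coordinate the absolute value in the weight can be dropped.
Keeping `|D.width i|` makes the sign of the width irrelevant. -/
theorem exists_wOp_eq_opDiag (R₀ : ℝ) :
    ∃ R, R₀ ≤ R ∧ ∃ c : D.Puncture → ℝ, ∀ i, ∀ z ∈ D.endPart i R, wOp w z = opDiag n fun j =>
      ((Real.exp (μ i j / |D.width i| * (D.outward i z - c i)) : ℝ) : ℂ) := by
  choose c r h using w.eq_diag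
  obtain ⟨T, hT⟩ : ∃ T, ∀ i, max (c i) (r i) ≤ T := by
    obtain ⟨T, hT⟩ := (Set.finite_range fun i => max (c i) (r i)).bddAbove
    exact ⟨T, fun j => hT ⟨j, rfl⟩⟩
  refine ⟨max R₀ T, le_max_left _ _, c, fun i z hz => ?_⟩
  have h1 := (hT i).trans ((le_max_right R₀ T).trans hz.2.1)
  have h2 := h i z ⟨hz.1, (le_max_right _ _).trans h1, hz.2.2⟩
  rw [wOp, h2, opDiag_apply]
  congr 3 with j
  rw [abs_div, abs_of_nonneg (sub_nonneg.2 ((le_max_left _ _).trans h1))]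
  congr 2
  ring

theorem hasFDerivAt_outward (α : ℕ × ℕ) (i : D.Puncture) :
    ∃ s : ℝ, ∀ z, HasFDerivAt (D.outward i)
      (if i = 0 then -Complex.reCLM else Complex.reCLM) z ∧
      (if i = 0 then -Complex.reCLM else Complex.reCLM) (unitDir α) = s := by
  refine ⟨_, fun z => ⟨?_, rfl⟩⟩
  by_cases hi : i = 0
  · have : D.outward i = fun z => -z.re := by funext z; simp [StandardDomain.outward, hi]
    rw [this, if_pos hi]
    exact Complex.reCLM.hasFDerivAt.neg
  · have : D.outward i = fun z => z.re := by funext z; simp [StandardDomain.outward, hi]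
    rw [this, if_neg hi]
    exact Complex.reCLM.hasFDerivAt

/-- Conjugation by the weight of a function which commutes with the weight near the punctures
preserves `C^k`-bounds. -/
theorem exists_conj_bound (k : ℕ) (R : ℝ) : ∃ K : ℝ≥0, ∀ (a : ℂ → Op n) (C : ℝ≥0),
    (∀ i, ∀ z ∈ D.endPart i R, wOp w z * a z = a z * wOp w z) → CBound D.carrier k a C →
      CBound D.inner k (fun z => wOp w z * a z * wInv w z) (K * C) := by
  obtain ⟨R', hR'⟩ := exists_inner_subset_core_union_ends D R
  obtain ⟨C₁, h1⟩ := CBound.of_isCompact (isCompact_core D R') k (a := wOp w)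
    fun z _ => (contDiff_wOp w).contDiffAt
  obtain ⟨C₂, h2⟩ := CBound.of_isCompact (isCompact_core D R') k (a := wInv w)
    fun z hz => contDiffAt_wInv w hz.1
  refine ⟨2 ^ k * (‖opMul n‖₊ * (2 ^ k * (‖opMul n‖₊ * C₁)) * C₂) + 1, fun a C ha hC => ?_⟩
  have hcore : CBound (core D R') k (fun z => wOp w z * a z * wInv w z)
      (2 ^ k * (‖opMul n‖₊ * (2 ^ k * (‖opMul n‖₊ * C₁ * C)) * C₂)) :=
    CBound.bilin (opMul n) (CBound.bilin (opMul n) h1 (hC.mono le_rfl inter_subset_left)) h2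
  have hends : CBound (D.carrier ∩ ends D R) k (fun z => wOp w z * a z * wInv w z) C := by
    refine (hC.mono le_rfl inter_subset_left).congr fun z hz => ?_
    obtain ⟨i, hi⟩ := hz.2
    -- On the ends conjugation does nothing, so the growth or decay of the weight there is harmless.
    filter_upwards [hi] with x hx
    rw [ha i x hx, mul_assoc, wOp_mul_wInv w hx.1, mul_one]
  refine (CBound.union (hcore.mono ?_ subset_rfl) (hends.mono ?_ subset_rfl)).mono le_rfl
    fun z hz => (hR' hz).imp id fun h => ⟨inner_subset_carrier D hz, h⟩
  · rw [add_mul]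
    exact le_add_right (le_of_eq (by ring))
  · rw [add_mul, one_mul]
    exact le_add_self

/-- From `∂v = ∂(w⁻¹ (w v))`, this is the coefficient that appears when a derivative is moved across
the weight. On each end the weight is a diagonal exponential and the coefficient is a constant `κ
i`; the rest of the domain is compact. -/
theorem exists_logDeriv_bound (k : ℕ) {α : ℕ × ℕ} (hα : α.1 + α.2 = 1) :
    ∃ K : ℝ≥0, CBound D.inner k (fun z => wOp w z * pderiv α (wInv w) z) K := by
  obtain ⟨R, -, c, hc⟩ := exists_wOp_eq_opDiag w 0
  obtain ⟨R', hR'⟩ := exists_inner_subset_core_union_ends D R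
  obtain ⟨C₁, h1⟩ := CBound.of_isCompact (isCompact_core D R') k
    (a := fun z => wOp w z * pderiv α (wInv w) z) fun z hz =>
      contDiffAt_bilin (opMul n) (contDiff_wOp w).contDiffAt
        (contDiffAt_pderiv hα (contDiffAt_wInv w hz.1))
  choose s hs using fun i => hasFDerivAt_outward (D := D) α i
  set lam : D.Puncture → Fin n → ℝ := fun i j => μ i j / |D.width i|
  set κ : D.Puncture → Op n := fun i => opDiag n fun j => ((-(lam i j * s i) : ℝ) : ℂ)
  have hend : ∀ i, ∀ z, D.endPart i R ∈ 𝓝 z → wOp w z * pderiv α (wInv w) z = κ i := by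
    intro i z hz
    have hinv : wInv w =ᶠ[𝓝 z] fun x => opDiag n
        (fun j => ((Real.exp (-(lam i j) * (D.outward i x - c i)) : ℝ) : ℂ)) := by
      filter_upwards [hz] with x hx
      have e1 := wInv_mul_wOp w hx.1
      have e2 : wOp w x * opDiag n
          (fun j => ((Real.exp (-(lam i j) * (D.outward i x - c i)) : ℝ) : ℂ)) = 1 := by
        rw [hc i x hx, opDiag_mul, ← opDiag_one]
        congr 1 with j
        rw [← Complex.ofReal_mul, ← Real.exp_add]
        simp [lam]
      calc wInv w x = wInv w x * (wOp w x * opDiag n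
          (fun j => ((Real.exp (-(lam i j) * (D.outward i x - c i)) : ℝ) : ℂ))) := by
            rw [e2, mul_one]
        _ = _ := by rw [← mul_assoc, e1, one_mul]
    have hd : HasFDerivAt (fun x => fun j : Fin n =>
        ((Real.exp (-(lam i j) * (D.outward i x - c i)) : ℝ) : ℂ))
        (ContinuousLinearMap.pi fun j => Complex.ofRealCLM.comp
          (Real.exp (-(lam i j) * (D.outward i z - c i)) •
            (-(lam i j)) • (if i = 0 then -Complex.reCLM else Complex.reCLM))) z := by
      rw [hasFDerivAt_pi]
      intro j
      exact Complex.ofRealCLM.hasFDerivAt.comp z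
        ((((hs i z).1.sub_const (c i)).const_mul (-(lam i j))).exp)
    rw [(pderiv_congr hα hinv).self_of_nhds, pderiv_clm_apply (opDiag n) hα hd.differentiableAt,
      hc i z (mem_of_mem_nhds hz), opDiag_mul, pderiv_eq_dirDeriv hα, dirDeriv, hd.fderiv]
    simp only [κ]
    congr 1 with j
    have e3 := (hs i z).2
    simp only [ContinuousLinearMap.pi_apply, ContinuousLinearMap.comp_apply,
      smul_apply, e3, Complex.ofRealCLM_apply, smul_eq_mul]
    rw [← Complex.ofReal_mul, ← mul_assoc, ← Real.exp_add]
    simp [lam]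
  have hends : CBound (ends D R) k (fun z => wOp w z * pderiv α (wInv w) z) (∑ i, ‖κ i‖₊) := by
    refine CBound.iUnion (X := fun i => {z | D.endPart i R ∈ 𝓝 z}) fun i => ?_
    refine ((CBound.const (κ i)).mono (Finset.single_le_sum (f := fun i => ‖κ i‖₊)
      (fun _ _ => bot_le) (Finset.mem_univ i)) subset_rfl).congr fun z hz => ?_
    have : ∀ᶠ x in 𝓝 z, D.endPart i R ∈ 𝓝 x := eventually_eventually_nhds.2 hz
    filter_upwards [this] with x hx
    exact (hend i x hx).symm
  exact ⟨C₁ + ∑ i, ‖κ i‖₊, (CBound.union (h1.mono le_self_add subset_rfl)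
    (hends.mono le_add_self subset_rfl)).mono le_rfl hR'⟩

end WeightCalculus

/-! ### Bounded operators on weighted Sobolev spaces -/

section Bounded

variable {w : Weight D μ} {k : ℕ}

theorem mem_multiIndices {k : ℕ} {α : ℕ × ℕ} : α ∈ multiIndices k ↔ α.1 + α.2 ≤ k := by
  simp only [multiIndices, Finset.mem_filter, Finset.mem_product, Finset.mem_range]
  omega

theorem WSob.norm_def (f : WSob w k) : ‖f‖ = ‖WSob.jet w k f‖ := rfl

theorem WSob.norm_jet_apply (f : WSob w k) (α : multiIndices k) :
    ‖WSob.jet w k f α‖ₑ = eLpNorm (f.weightedDeriv α) 2 D.vol :=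
  Lp.enorm_toLp (f.weightedDeriv_memLp α)

theorem WSob.sobBound (f : WSob w k) : SobBound D k (fun z => wOp w z (WSob.val f z)) ‖f‖₊ := by
  refine SobBound.of_pderiv fun β hβ => ?_
  let α : multiIndices k := ⟨β, mem_multiIndices.2 hβ⟩
  refine ⟨f.weightedDeriv α, (f.weightedDeriv_memLp α).1, ?_, f.weightedDeriv_spec α⟩
  rw [← WSob.norm_jet_apply]
  have : ‖WSob.jet w k f α‖₊ ≤ ‖f‖₊ := PiLp.norm_apply_le (WSob.jet w k f) α
  exact ENNReal.coe_le_coe.2 this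

/-- The norm is the `ℓ²`-sum of the `L²`-norms of the derivatives, each at most `c`; this produces
the square root of the number of multi-indices. -/
theorem exists_wSob {v : ℂ → Cn n} {c : ℝ≥0} (h : SobBound D k (fun z => wOp w z (v z)) c) :
    ∃ f : WSob w k, WSob.val f =ᵐ[D.vol] v ∧ ‖f‖ ≤ √((multiIndices k).card) * c := by
  have hm : AEStronglyMeasurable v D.vol := by
    have hc : ContinuousOn (wInv w) D.inner := fun z hz =>
      (contDiffAt_wInv w (inner_subset_carrier D hz)).continuousAt.continuousWithinAt
    have := (opEval n).aestronglyMeasurable_comp₂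
      (hc.aestronglyMeasurable (μ := volume) (isOpen_inner D).measurableSet) h.base.1
    refine this.congr ?_
    filter_upwards [ae_mem_inner D] with z hz
    exact wInv_wOp_apply w (inner_subset_carrier D hz) _
  have hv : (fun z => wOp w z (AEEqFun.mk v hm z)) =ᵐ[D.vol] fun z => wOp w z (v z) := by
    filter_upwards [AEEqFun.coeFn_mk v hm] with z hz
    rw [hz]
  let f : WSob w k := ⟨AEEqFun.mk v hm, fun α hα => by
    obtain ⟨g, h1, h2, h3⟩ := h.exists_pderiv (mem_multiIndices.1 hα)
    exact ⟨g, ⟨h1, h2.trans_lt ENNReal.coe_lt_top⟩, h3.congr hv.symm ae_eq_rfl⟩⟩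
  refine ⟨f, AEEqFun.coeFn_mk v hm, ?_⟩
  have hle : ∀ α, ‖WSob.jet w k f α‖ ≤ c := by
    intro α
    obtain ⟨g, h1, h2, h3⟩ := h.exists_pderiv (mem_multiIndices.1 α.2)
    have e : eLpNorm (f.weightedDeriv α) 2 D.vol = eLpNorm g 2 D.vol :=
      eLpNorm_congr_ae ((f.weightedDeriv_spec α).unique (h3.congr hv.symm ae_eq_rfl))
    have h4 : ‖WSob.jet w k f α‖ₑ ≤ c := by rw [WSob.norm_jet_apply, e]; exact h2
    exact_mod_cast (ENNReal.coe_le_coe.1 h4 : ‖WSob.jet w k f α‖₊ ≤ c)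
  rw [WSob.norm_def, PiLp.norm_eq_of_L2]
  calc √(∑ α, ‖WSob.jet w k f α‖ ^ 2) ≤ √(∑ _α : multiIndices k, (c : ℝ) ^ 2) := by
        gcongr with α; exact hle α
    _ = √((multiIndices k).card * (c : ℝ) ^ 2) := by simp
    _ = _ := by rw [Real.sqrt_mul (by positivity), Real.sqrt_sq (NNReal.coe_nonneg c)]

/-- Multiplication and `∂̄` are given as relations between classes of functions. Uniqueness of the
related element makes any choice of it linear, and the bound makes it continuous. -/
theorem exists_clm_of_relation {E E' : Type*} [NormedAddCommGroup E] [NormedSpace ℝ E]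
    [NormedAddCommGroup E'] [NormedSpace ℝ E'] (Rel : E → E' → Prop) {C : ℝ} (hC : 0 ≤ C)
    (hadd : ∀ v v' f f', Rel v f → Rel v' f' → Rel (v + v') (f + f'))
    (hsmul : ∀ (c : ℝ) v f, Rel v f → Rel (c • v) (c • f))
    (huniq : ∀ v f f', Rel v f → Rel v f' → f = f')
    (hex : ∀ v, ∃ f, Rel v f ∧ ‖f‖ ≤ C * ‖v‖) :
    ∃ T : E →L[ℝ] E', (∀ v, Rel v (T v)) ∧ ‖T‖ ≤ C := by
  choose T hT hb using hex
  refine ⟨LinearMap.mkContinuous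
    { toFun := T
      map_add' := fun v v' => huniq _ _ _ (hT _) (hadd _ _ _ _ (hT v) (hT v'))
      map_smul' := fun c v => huniq _ _ _ (hT _) (hsmul c _ _ (hT v)) } C hb, hT,
    LinearMap.mkContinuous_norm_le _ hC _⟩

variable (w)

/-- Multiplication operators on weighted Sobolev spaces. -/
theorem exists_mulOp (k : ℕ) : ∃ K : ℝ≥0, ∀ (a : ℂ → Op n) (C : ℝ≥0),
    CBound D.inner k (fun z => wOp w z * a z * wInv w z) C →
      ∃ T : WSob w k →L[ℝ] WSob w k,
        (∀ v, WSob.val (T v) =ᵐ[D.vol] fun z => a z (WSob.val v z)) ∧ ‖T‖ ≤ K * C := by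
  refine ⟨NNReal.sqrt (multiIndices k).card * (2 ^ k * ‖opEval n‖₊),
    fun a C hC => ?_⟩
  refine exists_clm_of_relation (fun v f : WSob w k => WSob.val f =ᵐ[D.vol]
    fun z => a z (WSob.val v z)) (by positivity) ?_ ?_ ?_ ?_
  · intro v v' f f' h h'
    rw [map_add, map_add]
    filter_upwards [h, h', AEEqFun.coeFn_add (WSob.val f) (WSob.val f'),
      AEEqFun.coeFn_add (WSob.val v) (WSob.val v')] with z h1 h2 h3 h4
    rw [h3, h4, Pi.add_apply, Pi.add_apply, h1, h2, map_add]
  · intro c v f h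
    rw [map_smul, map_smul]
    filter_upwards [h, AEEqFun.coeFn_smul c (WSob.val f),
      AEEqFun.coeFn_smul c (WSob.val v)] with z h1 h3 h4
    rw [h3, h4, Pi.smul_apply, Pi.smul_apply, h1]
    exact (((a z).restrictScalars ℝ).map_smul c _).symm
  · intro v f f' h h'
    exact WSob.val_injective (AEEqFun.ext (h.trans h'.symm))
  · intro v
    -- Uses `w a v = (w a w⁻¹) (w v)`.
    have h1 := SobBound.bilin (opEval n) hC v.sobBound
    have h2 : SobBound D k (fun z => wOp w z (a z (WSob.val v z)))
        (2 ^ k * (‖opEval n‖₊ * C * ‖v‖₊)) := by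
      refine h1.congr ?_
      filter_upwards [ae_mem_inner D] with z hz
      rw [opEval_apply, mul_apply_eq_comp, mul_apply_eq_comp,
        wInv_wOp_apply w (inner_subset_carrier D hz)]
    obtain ⟨f, hf, hb⟩ := exists_wSob h2
    refine ⟨f, hf, hb.trans (le_of_eq ?_)⟩
    push_cast
    ring

/-- Weak derivatives of an element of a weighted Sobolev space. -/
theorem isWeakDeriv_val {α : ℕ × ℕ} (hα : α.1 + α.2 = 1) {v u g : ℂ → Cn n}
    (hv : (fun z => wOp w z (v z)) =ᵐ[D.vol] u) (h : IsWeakDeriv D D.inner α u g) :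
    IsWeakDeriv D D.inner α v (fun z => pderiv α (wInv w) z (u z) + wInv w z (g z)) := by
  refine (h.bilin (opEval n) (isOpen_inner D) hα (a := wInv w)
    fun z hz => contDiffAt_wInv w (inner_subset_carrier D hz)).congr ?_ ae_eq_rfl
  filter_upwards [hv, ae_mem_inner D] with z hz hi
  rw [← hz]
  exact wInv_wOp_apply w (inner_subset_carrier D hi) _

/-- The operator `∂̄ : H_{2,μ} → H_{1,μ}` without boundary conditions is bounded. -/
theorem exists_dbarFull : ∃ T : WSob w 2 →L[ℝ] WSob w 1,
    ∀ v, IsDbar D (WSob.val v) (WSob.val (T v)) := by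
  obtain ⟨K₁, h1⟩ := exists_logDeriv_bound w 1 (α := (1, 0)) rfl
  obtain ⟨K₂, h2⟩ := exists_logDeriv_bound w 1 (α := (0, 1)) rfl
  -- By `w ∂v = (w ∂(w⁻¹)) (w v) + ∂(w v)`, each direction contributes a logarithmic derivative term
  -- and a `1`; the second direction also carries the factor `i`.
  set Q : ℝ≥0 := 2 ^ 1 * (‖opEval n‖₊ * K₁) + 1 +
    2 ^ 1 * (‖opEval n‖₊ * ‖opI n‖₊ * (2 ^ 1 * (‖opEval n‖₊ * K₂) + 1)) with hQ
  refine (exists_clm_of_relation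
    (fun (v : WSob w 2) (f : WSob w 1) => IsDbar D (WSob.val v) (WSob.val f))
    (C := √((multiIndices 1).card) * Q) (by positivity) ?_ ?_ ?_ ?_).imp fun T hT => hT.1
  · intro v v' f f' h h'
    rw [map_add, map_add]
    exact (h.add h').congr (AEEqFun.coeFn_add _ _).symm (AEEqFun.coeFn_add _ _).symm
  · intro c v f h
    rw [map_smul, map_smul]
    exact (h.const_smul c).congr (AEEqFun.coeFn_smul c _).symm (AEEqFun.coeFn_smul c _).symm
  · exact fun v f f' h h' => WSob.val_injective (AEEqFun.ext (h.unique h'))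
  · intro v
    have hb := v.sobBound
    obtain ⟨g₁, w1, b1⟩ := hb.2 (1, 0) rfl
    obtain ⟨g₂, w2, b2⟩ := hb.2 (0, 1) rfl
    have v1 := isWeakDeriv_val w rfl ae_eq_rfl w1
    have v2 := isWeakDeriv_val w rfl ae_eq_rfl w2
    have c1 := (SobBound.bilin (opEval n) h1 hb.of_succ).add b1
    have c2 := SobBound.bilin (opEval n) (CBound.const (opI n))
      ((SobBound.bilin (opEval n) h2 hb.of_succ).add b2)
    have c3 := c1.add c2
    obtain ⟨f, hf, hn⟩ := exists_wSob (w := w) (c := Q * ‖v‖₊)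
      (v := fun z => (pderiv (1, 0) (wInv w) z (wOp w z (WSob.val v z)) + wInv w z (g₁ z)) +
        Complex.I • (pderiv (0, 1) (wInv w) z (wOp w z (WSob.val v z)) + wInv w z (g₂ z))) (by
        refine (c3.congr ?_).mono (le_of_eq ?_)
        · filter_upwards [ae_mem_inner D] with z hz
          simp only [opEval_apply, opI_apply, map_add, map_smul,
            wOp_wInv_apply w (inner_subset_carrier D hz), mul_apply_eq_comp, smul_add]
        · rw [hQ]; ring)
    refine ⟨f, ⟨_, _, v1, v2, hf⟩, hn.trans (le_of_eq ?_)⟩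
    push_cast
    ring

end Bounded

/-! ### Vanishing boundary traces of products. -/

section ZeroTrace

variable {F F' G : Type*} [NormedAddCommGroup F] [NormedSpace ℝ F]
  [NormedAddCommGroup F'] [NormedSpace ℝ F'] [NormedAddCommGroup G] [NormedSpace ℝ G]
  {α : ℕ × ℕ}

theorem hasZeroTrace_iff {f : ℂ → F} : HasZeroTrace D f ↔
    ∀ α : ℕ × ℕ, α.1 + α.2 = 1 → ∃ g, IsWeakDeriv D univ α f g := by
  refine ⟨fun h α hα => ?_, fun h => ⟨h _ rfl, h _ rfl⟩⟩
  obtain ⟨a, b⟩ := α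
  obtain ⟨rfl, rfl⟩ | ⟨rfl, rfl⟩ : (a = 1 ∧ b = 0) ∨ (a = 0 ∧ b = 1) := by
    simp only at hα; omega
  exacts [h.1, h.2]

theorem HasZeroTrace.bilin [CompleteSpace F] [CompleteSpace F'] [FiniteDimensional ℝ G]
    (B : G →L[ℝ] F →L[ℝ] F') {a : ℂ → G} (ha : ContDiff ℝ ∞ a) {f : ℂ → F}
    (h : HasZeroTrace D f) : HasZeroTrace D (fun z => B (a z) (f z)) := by
  rw [hasZeroTrace_iff] at h ⊢
  intro α hα
  obtain ⟨g, hg⟩ := h α hα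
  exact ⟨_, hg.bilin B isOpen_univ hα fun z _ => ha.contDiffAt⟩

/-- A smooth truncation of the identity of the real line near zero. -/
theorem exists_truncation : ∃ θ : ℝ → ℝ, ContDiff ℝ ∞ θ ∧ (∀ x, |x| ≤ 1 → θ x = 0) ∧
    (∀ x, 2 ≤ |x| → θ x = x) ∧ (∀ x, |θ x| ≤ |x|) ∧ ∃ M, ∀ x, |deriv θ x| ≤ M := by
  let b : ContDiffBump (0 : ℝ) := ⟨1, 2, one_pos, one_lt_two⟩
  have hθ : ContDiff ℝ ∞ fun x => x * (1 - b x) := contDiff_id.mul (contDiff_const.sub b.contDiff)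
  have h2 : ∀ x, 2 ≤ |x| → x * (1 - b x) = x := fun x hx => by
    rw [b.zero_of_le_dist (by simpa using hx)]; ring
  refine ⟨fun x => x * (1 - b x), hθ, fun x hx => ?_, h2, fun x => ?_, ?_⟩
  · have : b x = 1 := b.one_of_mem_closedBall (by simpa using hx)
    simp only [this]; ring
  · rw [abs_mul]
    refine mul_le_of_le_one_right (abs_nonneg x) ?_
    rw [abs_le]
    constructor <;> linarith [b.nonneg' x, b.le_one (x := x)]
  · obtain ⟨M, hM⟩ := (isCompact_Icc (a := (-2 : ℝ)) (b := 2)).exists_bound_of_continuousOn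
      (hθ.continuous_deriv (by simp)).continuousOn
    refine ⟨max M 1, fun x => ?_⟩
    by_cases hx : x ∈ Icc (-2 : ℝ) 2
    · exact (hM x hx).trans (le_max_left _ _)
    · have hx' : 2 < |x| := by
        rw [lt_abs]
        by_contra! hcon
        exact hx ⟨by linarith [hcon.2], hcon.1⟩
      have : (fun x => x * (1 - b x)) =ᶠ[𝓝 x] fun x => x := by
        filter_upwards [(isOpen_lt continuous_const continuous_abs).mem_nhds hx'] with y hy
        exact h2 y (le_of_lt hy)
      rw [this.deriv_eq, deriv_id'']
      simp

theorem mem_frontier_of_mem_carrier {z : ℂ} (hz : z ∈ D.carrier) (hi : z ∉ D.inner) :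
    z ∈ frontier D.carrier := ⟨subset_closure hz, hi⟩

/-- A smooth function which vanishes on the boundary times a function of class `H¹` has zero
trace. -/
theorem IsWeakDeriv.smul_of_eq_zero_on_frontier (hα : α.1 + α.2 = 1) {g : ℂ → ℝ}
    (hg : ContDiff ℝ ∞ g) (h0 : ∀ z ∈ frontier D.carrier, g z = 0) {f f' : ℂ → F}
    (hf : LocallyIntegrableOn f univ D.vol) (hf' : LocallyIntegrableOn f' univ D.vol)
    (h : IsWeakDeriv D D.inner α f f') :
    IsWeakDeriv D univ α (fun z => g z • f z)
      (fun z => {z | g z ≠ 0}.indicator (fun z => pderiv α g z • f z) z + g z • f' z) := by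
  obtain ⟨θ, hθ, θ0, θ2, θle, M, hM⟩ := exists_truncation
  have hgc := hg.continuous
  have hgd : Continuous (pderiv α g) := (contDiff_pderiv α hg).continuous
  have hset : MeasurableSet {z | g z ≠ 0} := (isOpen_ne_fun hgc continuous_const).measurableSet
  have i1 : LocallyIntegrableOn (fun z => g z • f z) univ D.vol :=
    hf.continuousOn_smul isOpen_univ.isLocallyClosed hgc.continuousOn
  have i2 : LocallyIntegrableOn (fun z => g z • f' z) univ D.vol :=
    hf'.continuousOn_smul isOpen_univ.isLocallyClosed hgc.continuousOn
  have i3 : LocallyIntegrableOn (fun z => pderiv α g z • f z) univ D.vol :=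
    hf.continuousOn_smul isOpen_univ.isLocallyClosed hgd.continuousOn
  have i4 : LocallyIntegrableOn ({z | g z ≠ 0}.indicator (fun z => pderiv α g z • f z))
      univ D.vol := fun x hx => by
    obtain ⟨T, hT, hi⟩ := i3 x hx
    exact ⟨T, hT, Integrable.indicator hi hset⟩
  refine ⟨i1, i4.add i2, fun φ hφ hc hs => ?_⟩
  have hφc := hφ.continuous
  have hφd : Continuous (pderiv α φ) := (contDiff_pderiv α hφ).continuous
  have hcd : HasCompactSupport (pderiv α φ) :=
    hc.of_isClosed_subset (isClosed_tsupport _) (tsupport_pderiv α φ)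
  -- `T N = θ (m g) / m` vanishes near the zero set of `g`, hence near every boundary point. It
  -- tends to `g`, and its derivative is at most `M |∂g|` uniformly in `N`.
  let m : ℕ → ℝ := fun N => (N : ℝ) + 1
  have hm : ∀ N, 0 < m N := fun N => by positivity
  let T : ℕ → ℂ → ℝ := fun N z => (m N)⁻¹ * θ (m N * g z)
  have hTs : ∀ N, ContDiff ℝ ∞ (T N) := fun N =>
    contDiff_const.mul (hθ.comp (contDiff_const.mul hg))
  have hTd : ∀ N z, pderiv α (T N) z = deriv θ (m N * g z) * pderiv α g z := by
    intro N z
    have hgz : HasFDerivAt g (fderiv ℝ g z) z :=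
      hg.contDiffAt.differentiableAt_of_top.hasFDerivAt
    have hθz : HasDerivAt θ (deriv θ (m N * g z)) (m N * g z) :=
      hθ.contDiffAt.differentiableAt (by simp) |>.hasDerivAt
    have := (hθz.comp_hasFDerivAt z (hgz.const_mul (m N))).const_mul (m N)⁻¹
    rw [pderiv_eq_dirDeriv hα, pderiv_eq_dirDeriv hα, dirDeriv, dirDeriv]
    have e : fderiv ℝ (T N) z = _ := this.fderiv
    rw [e]
    have := (hm N).ne'
    simp only [smul_apply, smul_eq_mul]
    field_simp
  have hTle : ∀ N z, |T N z| ≤ |g z| := by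
    intro N z
    simp only [T]
    rw [abs_mul, abs_inv, abs_of_pos (hm N), inv_mul_le_iff₀ (hm N)]
    refine (θle _).trans ?_
    rw [abs_mul, abs_of_pos (hm N)]
  have hmtop : Tendsto m atTop atTop :=
    tendsto_atTop_add_const_right _ _ tendsto_natCast_atTop_atTop
  have hlarge : ∀ z, g z ≠ 0 → ∀ᶠ N in atTop, 2 < |m N * g z| := by
    intro z hz
    have : Tendsto (fun N => m N * |g z|) atTop atTop :=
      hmtop.atTop_mul_const (abs_pos.2 hz)
    filter_upwards [this.eventually_gt_atTop 2] with N hN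
    rwa [abs_mul, abs_of_pos (hm N)]
  have hTlim : ∀ z, Tendsto (fun N => T N z) atTop (𝓝 (g z)) := by
    intro z
    by_cases hz : g z = 0
    · simp [T, hz, θ0 0 (by simp)]
    · refine tendsto_const_nhds.congr' ?_
      filter_upwards [hlarge z hz] with N hN
      simp only [T]
      rw [θ2 _ hN.le, inv_mul_cancel_left₀ (hm N).ne']
  -- On the zero set of `g` the derivative of every `T N` vanishes, whence the indicator in the
  -- limit.
  have hdlim : ∀ z, Tendsto (fun N => pderiv α (T N) z • f z) atTop
      (𝓝 ({z | g z ≠ 0}.indicator (fun z => pderiv α g z • f z) z)) := by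
    intro z
    by_cases hz : g z = 0
    · rw [indicator_of_notMem (by simpa using hz)]
      have hd0 : deriv θ 0 = 0 := by
        have : θ =ᶠ[𝓝 0] fun _ => 0 := by
          filter_upwards [Metric.closedBall_mem_nhds (0 : ℝ) one_pos] with y hy
          exact θ0 y (by simpa using hy)
        rw [this.deriv_eq, deriv_const]
      simp [hTd, hz, hd0]
    · rw [indicator_of_mem (by exact hz)]
      refine tendsto_const_nhds.congr' ?_
      filter_upwards [hlarge z hz] with N hN
      have : θ =ᶠ[𝓝 (m N * g z)] fun x => x := by
        filter_upwards [(isOpen_lt continuous_const continuous_abs).mem_nhds hN] with y hy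
        exact θ2 y (le_of_lt hy)
      rw [hTd, this.deriv_eq, deriv_id'', one_mul]
  -- Since `T N` vanishes near every boundary point, cutting off `φ T N` outside the interior keeps
  -- it smooth. So `ψ N` is a test function for `h`, while `φ` is not.
  let ψ : ℕ → ℂ → ℝ := fun N => D.inner.indicator (fun z => φ z * T N z)
  have hψin : ∀ N, ∀ z ∈ D.inner, ψ N =ᶠ[𝓝 z] fun z => φ z * T N z := by
    intro N z hz
    filter_upwards [(isOpen_inner D).mem_nhds hz] with x hx
    exact indicator_of_mem hx _
  have hψout : ∀ N, ∀ z ∉ D.inner, ψ N =ᶠ[𝓝 z] fun _ => 0 := by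
    intro N z hz
    by_cases hzc : z ∈ D.carrier
    · have hgz := h0 z (mem_frontier_of_mem_carrier hzc hz)
      have ho : IsOpen {x | |m N * g x| < 1} :=
        isOpen_lt (continuous_abs.comp (continuous_const.mul hgc)) continuous_const
      filter_upwards [ho.mem_nhds (by simp [hgz])] with x hx
      have : T N x = 0 := by simp [T, θ0 _ (le_of_lt hx)]
      change D.inner.indicator (fun z => φ z * T N z) x = 0
      by_cases hxi : x ∈ D.inner
      · rw [indicator_of_mem hxi, this, mul_zero]
      · exact indicator_of_notMem hxi _
    · filter_upwards [(isClosed_carrier D).isOpen_compl.mem_nhds hzc] with x hx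
      exact indicator_of_notMem (fun hi => hx (inner_subset_carrier D hi)) _
  have hψs : ∀ N, ContDiff ℝ ∞ (ψ N) := fun N => contDiff_iff_contDiffAt.2 fun z => by
    by_cases hz : z ∈ D.inner
    · exact (hφ.mul (hTs N)).contDiffAt.congr_of_eventuallyEq (hψin N z hz)
    · exact contDiffAt_const.congr_of_eventuallyEq (hψout N z hz)
  have hψt : ∀ N, tsupport (ψ N) ⊆ D.inner := fun N z hz => by
    by_contra hcon
    exact (notMem_tsupport_iff_eventuallyEq.2 (hψout N z hcon)) hz
  have hψc : ∀ N, HasCompactSupport (ψ N) := fun N =>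
    hc.of_isClosed_subset (isClosed_tsupport _) (closure_mono fun z hz h0 => hz (by
      simp [ψ, h0]))
  have key : ∀ N, ∫ z, (pderiv α φ z • T N z • f z + φ z • pderiv α (T N) z • f z) ∂D.vol =
      -∫ z, φ z • T N z • f' z ∂D.vol := by
    intro N
    have e := h.2.2 (ψ N) (hψs N) (hψc N) (hψt N)
    rw [hα, pow_one, neg_smul, one_smul] at e
    have e1 : ∫ z, pderiv α (ψ N) z • f z ∂D.vol =
        ∫ z, (pderiv α φ z • T N z • f z + φ z • pderiv α (T N) z • f z) ∂D.vol := by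
      refine integral_congr_ae ?_
      filter_upwards [ae_mem_inner D] with z hz
      have h1 := (pderiv_congr hα (hψin N z hz)).self_of_nhds
      have h2 := pderiv_bilin_apply (ContinuousLinearMap.mul ℝ ℝ) hα
        (hφ.contDiffAt (x := z)).differentiableAt_of_top
        ((hTs N).contDiffAt (x := z)).differentiableAt_of_top
      simp only [ContinuousLinearMap.mul_apply'] at h2
      rw [h1, h2, add_smul, mul_smul (pderiv α φ z), mul_smul (φ z)]
    have e2 : ∫ z, ψ N z • f' z ∂D.vol = ∫ z, φ z • T N z • f' z ∂D.vol := by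
      refine integral_congr_ae ?_
      filter_upwards [ae_mem_inner D] with z hz
      rw [(hψin N z hz).self_of_nhds, mul_smul]
    rw [← e1, e, e2]
  have m1 := integrable_smul_test i1 hφd hcd (subset_univ _)
  have m2 := integrable_smul_test i3 hφc hc (subset_univ _)
  have m3 := integrable_smul_test i2 hφc hc (subset_univ _)
  have m4 := integrable_smul_test i4 hφc hc (subset_univ _)
  have L1 : Tendsto
      (fun N => ∫ z, (pderiv α φ z • T N z • f z + φ z • pderiv α (T N) z • f z) ∂D.vol)
      atTop (𝓝 (∫ z, (pderiv α φ z • g z • f z +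
        φ z • {z | g z ≠ 0}.indicator (fun z => pderiv α g z • f z) z) ∂D.vol)) := by
    refine tendsto_integral_of_dominated_convergence
      (fun z => ‖pderiv α φ z • g z • f z‖ + M * ‖φ z • pderiv α g z • f z‖) (fun N => ?_)
      (m1.norm.add (m2.norm.const_mul M)) (fun N => Eventually.of_forall fun z => ?_)
      (Eventually.of_forall fun z => ?_)
    · have hfm : AEStronglyMeasurable f D.vol := by
        simpa using hf.aestronglyMeasurable
      exact (hφd.aestronglyMeasurable.smul ((hTs N).continuous.aestronglyMeasurable.smul hfm)).add
        (hφc.aestronglyMeasurable.smul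
          ((contDiff_pderiv α (hTs N)).continuous.aestronglyMeasurable.smul hfm))
    · refine (norm_add_le _ _).trans (add_le_add ?_ ?_)
      · simp only [norm_smul, Real.norm_eq_abs]
        exact mul_le_mul_of_nonneg_left
          (mul_le_mul_of_nonneg_right (hTle N z) (norm_nonneg _)) (abs_nonneg _)
      · simp only [norm_smul, Real.norm_eq_abs, hTd, abs_mul]
        calc |φ z| * (|deriv θ (m N * g z)| * |pderiv α g z| * ‖f z‖)
            ≤ |φ z| * (M * |pderiv α g z| * ‖f z‖) := by gcongr; exact hM _
          _ = _ := by ring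
    · exact (((hTlim z).smul_const (f z)).const_smul _).add ((hdlim z).const_smul _)
  have L2 : Tendsto (fun N => -∫ z, φ z • T N z • f' z ∂D.vol)
      atTop (𝓝 (-∫ z, φ z • g z • f' z ∂D.vol)) := by
    refine (tendsto_integral_of_dominated_convergence
      (fun z => ‖φ z • g z • f' z‖) (fun N => ?_) m3.norm
      (fun N => Eventually.of_forall fun z => ?_) (Eventually.of_forall fun z => ?_)).neg
    · have hfm : AEStronglyMeasurable f' D.vol := by
        simpa using hf'.aestronglyMeasurable
      exact hφc.aestronglyMeasurable.smul ((hTs N).continuous.aestronglyMeasurable.smul hfm)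
    · simp only [norm_smul, Real.norm_eq_abs]
      exact mul_le_mul_of_nonneg_left
        (mul_le_mul_of_nonneg_right (hTle N z) (norm_nonneg _)) (abs_nonneg _)
    · exact ((hTlim z).smul_const (f' z)).const_smul _
  have lim := tendsto_nhds_unique (L1.congr key) L2
  rw [integral_add m1 m4] at lim
  rw [hα, pow_one, neg_smul, one_smul, eq_sub_of_add_eq lim]
  simp only [smul_add]
  rw [integral_add m4 m3]
  abel

/-- An operator valued smooth function which vanishes on the boundary maps functions of class `H¹`
to functions with zero trace. -/
theorem hasZeroTrace_bilin_of_eq_zero_on_frontier [CompleteSpace F] [CompleteSpace F']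
    [FiniteDimensional ℝ G] (B : G →L[ℝ] F →L[ℝ] F') {a : ℂ → G} (ha : ContDiff ℝ ∞ a)
    (h0 : ∀ z ∈ frontier D.carrier, a z = 0) {f : ℂ → F}
    (hf : ∀ α : ℕ × ℕ, α.1 + α.2 = 1 → ∃ f', LocallyIntegrableOn f univ D.vol ∧
      LocallyIntegrableOn f' univ D.vol ∧ IsWeakDeriv D D.inner α f f') :
    HasZeroTrace D (fun z => B (a z) (f z)) := by
  rw [hasZeroTrace_iff]
  intro α hα
  obtain ⟨f', h1, h2, h3⟩ := hf α hα
  have key := IsWeakDeriv.sum Finset.univ fun i _ =>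
    (h3.clm (B (Module.finBasis ℝ G i))).smul_of_eq_zero_on_frontier hα
      (g := fun z => finCoord G i (a z)) ((finCoord G i).contDiff.comp ha)
      (fun z hz => by rw [h0 z hz, map_zero]) (locallyIntegrableOn_clm _ h1)
      (locallyIntegrableOn_clm _ h2)
  refine ⟨_, key.congr (Eventually.of_forall fun z => ?_) ae_eq_rfl⟩
  exact (bilin_eq_sum B (a z) (f z)).symm

end ZeroTrace

/-! ### Test integrals as continuous functionals on `L²`. -/

section Pairing

variable {F F' G : Type*} [NormedAddCommGroup F] [NormedSpace ℝ F]
  [NormedAddCommGroup F'] [NormedSpace ℝ F'] [NormedAddCommGroup G] [NormedSpace ℝ G]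
  {α : ℕ × ℕ}

theorem aestronglyMeasurable_of_continuousOn {G : Type*} [NormedAddCommGroup G] {c : ℂ → G}
    (hc : ContinuousOn c D.carrier) :
    AEStronglyMeasurable c D.vol :=
  (hc.mono (inner_subset_carrier D)).aestronglyMeasurable (isOpen_inner D).measurableSet

theorem exists_bound_ae_of_continuousOn {G : Type*} [NormedAddCommGroup G] {c : ℂ → G}
    (hc : ContinuousOn c D.carrier) {K : Set ℂ}
    (hK : IsCompact K) : ∃ C : ℝ, ∀ᵐ z ∂D.vol, z ∈ K → ‖c z‖ ≤ C := by
  obtain ⟨C, hC⟩ := (hK.inter_left (isClosed_carrier D)).exists_bound_of_continuousOn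
    (hc.mono inter_subset_left)
  exact ⟨C, (ae_mem_inner D).mono fun z hz hzK => hC z ⟨inner_subset_carrier D hz, hzK⟩⟩

/-- On compact pieces of the closed domain `c` is bounded. No global bound is needed, which allows
coefficients such as `wInv` that may grow at the punctures. -/
theorem locallyIntegrableOn_bilin (B : G →L[ℝ] F →L[ℝ] F') {c : ℂ → G}
    (hc : ContinuousOn c D.carrier) {u : ℂ → F} (hu : MemLp u 2 D.vol) :
    LocallyIntegrableOn (fun z => B (c z) (u z)) univ D.vol := by
  have hul : LocallyIntegrable u D.vol := hu.locallyIntegrable (by norm_num)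
  intro x _
  rw [nhdsWithin_univ]
  refine ⟨Metric.closedBall x 1, Metric.closedBall_mem_nhds x one_pos, ?_⟩
  obtain ⟨C, hC⟩ := exists_bound_ae_of_continuousOn hc (isCompact_closedBall x 1)
  have hi : IntegrableOn u (Metric.closedBall x 1) D.vol :=
    hul.integrableOn_isCompact (isCompact_closedBall x 1)
  refine Integrable.mono' (hi.norm.const_mul (‖B‖ * C))
    (B.aestronglyMeasurable_comp₂ (aestronglyMeasurable_of_continuousOn hc) hu.1).restrict ?_
  filter_upwards [ae_restrict_of_ae hC, ae_restrict_mem Metric.isClosed_closedBall.measurableSet]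
    with z h1 h2
  refine (B.le_opNorm₂ _ _).trans ?_
  gcongr
  exact h1 h2

/-- The compact support of `ψ` puts the coefficient `ψ B(c ·)` in `L²`, so the integral is an
`L²`-pairing. The closedness statements below rest on this. -/
theorem continuous_integral_bilin [CompleteSpace F'] (B : G →L[ℝ] F →L[ℝ] F') {c : ℂ → G}
    (hc : ContinuousOn c D.carrier) {ψ : ℂ → ℝ} (hψ : Continuous ψ) (hs : HasCompactSupport ψ) :
    Continuous fun u : Lp F 2 D.vol => ∫ z, ψ z • B (c z) (u z) ∂D.vol := by
  set κ : ℂ → F →L[ℝ] F' := fun z => ψ z • B (c z)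
  have hκc : ContinuousOn κ D.carrier := hψ.continuousOn.smul (B.continuous.comp_continuousOn hc)
  have hκ : MemLp κ 2 D.vol := by
    have e : κ = (tsupport ψ).indicator κ := by
      funext z
      by_cases hz : z ∈ tsupport ψ
      · rw [indicator_of_mem hz]
      · rw [indicator_of_notMem hz]
        simp [κ, image_eq_zero_of_notMem_tsupport hz]
    have hK : IsCompact (tsupport ψ) := hs
    rw [e, memLp_indicator_iff_restrict (isClosed_tsupport ψ).measurableSet]
    have : IsFiniteMeasure (D.vol.restrict (tsupport ψ)) := ⟨by
      rw [Measure.restrict_apply_univ]; exact hK.measure_lt_top⟩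
    obtain ⟨C, hC⟩ := exists_bound_ae_of_continuousOn hκc hK
    refine MemLp.of_bound (aestronglyMeasurable_of_continuousOn hκc).restrict C ?_
    filter_upwards [ae_restrict_of_ae hC, ae_restrict_mem (isClosed_tsupport ψ).measurableSet]
      with z h1 h2
    exact h1 h2
  have e : (fun u : Lp F 2 D.vol => ∫ z, ψ z • B (c z) (u z) ∂D.vol) = fun u =>
      (ContinuousLinearMap.id ℝ (F →L[ℝ] F')).lpPairing D.vol 2 2 hκ.toLp u := by
    funext u
    rw [ContinuousLinearMap.lpPairing_eq_integral]
    refine integral_congr_ae ?_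
    filter_upwards [hκ.coeFn_toLp] with z hz
    rw [hz]
    rfl
  rw [e]
  exact ContinuousLinearMap.continuous _

/-- Test functions on the plane with support in `S`. -/
def TestFun (S : Set ℂ) : Type :=
  {φ : ℂ → ℝ // ContDiff ℝ ∞ φ ∧ HasCompactSupport φ ∧ tsupport φ ⊆ S}

theorem TestFun.hasCompactSupport_pderiv {S : Set ℂ} (φ : TestFun S) (α : ℕ × ℕ) :
    HasCompactSupport (pderiv α φ.1) :=
  φ.2.2.1.of_isClosed_subset (isClosed_tsupport _) (tsupport_pderiv α φ.1)

theorem isWeakDeriv_iff_of_memLp {S : Set ℂ} {f g : ℂ → F} (hf : MemLp f 2 D.vol)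
    (hg : MemLp g 2 D.vol) : IsWeakDeriv D S α f g ↔ ∀ φ : TestFun S,
      ∫ z, pderiv α φ.1 z • f z ∂D.vol = (-1 : ℝ) ^ (α.1 + α.2) • ∫ z, φ.1 z • g z ∂D.vol :=
  ⟨fun h φ => h.2.2 φ.1 φ.2.1 φ.2.2.1 φ.2.2.2, fun h =>
    ⟨locallyIntegrableOn_of_memLp hf, locallyIntegrableOn_of_memLp hg,
      fun φ h1 h2 h3 => h ⟨φ, h1, h2, h3⟩⟩⟩

theorem continuous_integral_smul [CompleteSpace F] {ψ : ℂ → ℝ} (hψ : Continuous ψ)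
    (hs : HasCompactSupport ψ) : Continuous fun u : Lp F 2 D.vol => ∫ z, ψ z • u z ∂D.vol := by
  simpa using continuous_integral_bilin (D := D) (ContinuousLinearMap.lsmul ℝ ℝ : ℝ →L[ℝ] F →L[ℝ] F)
    (c := fun _ => (1 : ℝ)) continuousOn_const hψ hs

end Pairing

/-! ### Completeness of the weighted spaces; trace conditions are closed. -/

section Completeness

variable (w : Weight D μ) {k : ℕ}

/-- The index of the function itself in its jet. -/
def jetZero (k : ℕ) : multiIndices k := ⟨(0, 0), mem_multiIndices.2 (Nat.zero_le _)⟩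

theorem isometry_jet : Isometry (WSob.jet w k) :=
  AddMonoidHomClass.isometry_of_norm _ fun _ => rfl

variable {w}

theorem coeFn_jet (v : WSob w k) (α : multiIndices k) :
    WSob.jet w k v α =ᵐ[D.vol] v.weightedDeriv α := (v.weightedDeriv_memLp α).coeFn_toLp

theorem coeFn_jet_zero (v : WSob w k) :
    WSob.jet w k v (jetZero k) =ᵐ[D.vol] fun z => wOp w z (WSob.val v z) :=
  (coeFn_jet v _).trans (v.weightedDeriv_spec (jetZero k)).self_of_zero.symm

theorem isWeakDeriv_jet (v : WSob w k) (α : multiIndices k) :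
    IsWeakDeriv D D.inner α.1 (fun z => wOp w z (WSob.val v z)) (WSob.jet w k v α) :=
  (v.weightedDeriv_spec α).congr ae_eq_rfl (coeFn_jet v α).symm

/-- A tuple of `L²` functions is a jet as soon as its entries are weak derivatives of the entry at
`jetZero k`: multiply that entry by `w⁻¹`. The identities on the right are closed conditions, which
yields completeness. -/
theorem range_jet : range (WSob.jet w k) =
    {u : PiLp 2 (fun _ : multiIndices k => Lp (Cn n) 2 D.vol) |
      ∀ (α : multiIndices k) (φ : TestFun D.inner),
      ∫ z, pderiv α.1 φ.1 z • u (jetZero k) z ∂D.vol =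
        (-1 : ℝ) ^ (α.1.1 + α.1.2) • ∫ z, φ.1 z • u α z ∂D.vol} := by
  ext u
  have hiff : ∀ α : multiIndices k, _ := fun α =>
    isWeakDeriv_iff_of_memLp (S := D.inner) (α := α.1) (Lp.memLp (u (jetZero k))) (Lp.memLp (u α))
  simp only [mem_ofPred_eq, ← hiff]
  constructor
  · rintro ⟨v, rfl⟩ α
    exact (isWeakDeriv_jet v α).congr (coeFn_jet_zero v).symm ae_eq_rfl
  · intro h
    have hm : AEStronglyMeasurable (fun z => wInv w z (u (jetZero k) z)) D.vol :=
      (opEval n).aestronglyMeasurable_comp₂ (aestronglyMeasurable_of_continuousOn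
        fun z hz => (contDiffAt_wInv w hz).continuousAt.continuousWithinAt) (Lp.memLp _).1
    have e : (fun z => wOp w z (AEEqFun.mk _ hm z)) =ᵐ[D.vol] u (jetZero k) := by
      filter_upwards [AEEqFun.coeFn_mk _ hm, ae_mem_inner D] with z h1 h2
      rw [h1, wOp_wInv_apply w (inner_subset_carrier D h2)]
    let v : WSob w k := ⟨AEEqFun.mk _ hm, fun α hα =>
      ⟨u ⟨α, hα⟩, Lp.memLp _, (h ⟨α, hα⟩).congr e.symm ae_eq_rfl⟩⟩
    refine ⟨v, ?_⟩
    ext1 α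
    refine Lp.ext ?_
    exact (isWeakDeriv_jet v α).unique ((h α).congr e.symm ae_eq_rfl)

instance : CompleteSpace (WSob w k) := by
  rw [completeSpace_iff_isComplete_range (isometry_jet w).isUniformInducing, range_jet]
  refine IsClosed.isComplete ?_
  simp only [ofPred_forall]
  refine isClosed_iInter fun α => isClosed_iInter fun φ => ?_
  refine isClosed_eq ?_ ((continuous_const_smul _).comp ?_)
  · exact (continuous_integral_smul (contDiff_pderiv α.1 φ.2.1).continuous
      (φ.hasCompactSupport_pderiv α.1)).comp (PiLp.continuous_apply 2 _ (jetZero k))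
  · exact (continuous_integral_smul φ.2.1.continuous φ.2.2.1).comp (PiLp.continuous_apply 2 _ α)

/-- The index of a first order derivative in a jet. -/
def jetOne (hk : 1 ≤ k) {α : ℕ × ℕ} (hα : α.1 + α.2 = 1) : multiIndices k :=
  ⟨α, mem_multiIndices.2 (hα.trans_le hk)⟩

/-- `HasZeroTrace` asks for some weak derivative on the plane. By uniqueness on the interior it must
be the one of the product rule, so the condition is a family of identities between continuous
functionals of the jet. -/
theorem isClosed_setOf_hasZeroTrace {F G : Type*} [NormedAddCommGroup F] [NormedSpace ℝ F]
    [CompleteSpace F] [NormedAddCommGroup G] [NormedSpace ℝ G] [FiniteDimensional ℝ G]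
    (hk : 1 ≤ k) (B : G →L[ℝ] Cn n →L[ℝ] F) {N : ℂ → G}
    (hN : ∀ z ∈ D.carrier, ContDiffAt ℝ ∞ N z) :
    IsClosed {v : WSob w k | HasZeroTrace D (fun z => B (N z) (wOp w z (WSob.val v z)))} := by
  have hNc : ContinuousOn N D.carrier := fun z hz => (hN z hz).continuousAt.continuousWithinAt
  have hNd : ∀ α : ℕ × ℕ, α.1 + α.2 = 1 → ContinuousOn (pderiv α N) D.carrier := fun α hα z hz =>
    (contDiffAt_pderiv hα (hN z hz)).continuousAt.continuousWithinAt
  have hset : {v : WSob w k | HasZeroTrace D (fun z => B (N z) (wOp w z (WSob.val v z)))} =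
      {v : WSob w k | ∀ (α : {α : ℕ × ℕ // α.1 + α.2 = 1}) (φ : TestFun univ),
        ∫ z, pderiv α.1 φ.1 z • B (N z) (WSob.jet w k v (jetZero k) z) ∂D.vol =
          -(∫ z, φ.1 z • B (pderiv α.1 N z) (WSob.jet w k v (jetZero k) z) ∂D.vol +
            ∫ z, φ.1 z • B (N z) (WSob.jet w k v (jetOne hk α.2) z) ∂D.vol)} := by
    ext v
    simp only [mem_ofPred_eq]
    have e0 : (fun z => B (N z) (WSob.jet w k v (jetZero k) z)) =ᵐ[D.vol]
        fun z => B (N z) (wOp w z (WSob.val v z)) :=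
      (coeFn_jet_zero v).mono fun z hz => congrArg (B (N z)) hz
    have l0 := locallyIntegrableOn_bilin B hNc (Lp.memLp (WSob.jet w k v (jetZero k)))
    have l1 := fun α hα => locallyIntegrableOn_bilin B (hNd α hα)
      (Lp.memLp (WSob.jet w k v (jetZero k)))
    have l2 := fun (α : ℕ × ℕ) (hα : α.1 + α.2 = 1) => locallyIntegrableOn_bilin B hNc
      (Lp.memLp (WSob.jet w k v (jetOne hk hα)))
    have hw : ∀ (α : ℕ × ℕ) (hα : α.1 + α.2 = 1), IsWeakDeriv D D.inner α
        (fun z => B (N z) (WSob.jet w k v (jetZero k) z))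
        (fun z => B (pderiv α N z) (WSob.jet w k v (jetZero k) z) +
          B (N z) (WSob.jet w k v (jetOne hk hα) z)) := fun α hα =>
      ((isWeakDeriv_jet v (jetOne hk hα)).congr (coeFn_jet_zero v).symm ae_eq_rfl).bilin B
        (isOpen_inner D) hα fun z hz => hN z (inner_subset_carrier D hz)
    have hint : ∀ (α : {α : ℕ × ℕ // α.1 + α.2 = 1}) (φ : TestFun univ),
        ∫ z, φ.1 z • (B (pderiv α.1 N z) (WSob.jet w k v (jetZero k) z) +
          B (N z) (WSob.jet w k v (jetOne hk α.2) z)) ∂D.vol =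
        ∫ z, φ.1 z • B (pderiv α.1 N z) (WSob.jet w k v (jetZero k) z) ∂D.vol +
            ∫ z, φ.1 z • B (N z) (WSob.jet w k v (jetOne hk α.2) z) ∂D.vol := fun α φ => by
      simp only [smul_add]
      exact integral_add (integrable_smul_test (l1 α.1 α.2) φ.2.1.continuous φ.2.2.1 φ.2.2.2)
        (integrable_smul_test (l2 α.1 α.2) φ.2.1.continuous φ.2.2.1 φ.2.2.2)
    constructor
    · intro h α φ
      obtain ⟨g, hg⟩ := hasZeroTrace_iff.1 h α.1 α.2
      have hg' := hg.congr e0.symm ae_eq_rfl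
      have hu := (hg'.mono (subset_univ _)).unique (hw α.1 α.2)
      have := (hg'.congr ae_eq_rfl hu).2.2 φ.1 φ.2.1 φ.2.2.1 φ.2.2.2
      rw [this, α.2, pow_one, neg_smul, one_smul, hint]
    · intro h
      refine HasZeroTrace.congr ?_ e0
      rw [hasZeroTrace_iff]
      refine fun α hα => ⟨_, l0, (l1 α hα).add (l2 α hα), fun φ h1 h2 h3 => ?_⟩
      have := h ⟨α, hα⟩ ⟨φ, h1, h2, h3⟩
      rw [this, hα, pow_one, neg_smul, one_smul, ← hint ⟨α, hα⟩ ⟨φ, h1, h2, h3⟩]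
      rfl
  rw [hset]
  simp only [ofPred_forall]
  refine isClosed_iInter fun α => isClosed_iInter fun φ => ?_
  have cj : ∀ β, Continuous fun v : WSob w k => WSob.jet w k v β := fun β =>
    (PiLp.continuous_apply 2 _ β).comp (isometry_jet w).continuous
  refine isClosed_eq ?_ (Continuous.neg (Continuous.add ?_ ?_))
  · exact (continuous_integral_bilin B hNc (contDiff_pderiv α.1 φ.2.1).continuous
      (φ.hasCompactSupport_pderiv α.1)).comp (cj (jetZero k))
  · exact (continuous_integral_bilin B (hNd α.1 α.2) φ.2.1.continuous φ.2.2.1).comp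
      (cj (jetZero k))
  · exact (continuous_integral_bilin B hNc φ.2.1.continuous φ.2.2.1).comp (cj (jetOne hk α.2))

end Completeness

/-! ### Closedness of the domain and the target of `∂̄_A`. -/

section ClosedSubspaces

variable (w : Weight D μ) {k : ℕ}

/-- The imaginary part of a vector. -/
def imPart (n : ℕ) : Cn n →L[ℝ] EuclideanSpace ℝ (Fin n) :=
  LinearMap.toContinuousLinearMap
    { toFun := fun x => WithLp.toLp 2 fun j => (x j).im
      map_add' := fun x y => by ext j; simp
      map_smul' := fun c x => by ext j; simp }

/-- `(a, x) ↦ Im (a† x)` as a bilinear map. -/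
def normalMap (n : ℕ) : Op n →L[ℝ] Cn n →L[ℝ] EuclideanSpace ℝ (Fin n) :=
  (ContinuousLinearMap.compL ℝ (Cn n) (Cn n) (EuclideanSpace ℝ (Fin n)) (imPart n)) ∘L
    (opEval n ∘L opStar n)

theorem normalMap_apply (a : Op n) (x : Cn n) : normalMap n a x = imPart n (star a x) := rfl

theorem normalPart_eq (M : Mat n) (x : Cn n) : normalPart M x = imPart n (star (opOf M) x) := by
  rw [← opOf_conjTranspose]
  rfl

theorem contDiffAt_star {a : ℂ → Op n} {z : ℂ} (h : ContDiffAt ℝ ∞ a z) :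
    ContDiffAt ℝ ∞ (fun z => star (a z)) z := contDiffAt_clm (opStar n) h

theorem isClosed_sobolevOne : IsClosed (sobolevOne w : Set (WSob w 1)) := by
  have h := isClosed_setOf_hasZeroTrace (w := w) (k := 1) le_rfl (opEval n) (N := wInv w)
    fun z hz => contDiffAt_wInv w hz
  convert h using 1
  ext v
  have e : (fun z => opEval n (wInv w z) (wOp w z (WSob.val v z))) =ᵐ[D.vol] WSob.val v := by
    filter_upwards [ae_mem_inner D] with z hz
    exact wInv_wOp_apply w (inner_subset_carrier D hz) _
  exact ⟨fun h => HasZeroTrace.congr h e.symm, fun h => HasZeroTrace.congr h e⟩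

theorem mem_sobolevTwo_iff {A : ℂ → Mat n} {T : WSob w 2 →L[ℝ] WSob w 1}
    (hT : ∀ v, IsDbar D (WSob.val v) (WSob.val (T v))) {v : WSob w 2} :
    v ∈ sobolevTwo w A ↔ HasZeroTrace D (fun z => normalPart (A z) (WSob.val v z)) ∧
      T v ∈ sobolevOne w := by
  refine and_congr_right fun _ => ⟨?_, fun h => ⟨⟨T v, h⟩, hT v⟩⟩
  rintro ⟨f, hf⟩
  rw [show T v = f.1 from WSob.val_injective (AEEqFun.ext ((hT v).unique hf))]
  exact f.2

theorem isClosed_sobolevTwo {A : ℂ → Mat n} (hA : ∀ j k, ContDiff ℝ ∞ (fun z => A z j k)) :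
    IsClosed (sobolevTwo w A : Set (WSob w 2)) := by
  obtain ⟨T, hT⟩ := exists_dbarFull w
  -- As `normalMap` takes an adjoint, the coefficient `(w⁻¹)† A` yields `Im (A† w⁻¹ (w v))`.
  have h1 := isClosed_setOf_hasZeroTrace (w := w) (k := 2) one_le_two (normalMap n)
    (N := fun z => star (wInv w z) * opOf (A z)) fun z hz =>
      contDiffAt_bilin (opMul n) (contDiffAt_star (contDiffAt_wInv w hz))
        (contDiff_opOf hA).contDiffAt
  convert h1.inter ((isClosed_sobolevOne w).preimage T.continuous) using 1
  ext v
  refine (mem_sobolevTwo_iff w hT).trans (and_congr_left fun _ => ?_)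
  have e : (fun z => normalMap n (star (wInv w z) * opOf (A z)) (wOp w z (WSob.val v z)))
      =ᵐ[D.vol] fun z => normalPart (A z) (WSob.val v z) := by
    filter_upwards [ae_mem_inner D] with z hz
    rw [normalMap_apply, star_mul, star_star, normalPart_eq, mul_apply_eq_comp,
      wInv_wOp_apply w (inner_subset_carrier D hz)]
  exact ⟨fun h => HasZeroTrace.congr h e.symm, fun h => HasZeroTrace.congr h e⟩

/-- Local integrability on the whole plane means up to the boundary, as the trace lemmas require; it
holds because `w⁻¹` is smooth up to the boundary. -/
theorem WSob.exists_weakDeriv (hk : 1 ≤ k) (v : WSob w k) {α : ℕ × ℕ} (hα : α.1 + α.2 = 1) :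
    ∃ g, LocallyIntegrableOn (WSob.val v) univ D.vol ∧ LocallyIntegrableOn g univ D.vol ∧
      IsWeakDeriv D D.inner α (WSob.val v) g := by
  have c0 : ContinuousOn (wInv w) D.carrier := fun z hz =>
    (contDiffAt_wInv w hz).continuousAt.continuousWithinAt
  have c1 : ContinuousOn (pderiv α (wInv w)) D.carrier := fun z hz =>
    (contDiffAt_pderiv hα (contDiffAt_wInv w hz)).continuousAt.continuousWithinAt
  have u0 := Lp.memLp (WSob.jet w k v (jetZero k))
  have u1 := Lp.memLp (WSob.jet w k v (jetOne hk hα))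
  have e := coeFn_jet_zero v
  refine ⟨_, ?_, (locallyIntegrableOn_bilin (opEval n) c1 u0).add
    (locallyIntegrableOn_bilin (opEval n) c0 u1), isWeakDeriv_val w hα e.symm
      ((isWeakDeriv_jet v (jetOne hk hα)).congr e.symm ae_eq_rfl)⟩
  have ev : (fun z => opEval n (wInv w z) (WSob.jet w k v (jetZero k) z)) =ᵐ[D.vol]
      WSob.val v := by
    filter_upwards [e, ae_mem_inner D] with z h1 h2
    rw [h1]
    exact wInv_wOp_apply w (inner_subset_carrier D h2) _
  intro x hx
  obtain ⟨T, hT, hi⟩ := locallyIntegrableOn_bilin (opEval n) c0 u0 x hx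
  exact ⟨T, hT, hi.congr_fun_ae (ae_restrict_of_ae ev)⟩

end ClosedSubspaces

/-! ### First order inversion of unitary boundary values -/

section Correction

/-- A polynomial in `a` and `a†` which agrees with `a⁻¹` to first order where `a` is unitary. -/
def unitaryInv (a : Op n) : Op n := (star a + star a) - star a * a * star a

theorem unitaryInv_of_unitary {a : Op n} (h : star a * a = 1) : unitaryInv a = star a := by
  rw [unitaryInv, h, one_mul, add_sub_cancel_right]

/-- The defect is a square, so it vanishes to second order where `a` is unitary. -/
theorem unitaryInv_mul (a : Op n) :
    unitaryInv a * a = 1 - (1 - star a * a) * (1 - star a * a) := by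
  rw [unitaryInv]; noncomm_ring

theorem contDiff_star {a : ℂ → Op n} (h : ContDiff ℝ ∞ a) : ContDiff ℝ ∞ (fun z => star (a z)) :=
  (opStar n).contDiff.comp h

theorem contDiff_op_mul {a b : ℂ → Op n} (ha : ContDiff ℝ ∞ a) (hb : ContDiff ℝ ∞ b) :
    ContDiff ℝ ∞ (fun z => a z * b z) :=
  ((opMul n).contDiff.comp ha).clm_apply hb

theorem contDiff_unitaryInv {a : ℂ → Op n} (h : ContDiff ℝ ∞ a) :
    ContDiff ℝ ∞ (fun z => unitaryInv (a z)) :=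
  ((contDiff_star h).add (contDiff_star h)).sub
    (contDiff_op_mul (contDiff_op_mul (contDiff_star h) h) (contDiff_star h))

theorem contDiff_opDbar {a : ℂ → Op n} (h : ContDiff ℝ ∞ a) : ContDiff ℝ ∞ (opDbar a) :=
  (contDiff_pderiv _ h).add (contDiff_op_mul contDiff_const (contDiff_pderiv _ h))

theorem pderiv_op_mul {α : ℕ × ℕ} (hα : α.1 + α.2 = 1) {a b : ℂ → Op n}
    (ha : ContDiff ℝ ∞ a) (hb : ContDiff ℝ ∞ b) (z : ℂ) :
    pderiv α (fun z => a z * b z) z = pderiv α a z * b z + a z * pderiv α b z :=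
  pderiv_bilin_apply (opMul n) hα ha.contDiffAt.differentiableAt_of_top
    hb.contDiffAt.differentiableAt_of_top

/-- There is no correction term because the values of `a` are complex linear and commute with `i`.
-/
theorem opDbar_mul {a b : ℂ → Op n} (ha : ContDiff ℝ ∞ a) (hb : ContDiff ℝ ∞ b) (z : ℂ) :
    opDbar (fun z => a z * b z) z = opDbar a z * b z + a z * opDbar b z := by
  simp only [opDbar, pderiv_op_mul (α := (1, 0)) rfl ha hb, pderiv_op_mul (α := (0, 1)) rfl ha hb]
  rw [mul_add, mul_add, add_mul, ← mul_assoc (opI n) (a z), opI_comm (a z)]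
  noncomm_ring

/-- Write `u(a) a = 1 - q²` with `q = 1 - a† a`. As `q z = 0`, the first derivatives of the right
side vanish at `z`. Since `∂̄a = 0` at `z`, Leibniz leaves `∂̄(u(a)) a = 0`, and `a` is cancelled by
`a†`. -/
theorem opDbar_unitaryInv {a : ℂ → Op n} (ha : ContDiff ℝ ∞ a) {z : ℂ}
    (h1 : star (a z) * a z = 1) (h2 : a z * star (a z) = 1) (hd : opDbar a z = 0) :
    opDbar (fun z => unitaryInv (a z)) z = 0 := by
  set q : ℂ → Op n := fun z => 1 - star (a z) * a z with hq
  have hqs : ContDiff ℝ ∞ q := contDiff_const.sub (contDiff_op_mul (contDiff_star ha) ha)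
  have hqz : q z = 0 := by rw [hq]; simp [h1]
  have hprod : (fun z => unitaryInv (a z) * a z) = fun z => 1 - q z * q z :=
    funext fun z => unitaryInv_mul (a z)
  have hp : ∀ α : ℕ × ℕ, α.1 + α.2 = 1 → pderiv α (fun z => unitaryInv (a z) * a z) z = 0 := by
    intro α hα
    have e := pderiv_op_mul hα hqs hqs z
    rw [hqz, mul_zero, zero_mul, add_zero] at e
    rw [hprod, pderiv_eq_dirDeriv hα] at *
    rw [dirDeriv, fderiv_const_sub] at *
    simp only [neg_apply]
    rw [e, neg_zero]
  have e := opDbar_mul (contDiff_unitaryInv ha) ha z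
  rw [hd, mul_zero, add_zero, opDbar, hp _ rfl, hp _ rfl, mul_zero, add_zero] at e
  calc opDbar (fun z => unitaryInv (a z)) z
      = opDbar (fun z => unitaryInv (a z)) z * a z * star (a z) := by rw [mul_assoc, h2, mul_one]
    _ = 0 := by rw [← e, zero_mul]

end Correction

/-! ### Changing the boundary condition -/

section BoundaryChange

/-- A family of operators that is smooth, unitary on the boundary and `∂̄`-holomorphic there. -/
structure IsBoundaryFrame (D : StandardDomain) {n : ℕ} (A : ℂ → Mat n) : Prop where
  smooth : ∀ j k, ContDiff ℝ ∞ (fun z => A z j k)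
  unitary : ∀ z ∈ frontier D.carrier, A z ∈ Matrix.unitaryGroup (Fin n) ℂ
  opDbar_eq_zero : ∀ z ∈ frontier D.carrier, opDbar (fun z => opOf (A z)) z = 0

variable {A A' : ℂ → Mat n}

theorem IsBoundaryFrame.star_mul (h : IsBoundaryFrame D A) {z : ℂ} (hz : z ∈ frontier D.carrier) :
    star (opOf (A z)) * opOf (A z) = 1 := by
  rw [← opOf_conjTranspose, ← opOf_mul, ← opOf_one]
  exact congrArg opOf (Matrix.mem_unitaryGroup_iff'.1 (h.unitary z hz))

theorem IsBoundaryFrame.mul_star (h : IsBoundaryFrame D A) {z : ℂ} (hz : z ∈ frontier D.carrier) :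
    opOf (A z) * star (opOf (A z)) = 1 := by
  rw [← opOf_conjTranspose, ← opOf_mul, ← opOf_one]
  exact congrArg opOf (Matrix.mem_unitaryGroup_iff.1 (h.unitary z hz))

theorem IsBoundaryFrame.contDiff (h : IsBoundaryFrame D A) :
    ContDiff ℝ ∞ fun z => opOf (A z) := contDiff_opOf h.smooth

/-- `1 + changeOp A A'` takes the boundary condition `A` to the boundary condition `A'`. -/
def changeOp (A A' : ℂ → Mat n) (z : ℂ) : Op n :=
  opOf ((A' - A) z) * unitaryInv (opOf (A z))

theorem contDiff_changeOp (h : IsBoundaryFrame D A) (h' : IsBoundaryFrame D A') :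
    ContDiff ℝ ∞ (changeOp A A') := by
  have : changeOp A A' = fun z => (opOf (A' z) - opOf (A z)) * unitaryInv (opOf (A z)) := by
    funext z; rw [changeOp, Pi.sub_apply, opOf_sub]
  rw [this]
  exact contDiff_op_mul (h'.contDiff.sub h.contDiff) (contDiff_unitaryInv h.contDiff)

theorem opDbar_changeOp (h : IsBoundaryFrame D A) (h' : IsBoundaryFrame D A') {z : ℂ}
    (hz : z ∈ frontier D.carrier) : opDbar (changeOp A A') z = 0 := by
  have e : changeOp A A' = fun z => (opOf (A' z) - opOf (A z)) * unitaryInv (opOf (A z)) := by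
    funext z; rw [changeOp, Pi.sub_apply, opOf_sub]
  have hsub : opDbar (fun z => opOf (A' z) - opOf (A z)) z = 0 := by
    have hp : ∀ α : ℕ × ℕ, α.1 + α.2 = 1 → pderiv α (fun z => opOf (A' z) - opOf (A z)) z =
        pderiv α (fun z => opOf (A' z)) z - pderiv α (fun z => opOf (A z)) z := by
      intro α hα
      simp only [pderiv_eq_dirDeriv hα, dirDeriv]
      rw [fderiv_fun_sub h'.contDiff.contDiffAt.differentiableAt_of_top
        h.contDiff.contDiffAt.differentiableAt_of_top]
      rfl
    have e1 := h.opDbar_eq_zero z hz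
    have e2 := h'.opDbar_eq_zero z hz
    rw [opDbar] at e1 e2 ⊢
    rw [hp _ rfl, hp _ rfl, mul_sub, ← sub_eq_zero_of_eq (e2.trans e1.symm)]
    abel
  rw [e, opDbar_mul (h'.contDiff.sub h.contDiff) (contDiff_unitaryInv h.contDiff), hsub,
    opDbar_unitaryInv h.contDiff (h.star_mul hz) (h.mul_star hz) (h.opDbar_eq_zero z hz),
    zero_mul, mul_zero, add_zero]

/-- On the boundary `1 + changeOp A A'` is `A' A†`. -/
theorem star_mul_one_add_changeOp (h : IsBoundaryFrame D A) (h' : IsBoundaryFrame D A') {z : ℂ}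
    (hz : z ∈ frontier D.carrier) :
    star (opOf (A' z)) * (1 + changeOp A A' z) = star (opOf (A z)) := by
  rw [changeOp, unitaryInv_of_unitary (h.star_mul hz), Pi.sub_apply, opOf_sub, sub_mul,
    h.mul_star hz, add_sub_cancel, ← mul_assoc, h'.star_mul hz, one_mul]

theorem isDbar_add_mul {a : ℂ → Op n} (ha : ContDiff ℝ ∞ a)
    {v f : ℂ → Cn n} (h : IsDbar D v f) :
    IsDbar D (fun z => v z + a z (v z)) (fun z => f z + (opDbar a z (v z) + a z (f z))) := by
  obtain ⟨g₁, g₂, h1, h2, e⟩ := h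
  refine ⟨_, _, h1.add (h1.bilin (opEval n) (isOpen_inner D) rfl fun z _ => ha.contDiffAt),
    h2.add (h2.bilin (opEval n) (isOpen_inner D) rfl fun z _ => ha.contDiffAt), ?_⟩
  filter_upwards [e] with z hz
  simp only [hz, opEval_apply, opDbar, add_apply, mul_apply_eq_comp, opI_apply, map_add, map_smul,
    smul_add]
  abel

/-- With `E` the multiplication by `changeOp A A'`, the difference `A'† (1 + E) - A†` is smooth and
vanishes on the boundary, so the normal part of `v + E v` has zero trace like that of `v`. In `∂̄(v
+ E v) = ∂̄v + (∂̄E) v + E ∂̄v` the outer terms inherit zero trace from `∂̄v`, and the middle one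
has it since `∂̄E = 0` on the boundary. -/
theorem change_mem_sobolevTwo (w : Weight D μ) (h : IsBoundaryFrame D A)
    (h' : IsBoundaryFrame D A') {E : WSob w 2 →L[ℝ] WSob w 2}
    (hE : ∀ v, WSob.val (E v) =ᵐ[D.vol] fun z => changeOp A A' z (WSob.val v z))
    {v : WSob w 2} (hv : v ∈ sobolevTwo w A) : v + E v ∈ sobolevTwo w A' := by
  obtain ⟨T, hT⟩ := exists_dbarFull w
  rw [mem_sobolevTwo_iff w hT] at hv ⊢
  have hs := contDiff_changeOp h h'
  have hval : WSob.val (v + E v) =ᵐ[D.vol]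
      fun z => WSob.val v z + changeOp A A' z (WSob.val v z) := by
    rw [map_add]
    filter_upwards [AEEqFun.coeFn_add (WSob.val v) (WSob.val (E v)), hE v] with z h1 h2
    rw [h1, Pi.add_apply, h2]
  have hreg : ∀ α : ℕ × ℕ, α.1 + α.2 = 1 → ∃ f', LocallyIntegrableOn (WSob.val v) univ D.vol ∧
      LocallyIntegrableOn f' univ D.vol ∧ IsWeakDeriv D D.inner α (WSob.val v) f' :=
    fun α hα => v.exists_weakDeriv w one_le_two hα
  constructor
  · have key : HasZeroTrace D (fun z => opEval n
        (star (opOf (A' z)) * (1 + changeOp A A' z) - star (opOf (A z))) (WSob.val v z)) :=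
      hasZeroTrace_bilin_of_eq_zero_on_frontier (opEval n)
        ((contDiff_op_mul (contDiff_star h'.contDiff) (contDiff_const.add hs)).sub
          (contDiff_star h.contDiff))
        (fun z hz => sub_eq_zero.2 (star_mul_one_add_changeOp h h' hz)) hreg
    have key2 : HasZeroTrace D (fun z => imPart n (opEval n
        (star (opOf (A' z)) * (1 + changeOp A A' z) - star (opOf (A z))) (WSob.val v z))) := by
      rw [hasZeroTrace_iff] at key ⊢
      intro α hα
      obtain ⟨g, hg⟩ := key α hα
      exact ⟨_, hg.clm (imPart n)⟩
    refine (hv.1.add key2).congr ?_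
    filter_upwards [hval] with z hz
    rw [hz, normalPart_eq, normalPart_eq, ← map_add, opEval_apply, sub_apply, mul_apply_eq_comp]
    simp [map_add]
  · have hd := isDbar_add_mul hs (hT v)
    have e := (hT (v + E v)).unique (hd.congr hval.symm ae_eq_rfl)
    have z1 : HasZeroTrace D (WSob.val (T v)) := hv.2
    have z2 : HasZeroTrace D (fun z => opEval n (changeOp A A' z) (WSob.val (T v) z)) :=
      z1.bilin (opEval n) hs
    have z3 : HasZeroTrace D (fun z => opEval n (opDbar (changeOp A A') z) (WSob.val v z)) :=
      hasZeroTrace_bilin_of_eq_zero_on_frontier (opEval n) (contDiff_opDbar hs)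
        (fun z hz => opDbar_changeOp h h' hz) hreg
    exact (z1.add (z3.add z2)).congr e.symm

end BoundaryChange

/-! ### From `cNorm` of matrices to `C^k`-bounds of operators. -/

section CNorm

variable {G : Type*} [NormedAddCommGroup G] [NormedSpace ℝ G] {X : Set ℂ} {k : ℕ}

theorem dirDeriv_iterate_comm {e e' : ℂ} (d : ℕ) {φ : ℂ → G} (h : ContDiff ℝ ∞ φ) :
    (dirDeriv e)^[d] (dirDeriv e' φ) = dirDeriv e' ((dirDeriv e)^[d] φ) := by
  induction d with
  | zero => rfl
  | succ d ih =>
    rw [Function.iterate_succ_apply', Function.iterate_succ_apply', ih,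
      dirDeriv_comm (contDiff_iterate _ _ h)]

/-- Here the first order derivative is innermost, as in the recursion of `CBound`; in
`pderiv_pderiv` it is outermost. -/
theorem pderiv_pderiv_inner {α : ℕ × ℕ} (β : ℕ × ℕ) (hα : α.1 + α.2 = 1) {φ : ℂ → G}
    (h : ContDiff ℝ ∞ φ) : pderiv β (pderiv α φ) = pderiv (β + α) φ := by
  obtain ⟨c, d⟩ := β
  rw [← pderiv_pderiv hα h, pderiv_eq_dirDeriv hα, pderiv_eq_dirDeriv hα]
  simp only [pderiv]
  rw [dirDeriv_iterate_comm d h, dirDeriv_iterate_comm c (contDiff_iterate _ _ h)]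

theorem CBound.of_pderiv {C : ℝ≥0} {f : ℂ → G} (hf : ContDiff ℝ ∞ f)
    (h : ∀ β : ℕ × ℕ, β.1 + β.2 ≤ k → ∀ z ∈ X, ‖pderiv β f z‖ ≤ C) : CBound X k f C := by
  induction k generalizing f with
  | zero => exact fun z hz => ⟨hf.contDiffAt, h (0, 0) le_rfl z hz⟩
  | succ k ih =>
    refine ⟨fun z hz => ⟨hf.contDiffAt, h (0, 0) (Nat.zero_le _) z hz⟩, fun α hα => ?_⟩
    refine ih (contDiff_pderiv α hf) fun β hβ z hz => ?_
    rw [pderiv_pderiv_inner β hα hf]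
    exact h _ (by simp only [Prod.fst_add, Prod.snd_add]; omega) z hz

theorem CBound.sum {ι : Type*} (s : Finset ι) {C : ι → ℝ≥0} {a : ι → ℂ → G}
    (h : ∀ i ∈ s, CBound X k (a i) (C i)) :
    CBound X k (fun z => ∑ i ∈ s, a i z) (∑ i ∈ s, C i) := by
  classical
  induction s using Finset.induction_on with
  | empty => simpa using CBound.const (X := X) (k := k) (0 : G)
  | insert i s hi ih =>
    simp only [Finset.sum_insert hi]
    exact (h i (Finset.mem_insert_self i s)).add
      (ih fun j hj => h j (Finset.mem_insert_of_mem hj))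

/-- A `C^k`-bound on a matrix valued function bounds the corresponding operator valued function. -/
theorem exists_opOf_bound (n k : ℕ) (X : Set ℂ) : ∃ K : ℝ≥0, ∀ A : ℂ → Mat n,
    (∀ i j, ContDiff ℝ ∞ fun z => A z i j) → ∀ c : ℝ≥0, cNorm k X A ≤ c →
      CBound X k (fun z => opOf (A z)) (K * c) := by
  refine ⟨∑ i : Fin n, ∑ j : Fin n, ‖opUnit i j‖₊, fun A hA c hc => ?_⟩
  have hentry : ∀ i j, CBound X k (fun z => A z i j) c := fun i j => by
    refine CBound.of_pderiv (hA i j) fun β hβ z hz => ?_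
    have h1 : ‖pderiv β (fun x => A x i j) z‖ₑ ≤ cNorm k X A := by
      refine le_trans ?_ (Finset.single_le_sum (f := fun α => ⨆ z ∈ X, ⨆ (i : Fin n) (j : Fin n),
        ‖pderiv α (fun x => A x i j) z‖ₑ) (fun _ _ => bot_le) (mem_multiIndices.2 hβ))
      exact le_iSup₂_of_le z hz (le_iSup₂_of_le i j le_rfl)
    exact_mod_cast (ENNReal.coe_le_coe.1 (h1.trans hc) : ‖pderiv β (fun x => A x i j) z‖₊ ≤ c)
  have h := CBound.sum Finset.univ fun i _ => CBound.sum Finset.univ fun j _ =>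
    (hentry i j).clm (opUnit i j)
  have e : (fun z => opOf (A z)) = fun z => ∑ i, ∑ j, opUnit i j (A z i j) :=
    funext fun z => opOf_eq_sum (A z)
  rw [e]
  simpa only [Finset.sum_mul] using h

/-- A polynomial in `a` and `a†` is controlled by a bound on `a` alone, with no bound on its
inverse. -/
theorem exists_unitaryInv_bound (n k : ℕ) (C : ℝ≥0) (X : Set ℂ) : ∃ K : ℝ≥0, ∀ a : ℂ → Op n,
    CBound X k a C → CBound X k (fun z => unitaryInv (a z)) K := by
  set σ : ℝ≥0 := ‖opStar n‖₊ * C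
  refine ⟨σ + σ + ‖-ContinuousLinearMap.id ℝ (Op n)‖₊ *
    (2 ^ k * (‖opMul n‖₊ * (2 ^ k * (‖opMul n‖₊ * σ * C)) * σ)), fun a ha => ?_⟩
  have hs := ha.clm (opStar n)
  have h1 := (hs.bilin (opMul n) ha).bilin (opMul n) hs
  have h2 := (hs.add hs).add (h1.clm (-ContinuousLinearMap.id ℝ (Op n)))
  refine h2.congr fun z _ => Eventually.of_forall fun x => ?_
  simp only [unitaryInv, opStar_apply, opMul_apply, neg_apply, ContinuousLinearMap.id_apply]
  exact (sub_eq_add_neg _ _).symm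

theorem contDiff_sub_entries {A B : ℂ → Mat n} (hA : ∀ i j, ContDiff ℝ ∞ fun z => A z i j)
    (hB : ∀ i j, ContDiff ℝ ∞ fun z => B z i j) :
    ∀ i j, ContDiff ℝ ∞ fun z => (A - B) z i j := fun i j => (hA i j).sub (hB i j)

theorem pderiv_sub_apply {f g : ℂ → G} (hf : ContDiff ℝ ∞ f) (hg : ContDiff ℝ ∞ g) (α : ℕ × ℕ) :
    pderiv α (fun z => f z - g z) = fun z => pderiv α f z - pderiv α g z := by
  have one : ∀ (e : ℂ) (f g : ℂ → G), ContDiff ℝ ∞ f → ContDiff ℝ ∞ g →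
      dirDeriv e (fun z => f z - g z) = fun z => dirDeriv e f z - dirDeriv e g z := by
    intro e f g hf hg
    funext z
    simp only [dirDeriv]
    rw [fderiv_fun_sub hf.contDiffAt.differentiableAt_of_top hg.contDiffAt.differentiableAt_of_top]
    rfl
  have iter : ∀ (e : ℂ) (m : ℕ) (f g : ℂ → G), ContDiff ℝ ∞ f → ContDiff ℝ ∞ g →
      (dirDeriv e)^[m] (fun z => f z - g z) =
        fun z => (dirDeriv e)^[m] f z - (dirDeriv e)^[m] g z := by
    intro e m
    induction m with
    | zero => intros; rfl
    | succ m ih =>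
      intro f g hf hg
      rw [Function.iterate_succ_apply, one e f g hf hg,
        ih _ _ (contDiff_dirDeriv e hf) (contDiff_dirDeriv e hg)]
      rfl
  rw [pderiv, iter _ _ _ _ hf hg, iter _ _ _ _ (contDiff_iterate _ _ hf) (contDiff_iterate _ _ hg)]
  rfl

theorem cNorm_sub_comm {A B : ℂ → Mat n} (hA : ∀ i j, ContDiff ℝ ∞ fun z => A z i j)
    (hB : ∀ i j, ContDiff ℝ ∞ fun z => B z i j) : cNorm k X (A - B) = cNorm k X (B - A) := by
  have e : ∀ (α : ℕ × ℕ) i j z, ‖pderiv α (fun x => (A - B) x i j) z‖ₑ =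
      ‖pderiv α (fun x => (B - A) x i j) z‖ₑ := fun α i j z => by
    have e1 : pderiv α (fun x => (A - B) x i j) = _ := pderiv_sub_apply (hA i j) (hB i j) α
    have e2 : pderiv α (fun x => (B - A) x i j) = _ := pderiv_sub_apply (hB i j) (hA i j) α
    rw [e1, e2]
    exact enorm_sub_rev _ _
  simp only [cNorm, e]

theorem cNorm_le_add {A B : ℂ → Mat n} (hA : ∀ i j, ContDiff ℝ ∞ fun z => A z i j)
    (hB : ∀ i j, ContDiff ℝ ∞ fun z => B z i j) :
    cNorm k X A ≤ cNorm k X (A - B) + cNorm k X B := by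
  simp only [cNorm]
  rw [← Finset.sum_add_distrib]
  refine Finset.sum_le_sum fun α _ => ?_
  refine iSup₂_le fun z hz => iSup₂_le fun i j => ?_
  have e1 : pderiv α (fun x => (A - B) x i j) = _ := pderiv_sub_apply (hA i j) (hB i j) α
  have e : pderiv α (fun x => A x i j) z =
      pderiv α (fun x => (A - B) x i j) z + pderiv α (fun x => B x i j) z := by rw [e1]; simp
  rw [e]
  refine (enorm_add_le _ _).trans (add_le_add ?_ ?_)
  · exact le_iSup₂_of_le z hz (le_iSup₂_of_le (f := fun (i : Fin n) (j : Fin n) =>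
      ‖pderiv α (fun x => (A - B) x i j) z‖ₑ) i j le_rfl)
  · exact le_iSup₂_of_le z hz (le_iSup₂_of_le (f := fun (i : Fin n) (j : Fin n) =>
      ‖pderiv α (fun x => B x i j) z‖ₑ) i j le_rfl)

end CNorm

/-! ### Commutation with the weight and the norm of `changeOp`. -/

section Splitting

variable (w : Weight D μ)

theorem opDiag_comm {M : Mat n} {d : Fin n → ℂ} (h : ∀ j k, d j ≠ d k → M j k = 0) :
    Commute (opDiag n d) (opOf M) := by
  rw [Commute, SemiconjBy, opDiag_apply, ← opOf_mul, ← opOf_mul]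
  congr 1
  ext j k
  rw [Matrix.diagonal_mul, Matrix.mul_diagonal]
  by_cases hd : d j = d k
  · rw [hd, mul_comm]
  · rw [h j k hd, zero_mul, mul_zero]

theorem star_opDiag_ofReal (d : Fin n → ℝ) :
    star (opDiag n fun j => (d j : ℂ)) = opDiag n fun j => (d j : ℂ) := by
  rw [opDiag_apply, ← opOf_conjTranspose, Matrix.diagonal_conjTranspose]
  congr 2
  funext j
  simp

/-- Beyond a suitable point of the ends, the weight commutes with the operators which do not mix
directions of different weights, and with their adjoints. -/
theorem exists_wOp_commute (R₀ : ℝ) : ∃ R, ∀ (M : ℂ → Mat n),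
    (∀ i, ∀ z ∈ D.endPart i R₀, ∀ j k, μ i j ≠ μ i k → M z j k = 0) →
      ∀ i, ∀ z ∈ D.endPart i R, Commute (wOp w z) (opOf (M z)) ∧
        Commute (wOp w z) (star (opOf (M z))) := by
  obtain ⟨R, hR, c, h⟩ := exists_wOp_eq_opDiag w R₀
  refine ⟨R, fun M hM i z hz => ?_⟩
  have hc : Commute (wOp w z) (opOf (M z)) := by
    rw [h i z hz]
    refine opDiag_comm fun j k hd => hM i z (endPart_anti D i hR hz) j k fun e => hd ?_
    rw [e]
  refine ⟨hc, ?_⟩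
  have hs := hc.star_star
  have e : star (wOp w z) = wOp w z := by rw [h i z hz, star_opDiag_ofReal]
  rwa [e] at hs

/-- Multiplication by `B * unitaryInv A` is bounded on `H_{2,μ}` by the `C²`-norm of `B`. -/
theorem exists_changeOp_bound (R₀ : ℝ) (c₀ : ℝ≥0) : ∃ K : ℝ≥0, ∀ A B : ℂ → Mat n,
    (∀ i j, ContDiff ℝ ∞ fun z => A z i j) → (∀ i j, ContDiff ℝ ∞ fun z => B z i j) →
    (∀ i, ∀ z ∈ D.endPart i R₀, ∀ j k, μ i j ≠ μ i k → A z j k = 0) →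
    (∀ i, ∀ z ∈ D.endPart i R₀, ∀ j k, μ i j ≠ μ i k → B z j k = 0) →
    cNorm 2 D.carrier A ≤ c₀ → ∀ c : ℝ≥0, cNorm 2 D.carrier B ≤ c →
      ∃ T : WSob w 2 →L[ℝ] WSob w 2,
        (∀ v, WSob.val (T v) =ᵐ[D.vol]
          fun z => (opOf (B z) * unitaryInv (opOf (A z))) (WSob.val v z)) ∧ ‖T‖ ≤ K * c := by
  obtain ⟨R, hR⟩ := exists_wOp_commute w R₀
  obtain ⟨K₁, h1⟩ := exists_opOf_bound n 2 D.carrier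
  obtain ⟨K₂, h2⟩ := exists_unitaryInv_bound n 2 (K₁ * c₀) D.carrier
  obtain ⟨K₃, h3⟩ := exists_conj_bound w 2 R
  obtain ⟨K₄, h4⟩ := exists_mulOp w 2
  refine ⟨K₄ * (K₃ * (2 ^ 2 * (‖opMul n‖₊ * K₁ * K₂))), fun A B hA hB sA sB cA c cB => ?_⟩
  have b := CBound.bilin (opMul n) (h1 B hB c cB) (h2 _ (h1 A hA c₀ cA))
  -- The weight commutes with `A`, `A†` and `B` on the ends, hence with the polynomial formed from
  -- them.
  have hcomm : ∀ i, ∀ z ∈ D.endPart i R, wOp w z * (opOf (B z) * unitaryInv (opOf (A z))) =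
      opOf (B z) * unitaryInv (opOf (A z)) * wOp w z := fun i z hz => by
    have a1 := hR A sA i z hz
    have b1 := (hR B sB i z hz).1
    exact b1.mul_right ((a1.2.add_right a1.2).sub_right ((a1.2.mul_right a1.1).mul_right a1.2))
  obtain ⟨T, hT, hn⟩ := h4 _ _ (h3 _ _ hcomm b)
  refine ⟨T, hT, hn.trans (le_of_eq ?_)⟩
  push_cast
  ring

end Splitting

/-! ### Boundary frames and kernels of the family. -/

section Family

variable {w : Weight D μ}

theorem pderiv_opOf {A : ℂ → Mat n} (hA : ∀ j k, ContDiff ℝ ∞ fun z => A z j k) {α : ℕ × ℕ}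
    (hα : α.1 + α.2 = 1) (z : ℂ) :
    pderiv α (fun z => opOf (A z)) z =
      opOf (Matrix.of fun j k => pderiv α (fun x => A x j k) z) := by
  have e : (fun z => opOf (A z)) = fun z => ∑ i, ∑ j, opUnit i j (A z i j) :=
    funext fun z => opOf_eq_sum (A z)
  have hd : ∀ i j, DifferentiableAt ℝ (fun z => opUnit i j (A z i j)) z := fun i j =>
    (contDiffAt_clm (opUnit i j) (hA i j).contDiffAt).differentiableAt_of_top
  rw [e, pderiv_eq_dirDeriv hα, dirDeriv,
    fderiv_fun_sum fun i _ => DifferentiableAt.fun_sum fun j _ => hd i j, opOf_eq_sum]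
  simp only [sum_apply]
  refine Finset.sum_congr rfl fun i _ => ?_
  rw [fderiv_fun_sum fun j _ => hd i j, sum_apply]
  refine Finset.sum_congr rfl fun j _ => ?_
  have := pderiv_clm_apply (opUnit i j) hα (hA i j).contDiffAt.differentiableAt_of_top (z := z)
  rw [pderiv_eq_dirDeriv hα] at this
  exact this

theorem IsC2Admissible.isBoundaryFrame {A : ℝ → ℂ → Mat n} (hA : IsC2Admissible w A) {l : ℝ}
    (hl : l ∈ Icc (0 : ℝ) 1) : IsBoundaryFrame D (A l) where
  smooth := hA.smooth l hl
  unitary := hA.unitary l hl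
  opDbar_eq_zero z hz := by
    rw [opDbar, pderiv_opOf (hA.smooth l hl) rfl, pderiv_opOf (hA.smooth l hl) rfl]
    have : opI n = opOf (Matrix.diagonal fun _ => Complex.I) := by
      ext x j
      simp [opI_apply, opOf_apply, act, Matrix.toLpLin_apply]
    rw [this, ← opOf_mul, ← opOf_add, show (0 : Op n) = opOf 0 from
      (map_zero (Matrix.toEuclideanCLM (𝕜 := ℂ) (n := Fin n))).symm]
    congr 1
    ext i j
    simpa using hA.dbar_eq_zero l hl z hz i j

theorem coe_dbar {A : ℂ → Mat n} {T : WSob w 2 →L[ℝ] WSob w 1}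
    (hT : ∀ v, IsDbar D (WSob.val v) (WSob.val (T v))) (u : sobolevTwo w A) :
    ((dbar w A u).1 : WSob w 1) = T u.1 :=
  WSob.val_injective (AEEqFun.ext ((dbar_spec w A u).unique (hT u.1)))

/-- Kernels of operators with different domains become intersections of those domains with the
kernel of one operator `T`, as `exists_kernel_equiv` needs. -/
theorem mem_kernel_iff {A : ℂ → Mat n} {T : WSob w 2 →L[ℝ] WSob w 1}
    (hT : ∀ v, IsDbar D (WSob.val v) (WSob.val (T v))) {v : WSob w 2} :
    v ∈ kernel w A ↔ v ∈ sobolevTwo w A ∧ T v = 0 := by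
  constructor
  · rintro ⟨u, hu, rfl⟩
    refine ⟨u.2, ?_⟩
    have h0 : dbar w A u = 0 := hu
    change T u.1 = 0
    rw [← coe_dbar hT, h0]
    rfl
  · rintro ⟨h1, h2⟩
    refine ⟨⟨v, h1⟩, ?_, rfl⟩
    change dbar w A ⟨v, h1⟩ = 0
    exact Subtype.ext ((coe_dbar hT ⟨v, h1⟩).trans h2)

end Family

/-! ### Perturbation of kernels in Banach spaces. -/

section Perturbation

variable {X Y : Type*} [NormedAddCommGroup X] [NormedSpace ℝ X]
  [NormedAddCommGroup Y] [NormedSpace ℝ Y]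

/-- A surjective bounded operator between Banach spaces whose kernel is complemented has a bounded
right inverse. -/
theorem exists_rightInverse [CompleteSpace X] [CompleteSpace Y] (T : X →L[ℝ] Y)
    (hT : Function.Surjective T) (hk : T.ker.ClosedComplemented) :
    ∃ R : Y →L[ℝ] X, ∀ y, T (R y) = y := by
  obtain ⟨P, hP⟩ := hk
  have hker : IsClosed (T.ker : Set X) := T.isClosed_ker
  have : CompleteSpace T.ker := hker.completeSpace_coe
  have hPs : P.range = ⊤ := LinearMap.range_eq_top.2 fun x => ⟨x, hP x⟩
  have hc : IsCompl T.ker P.ker := LinearMap.isCompl_of_proj hP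
  let e := T.equivProdOfSurjectiveOfIsCompl P (LinearMap.range_eq_top.2 hT) hPs hc
  refine ⟨e.symm.toContinuousLinearMap ∘L ContinuousLinearMap.inl ℝ Y T.ker, fun y => ?_⟩
  have : e (e.symm (y, 0)) = (y, 0) := e.apply_symm_apply _
  exact congrArg Prod.fst this

theorem isUnit_one_add [CompleteSpace X] {H : X →L[ℝ] X} (h : ‖H‖ < 1) : IsUnit (1 + H) := by
  have := isUnit_one_sub_of_norm_lt_one (x := -H) (by rwa [norm_neg])
  rwa [sub_neg_eq_add] at this

/-- A Neumann series argument inside a closed subspace. -/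
theorem exists_add_eq_of_mapsTo {Z : Submodule ℝ X} [CompleteSpace Z] {H : X →L[ℝ] X}
    (hH : ∀ z ∈ Z, H z ∈ Z) (hn : ‖H‖ < 1) {z : X} (hz : z ∈ Z) : ∃ y ∈ Z, y + H y = z := by
  let H' : Z →L[ℝ] Z := (H ∘L Z.subtypeL).codRestrict Z fun y => hH y y.2
  have hn' : ‖H'‖ < 1 := by
    refine lt_of_le_of_lt (H'.opNorm_le_bound (norm_nonneg H) fun y => ?_) hn
    exact H.le_opNorm y
  obtain ⟨u, hu⟩ := isUnit_one_add hn'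
  refine ⟨(u⁻¹ : (Z →L[ℝ] Z)ˣ).1 ⟨z, hz⟩, Subtype.coe_prop _, ?_⟩
  have h1 : (u * u⁻¹ : (Z →L[ℝ] Z)ˣ).1 ⟨z, hz⟩ = ⟨z, hz⟩ := by rw [mul_inv_cancel]; rfl
  rw [Units.val_mul, hu] at h1
  exact congrArg Subtype.val h1

/-- Perturbation of the kernel of a surjective operator under small changes of its domain. The
domain `X₀` is carried to the domain `Z l` by `1 + E l`, and back by `1 + F l`. -/
theorem exists_kernel_equiv [CompleteSpace X] {Λ : Type*} [TopologicalSpace Λ] (D : X →L[ℝ] Y)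
    {Y₀ : Submodule ℝ Y} {X₀ : Submodule ℝ X} {Z : Λ → Submodule ℝ X} [CompleteSpace X₀]
    [∀ l, CompleteSpace (Z l)] (hX : ∀ x ∈ X₀, D x ∈ Y₀) (hZ : ∀ l, ∀ x ∈ Z l, D x ∈ Y₀)
    (R : Y₀ →L[ℝ] X₀) (hR : ∀ y, D (R y) = y) (E F : Λ → X →L[ℝ] X) (hEc : Continuous E)
    (hE : ∀ l, ∀ x ∈ X₀, x + E l x ∈ Z l) (hF : ∀ l, ∀ x ∈ Z l, x + F l x ∈ X₀)
    (hEn : ∀ l, ‖E l‖ ≤ 1 / 4) (hFn : ∀ l, ‖F l‖ ≤ 1 / 4)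
    (hsmall : ∀ l, ‖R‖ * ‖D‖ * ‖E l‖ ≤ 1 / 2)
    {N₀ : Submodule ℝ X} {N : Λ → Submodule ℝ X} (hN₀ : ∀ x, x ∈ N₀ ↔ x ∈ X₀ ∧ D x = 0)
    (hN : ∀ l x, x ∈ N l ↔ x ∈ Z l ∧ D x = 0) :
    ∃ Ψ : ∀ l, N₀ ≃ₗ[ℝ] N l,
      (∀ l x, ‖(Ψ l x : X) - x‖ ≤ 2 * (‖R‖ * ‖D‖ + 1) * ‖E l‖ * ‖(x : X)‖) ∧
      Continuous (fun p : Λ × N₀ => (Ψ p.1 p.2 : X)) ∧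
      Continuous (fun p : {p : Λ × X // p.2 ∈ N p.1} => (Ψ p.1.1).symm ⟨p.1.2, p.2⟩) := by
  -- Both `D x` and `D (x + E l x)` lie in `Y₀`, hence so does `D (E l x)`, and `R` applies to it.
  let Q : Λ → X₀ →L[ℝ] Y₀ := fun l =>
    (D ∘L E l ∘L X₀.subtypeL).codRestrict Y₀ fun x => by
      have h := Y₀.sub_mem (hZ l _ (hE l x x.2)) (hX x x.2)
      rwa [map_add, add_sub_cancel_left] at h
  have hQ : ∀ l (x : X₀), (Q l x : Y) = D (E l x) := fun l x => rfl
  have hQn : ∀ l (x : X₀), ‖R (Q l x)‖ ≤ ‖R‖ * ‖D‖ * ‖E l‖ * ‖x‖ := fun l x => by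
    calc ‖R (Q l x)‖ ≤ ‖R‖ * ‖D (E l x)‖ := R.le_opNorm _
      _ ≤ ‖R‖ * (‖D‖ * (‖E l‖ * ‖x‖)) := by
        gcongr
        exact (D.le_opNorm _).trans (by gcongr; exact (E l).le_opNorm _)
      _ = _ := by ring
  have hRQ : ∀ l, ‖R ∘L Q l‖ ≤ 1 / 2 := fun l =>
    (ContinuousLinearMap.opNorm_le_bound _ (by positivity) (hQn l)).trans (hsmall l)
  let S : Λ → X₀ →L[ℝ] X₀ := fun l => 1 + R ∘L Q l
  have hSu : ∀ l, IsUnit (S l) := fun l => isUnit_one_add ((hRQ l).trans_lt (by norm_num))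
  have hSc : Continuous S := by
    have hd : ∀ l l', ‖S l - S l'‖ ≤ ‖R‖ * ‖D‖ * ‖E l - E l'‖ := fun l l' => by
      refine ContinuousLinearMap.opNorm_le_bound _ (by positivity) fun x => ?_
      have e : (S l - S l') x = R (Q l x - Q l' x) := by simp [S]
      have e2 : ((Q l x - Q l' x : Y₀) : Y) = D ((E l - E l') x) := by simp [hQ]
      rw [e]
      calc ‖R (Q l x - Q l' x)‖ ≤ ‖R‖ * ‖D ((E l - E l') x)‖ := by
            rw [← e2]; exact R.le_opNorm _
        _ ≤ ‖R‖ * (‖D‖ * (‖E l - E l'‖ * ‖x‖)) := by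
          gcongr
          exact (D.le_opNorm _).trans (by gcongr; exact (E l - E l').le_opNorm _)
        _ = _ := by ring
    rw [continuous_iff_continuousAt]
    intro l₀
    rw [ContinuousAt, tendsto_iff_norm_sub_tendsto_zero]
    refine squeeze_zero (fun _ => norm_nonneg _) (fun l => hd l l₀) ?_
    have := (tendsto_iff_norm_sub_tendsto_zero.1 (hEc.tendsto l₀)).const_mul (‖R‖ * ‖D‖)
    simpa using this
  let Si : Λ → X₀ →L[ℝ] X₀ := fun l => Ring.inverse (S l)
  have hSic : Continuous Si := by
    rw [continuous_iff_continuousAt]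
    intro l
    obtain ⟨u, hu⟩ := hSu l
    have := NormedRing.inverse_continuousAt u
    rw [hu] at this
    exact ContinuousAt.comp (f := S) this hSc.continuousAt
  have hS1 : ∀ l x, S l (Si l x) = x := fun l x =>
    congrArg (fun T : X₀ →L[ℝ] X₀ => T x) (Ring.mul_inverse_cancel _ (hSu l))
  have hS2 : ∀ l x, Si l (S l x) = x := fun l x =>
    congrArg (fun T : X₀ →L[ℝ] X₀ => T x) (Ring.inverse_mul_cancel _ (hSu l))
  let M : Λ → X →L[ℝ] X := fun l => 1 + E l
  have hMc : Continuous M := continuous_const.add hEc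
  have hMu : ∀ l, IsUnit (M l) := fun l => isUnit_one_add ((hEn l).trans_lt (by norm_num))
  let Mi : Λ → X →L[ℝ] X := fun l => Ring.inverse (M l)
  have hMic : Continuous Mi := by
    rw [continuous_iff_continuousAt]
    intro l
    obtain ⟨u, hu⟩ := hMu l
    have := NormedRing.inverse_continuousAt u
    rw [hu] at this
    exact ContinuousAt.comp (f := M) this hMc.continuousAt
  have hM1 : ∀ l x, M l (Mi l x) = x := fun l x =>
    congrArg (fun T : X →L[ℝ] X => T x) (Ring.mul_inverse_cancel _ (hMu l))
  have hM2 : ∀ l x, Mi l (M l x) = x := fun l x =>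
    congrArg (fun T : X →L[ℝ] X => T x) (Ring.inverse_mul_cancel _ (hMu l))
  have hMZ : ∀ l x, x ∈ X₀ → M l x ∈ Z l := fun l x hx => hE l x hx
  -- The key identity, from `D R = 1`: the automorphism `S l` of `X₀` and the change of domain `M l`
  -- agree after applying `D`. So `M l` composed with the inverse of `S l` preserves the values of
  -- `D`.
  have hDS : ∀ l (x : X₀), D (S l x : X₀) = D (M l x) := fun l x => by
    have e : ((S l x : X₀) : X) = x + (R (Q l x) : X₀) := rfl
    have e2 : M l (x : X) = x + E l x := rfl
    rw [e, e2, map_add, map_add, hR, hQ]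
  -- `M l (1 + F l) = 1 + H` preserves `Z l`, and `‖H‖ ≤ 9/16`. A Neumann series in `Z l` writes `z
  -- = M l (y + F l y)` with `y ∈ Z l`, and `y + F l y ∈ X₀`; `1 + F l` itself need not invert `M
  -- l`.
  have hMiX : ∀ l z, z ∈ Z l → Mi l z ∈ X₀ := by
    intro l z hz
    obtain ⟨y, hy, hyz⟩ := exists_add_eq_of_mapsTo (Z := Z l) (H := E l + F l + E l ∘L F l)
      (fun y hy => by
        have h := (Z l).sub_mem (hE l _ (hF l y hy)) hy
        have e : y + F l y + E l (y + F l y) - y = (E l + F l + E l ∘L F l) y := by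
          simp only [map_add, add_apply, ContinuousLinearMap.comp_apply]; abel
        rwa [e] at h) (by
        calc ‖E l + F l + E l ∘L F l‖ ≤ ‖E l‖ + ‖F l‖ + ‖E l‖ * ‖F l‖ :=
              (norm_add_le _ _).trans (add_le_add (norm_add_le _ _)
                (ContinuousLinearMap.opNorm_comp_le _ _))
          _ ≤ 1 / 4 + 1 / 4 + 1 / 4 * (1 / 4) := by
            gcongr <;> first | exact hEn l | exact hFn l
          _ < 1 := by norm_num) hz
    have e : M l (y + F l y) = z := by
      rw [← hyz]
      change y + F l y + E l (y + F l y) = _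
      simp only [map_add, add_apply, ContinuousLinearMap.comp_apply]; abel
    rw [← e, hM2]
    exact hF l y hy
  have hfwd : ∀ l (x : N₀), M l (Si l ⟨x, ((hN₀ x).1 x.2).1⟩ : X₀) ∈ N l := fun l x => by
    rw [hN]
    refine ⟨hMZ l _ (Subtype.coe_prop _), ?_⟩
    rw [← hDS, hS1]
    exact ((hN₀ x).1 x.2).2
  have hbwd : ∀ l (y : N l), ((S l ⟨Mi l y, hMiX l y ((hN l y).1 y.2).1⟩ : X₀) : X) ∈ N₀ :=
    fun l y => by
      rw [hN₀]
      refine ⟨Subtype.coe_prop _, ?_⟩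
      rw [hDS, hM1]
      exact ((hN l y).1 y.2).2
  let ι : N₀ →ₗ[ℝ] X₀ := Submodule.inclusion fun x hx => ((hN₀ x).1 hx).1
  let Ψ : ∀ l, N₀ ≃ₗ[ℝ] N l := fun l =>
    { toFun := fun x => ⟨M l (Si l (ι x) : X₀), hfwd l x⟩
      map_add' := fun x y => Subtype.ext (by simp)
      map_smul' := fun c x => Subtype.ext (by simp)
      invFun := fun y => ⟨(S l ⟨Mi l y, hMiX l y ((hN l y).1 y.2).1⟩ : X₀), hbwd l y⟩
      left_inv := fun x => Subtype.ext (by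
        simp only [hM2]
        change ((S l (Si l (ι x)) : X₀) : X) = x
        rw [hS1]
        rfl)
      right_inv := fun y => Subtype.ext (by
        change M l (Si l (S l ⟨Mi l y, hMiX l y ((hN l y).1 y.2).1⟩) : X₀) = y
        rw [hS2]
        exact hM1 l y) }
  refine ⟨Ψ, fun l x => ?_, ?_, ?_⟩
  -- From `y - x = -R D E y` one gets `‖y‖ ≤ 2 ‖x‖`, and `Ψ x - x = (y - x) + E y`.
  · set y : X₀ := Si l (ι x)
    have hy : y + R (Q l y) = ι x := hS1 l (ι x)
    have hy1 : ‖(y : X) - x‖ ≤ ‖R‖ * ‖D‖ * ‖E l‖ * ‖(y : X)‖ := by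
      have e : (y : X) - x = -(R (Q l y) : X₀) := by
        have := congrArg Subtype.val hy
        change (y : X) + (R (Q l y) : X₀) = x at this
        rw [← this]; abel
      rw [e, norm_neg]
      exact hQn l y
    have hy2 : ‖(y : X)‖ ≤ 2 * ‖(x : X)‖ := by
      have h1 : ‖(y : X)‖ ≤ ‖(x : X)‖ + ‖(y : X) - x‖ := by
        simpa using norm_add_le (x : X) ((y : X) - x)
      have h2 : ‖R‖ * ‖D‖ * ‖E l‖ * ‖(y : X)‖ ≤ 1 / 2 * ‖(y : X)‖ := by
        gcongr; exact hsmall l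
      linarith
    have e : (Ψ l x : X) - x = ((y : X) - x) + E l y := by
      change (y : X) + E l y - x = _
      abel
    rw [e]
    calc ‖(y : X) - x + E l y‖ ≤ ‖R‖ * ‖D‖ * ‖E l‖ * ‖(y : X)‖ + ‖E l‖ * ‖(y : X)‖ :=
          (norm_add_le _ _).trans (add_le_add hy1 ((E l).le_opNorm _))
      _ = (‖R‖ * ‖D‖ + 1) * ‖E l‖ * ‖(y : X)‖ := by ring
      _ ≤ (‖R‖ * ‖D‖ + 1) * ‖E l‖ * (2 * ‖(x : X)‖) := by gcongr
      _ = _ := by ring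
  · have hι : Continuous ι := Continuous.subtype_mk continuous_subtype_val _
    exact (hMc.comp continuous_fst).clm_apply (continuous_subtype_val.comp
      ((hSic.comp continuous_fst).clm_apply (hι.comp continuous_snd)))
  · have h1 : Continuous fun p : {p : Λ × X // p.2 ∈ N p.1} => Mi p.1.1 p.1.2 :=
      (hMic.comp (continuous_fst.comp continuous_subtype_val)).clm_apply
        (continuous_snd.comp continuous_subtype_val)
    have h2 : Continuous fun p : {p : Λ × X // p.2 ∈ N p.1} =>
        (⟨Mi p.1.1 p.1.2, hMiX _ _ ((hN _ _).1 p.2).1⟩ : X₀) := h1.subtype_mk _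
    exact Continuous.subtype_mk (continuous_subtype_val.comp
      ((hSc.comp (continuous_fst.comp continuous_subtype_val)).clm_apply h2)) _

end Perturbation

/-! ### The bundle of kernels near the parameter `0`. -/

section KernelBundle

/-- The domain and the target are complete, being closed subspaces, and the kernel of a Fredholm
operator is complemented; `exists_rightInverse` applies. -/
theorem exists_rightInverse_dbar {w : Weight D μ} {A : ℂ → Mat n} (hadm : IsAdmissible w A)
    (hA : ∀ j k, ContDiff ℝ ∞ fun z => A z j k) (hsurj : Function.Surjective (dbar w A))
    {T : WSob w 2 →L[ℝ] WSob w 1} (hT : ∀ v, IsDbar D (WSob.val v) (WSob.val (T v))) :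
    ∃ R : sobolevOne w →L[ℝ] sobolevTwo w A, ∀ y, T (R y) = y := by
  obtain ⟨T₀, h0, hF⟩ := hadm
  have h0' : ∀ u, T₀ u = dbar w A u := fun u => congrArg (fun L => L u) h0
  have : CompleteSpace (sobolevOne w) := (isClosed_sobolevOne w).completeSpace_coe
  have : CompleteSpace (sobolevTwo w A) := (isClosed_sobolevTwo w hA).completeSpace_coe
  obtain ⟨R, hR⟩ := exists_rightInverse T₀
    (fun y => (hsurj y).imp fun x hx => (h0' x).trans hx) hF.closedComplemented_ker
  refine ⟨R, fun y => ?_⟩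
  rw [← coe_dbar hT (R y), ← h0', hR]

theorem exists_cNorm_sub_le {w : Weight D μ} {A : ℝ → ℂ → Mat n} (hA : IsC2Admissible w A)
    {ε : ℝ≥0} (hε : 0 < ε) :
    ∃ l₀ ∈ Ioc (0 : ℝ) 1, ∀ l ∈ Icc (0 : ℝ) l₀, cNorm 2 D.carrier (A l - A 0) ≤ ε := by
  have h := hA.continuous 0 ⟨le_rfl, zero_le_one⟩
  have hev : ∀ᶠ l in 𝓝[Icc (0 : ℝ) 1] 0, cNorm 2 D.carrier (A l - A 0) ≤ ε :=
    h.eventually (Iic_mem_nhds (ENNReal.coe_pos.2 hε))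
  obtain ⟨r, hr, hsub⟩ := Metric.mem_nhdsWithin_iff.1 hev
  refine ⟨min (r / 2) 1, ⟨by positivity, min_le_right _ _⟩, fun l hl => hsub ⟨?_, hl.1,
    hl.2.trans (min_le_right _ _)⟩⟩
  rw [Metric.mem_ball, Real.dist_eq, sub_zero, abs_of_nonneg hl.1]
  have := hl.2.trans (min_le_left _ _)
  linarith

/-- The isomorphisms `Ψ l` involve no basis, so `l₀` and `C` serve all bases at once. -/
theorem exists_kernel_frames (w : Weight D μ) (A : ℝ → ℂ → Mat n) (hA : IsC2Admissible w A)
    (hsplit : SplitsAtPunctures D μ A) (hsurj : Function.Surjective (dbar w (A 0))) :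
    ∃ l₀ ∈ Ioc (0 : ℝ) 1, ∃ C : ℝ≥0, ∃ Ψ : ∀ l : Icc (0 : ℝ) l₀,
      kernel w (A 0) ≃ₗ[ℝ] kernel w (A l),
      (∀ (l : Icc (0 : ℝ) l₀) x, ‖(Ψ l x : WSob w 2) - x‖ₑ ≤
        C * cNorm 2 D.carrier (A l - A 0) * ‖(x : WSob w 2)‖ₑ) ∧
      Continuous (fun p : Icc (0 : ℝ) l₀ × kernel w (A 0) => (Ψ p.1 p.2 : WSob w 2)) ∧
      Continuous (fun p : {p : Icc (0 : ℝ) l₀ × WSob w 2 // p.2 ∈ kernel w (A p.1)} =>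
        (Ψ p.1.1).symm ⟨p.1.2, p.2⟩) := by
  have h0 : (0 : ℝ) ∈ Icc (0 : ℝ) 1 := ⟨le_rfl, zero_le_one⟩
  obtain ⟨T, hT⟩ := exists_dbarFull w
  obtain ⟨R₀, hR₀⟩ := hsplit
  obtain ⟨R, hR⟩ := exists_rightInverse_dbar (hA.admissible 0 h0) (hA.smooth 0 h0) hsurj hT
  -- The extra `1` leaves room for every `A l` at distance at most `1` from `A 0`, so that one `K`
  -- serves both `E` and `F`.
  obtain ⟨K, hK⟩ := exists_changeOp_bound w R₀ (1 + (cNorm 2 D.carrier (A 0)).toNNReal)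
  have hc0 : ((cNorm 2 D.carrier (A 0)).toNNReal : ℝ≥0∞) = cNorm 2 D.carrier (A 0) :=
    ENNReal.coe_toNNReal (hA.bounded 0 h0)
  -- Chosen to make `K ε ≤ 1/4`, `‖R‖ ‖T‖ K ε ≤ 1/2` and `ε ≤ 1`; the added ones keep the
  -- denominator positive.
  set ε : ℝ≥0 := (4 * (K + 1) * (‖R‖₊ * ‖T‖₊ + 1))⁻¹ with hε
  have hεpos : 0 < ε := by positivity
  have hKε : K * ε ≤ 1 / 4 ∧ ‖R‖₊ * ‖T‖₊ * (K * ε) ≤ 1 / 2 ∧ ε ≤ 1 := by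
    refine ⟨?_, ?_, ?_⟩
    · rw [hε, ← div_eq_mul_inv, div_le_div_iff₀ (by positivity) (by norm_num)]
      have : K * 4 ≤ 4 * (K + 1) * 1 := by rw [mul_one, mul_comm]; gcongr; exact le_self_add
      exact this.trans ((mul_le_mul_right le_add_self _).trans_eq (one_mul _).symm)
    · rw [hε, ← div_eq_mul_inv, mul_div_assoc', div_le_div_iff₀ (by positivity) (by norm_num)]
      have h1 : ‖R‖₊ * ‖T‖₊ ≤ ‖R‖₊ * ‖T‖₊ + 1 := le_self_add
      have h2 : K ≤ K + 1 := le_self_add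
      calc ‖R‖₊ * ‖T‖₊ * K * 2 ≤ (‖R‖₊ * ‖T‖₊ + 1) * (K + 1) * 4 := by
            gcongr; norm_num
        _ = _ := by ring
    · rw [hε]
      refine inv_le_one_of_one_le₀ ?_
      calc (1 : ℝ≥0) ≤ 4 * 1 * 1 := by norm_num
        _ ≤ _ := by gcongr <;> exact le_add_self
  obtain ⟨l₀, hl₀, hsmall⟩ := exists_cNorm_sub_le hA hεpos
  have hmem : ∀ l : Icc (0 : ℝ) l₀, (l : ℝ) ∈ Icc (0 : ℝ) 1 := fun l =>
    ⟨l.2.1, l.2.2.trans hl₀.2⟩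
  set c : Icc (0 : ℝ) l₀ → ℝ≥0 := fun l => (cNorm 2 D.carrier (A l - A 0)).toNNReal
  have hc : ∀ l, (c l : ℝ≥0∞) = cNorm 2 D.carrier (A l - A 0) := fun l =>
    ENNReal.coe_toNNReal (ne_top_of_le_ne_top ENNReal.coe_ne_top (hsmall l l.2))
  have hcε : ∀ l, c l ≤ ε := fun l => by
    rw [← ENNReal.coe_le_coe, hc]; exact hsmall l l.2
  have hsm : ∀ l : Icc (0 : ℝ) l₀, ∀ i j, ContDiff ℝ ∞ fun z => A l z i j := fun l =>
    hA.smooth l (hmem l)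
  have hs0 := hA.smooth 0 h0
  have hAl : ∀ l : Icc (0 : ℝ) l₀,
      cNorm 2 D.carrier (A l) ≤ (1 + (cNorm 2 D.carrier (A 0)).toNNReal : ℝ≥0) := fun l => by
    refine (cNorm_le_add (hsm l) hs0).trans ?_
    rw [ENNReal.coe_add, hc0]
    gcongr
    exact (hsmall l l.2).trans (ENNReal.coe_le_coe.2 hKε.2.2)
  have hA0 : cNorm 2 D.carrier (A 0) ≤ (1 + (cNorm 2 D.carrier (A 0)).toNNReal : ℝ≥0) := by
    rw [ENNReal.coe_add, hc0]; exact le_add_self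
  have hspl : ∀ a ∈ Icc (0 : ℝ) 1, ∀ b ∈ Icc (0 : ℝ) 1, ∀ i, ∀ z ∈ D.endPart i R₀, ∀ j k,
      μ i j ≠ μ i k → (A a - A b) z j k = 0 := fun a ha b hb i z hz j k hjk => by
    simp [hR₀ a ha i z hz j k hjk, hR₀ b hb i z hz j k hjk]
  choose E hE hEn using fun l : Icc (0 : ℝ) l₀ => hK (A 0) (A l - A 0) hs0
    (contDiff_sub_entries (hsm l) hs0) (hR₀ 0 h0) (hspl l (hmem l) 0 h0) hA0 (c l) (hc l).ge
  choose F hF hFn using fun l : Icc (0 : ℝ) l₀ => hK (A l) (A 0 - A l) (hsm l)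
    (contDiff_sub_entries hs0 (hsm l)) (hR₀ l (hmem l)) (hspl 0 h0 l (hmem l)) (hAl l) (c l)
    (by rw [cNorm_sub_comm hs0 (hsm l)]; exact (hc l).ge)
  have hKc : ∀ l, (K * c l : ℝ) ≤ K * ε := fun l => by
    have := hcε l
    gcongr
  -- `E l` is affine in `A l`: the difference `E l' - E l` is multiplication by `(A l' - A l) u(A
  -- 0)`, to which the bound with the same `K` applies.
  have hEcont : Continuous E := by
    rw [continuous_iff_continuousAt]
    intro l
    rw [ContinuousAt, tendsto_iff_norm_sub_tendsto_zero]
    -- Compared through `A 0`, the norm is finite, so `toNNReal` loses nothing.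
    have hfin : ∀ l' : Icc (0 : ℝ) l₀, cNorm 2 D.carrier (A l' - A l) ≠ ⊤ := fun l' => by
      have h1 := cNorm_le_add (k := 2) (X := D.carrier) (contDiff_sub_entries (hsm l') (hsm l))
        (contDiff_sub_entries hs0 (hsm l))
      rw [sub_sub_sub_cancel_right, cNorm_sub_comm hs0 (hsm l), ← hc, ← hc] at h1
      exact ne_top_of_le_ne_top (by simp) h1
    have hd : ∀ l' : Icc (0 : ℝ) l₀,
        ‖E l' - E l‖ ≤ K * (cNorm 2 D.carrier (A l' - A l)).toNNReal := fun l' => by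
      obtain ⟨H, hH, hHn⟩ := hK (A 0) (A l' - A l) hs0 (contDiff_sub_entries (hsm l') (hsm l))
        (hR₀ 0 h0) (hspl l' (hmem l') l (hmem l)) hA0 _ (ENNReal.coe_toNNReal (hfin l')).ge
      have e : E l' - E l = H := by
        ext1 v
        refine WSob.val_injective (AEEqFun.ext ?_)
        rw [sub_apply, map_sub]
        filter_upwards [AEEqFun.coeFn_sub (WSob.val (E l' v)) (WSob.val (E l v)), hE l' v, hE l v,
          hH v] with z h1 h2 h3 h4
        rw [h1, Pi.sub_apply, h2, h3, h4, ← sub_apply, ← sub_mul, ← opOf_sub]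
        congr 3
        simp
      rw [e]
      exact hHn
    refine squeeze_zero (fun _ => norm_nonneg _) hd ?_
    have h1 : Tendsto (fun l' : Icc (0 : ℝ) l₀ => cNorm 2 D.carrier (A l' - A l)) (𝓝 l) (𝓝 0) :=
      (hA.continuous l (hmem l)).comp (tendsto_nhdsWithin_iff.2
        ⟨continuous_subtype_val.tendsto l, Eventually.of_forall hmem⟩)
    have h2 := (ENNReal.tendsto_toNNReal ENNReal.zero_ne_top).comp h1
    have h3 := (NNReal.continuous_coe.tendsto _).comp h2
    simpa using h3.const_mul (K : ℝ)
  have fr0 := hA.isBoundaryFrame h0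
  have fr := fun l : Icc (0 : ℝ) l₀ => hA.isBoundaryFrame (hmem l)
  have : CompleteSpace (sobolevTwo w (A 0)) := (isClosed_sobolevTwo w hs0).completeSpace_coe
  have : ∀ l : Icc (0 : ℝ) l₀, CompleteSpace (sobolevTwo w (A l)) := fun l =>
    (isClosed_sobolevTwo w (hsm l)).completeSpace_coe
  have q1 : (K : ℝ) * ε ≤ 1 / 4 := by exact_mod_cast hKε.1
  have q2 : ‖R‖ * ‖T‖ * ((K : ℝ) * ε) ≤ 1 / 2 := by exact_mod_cast hKε.2.1
  obtain ⟨Ψ, h1, h2, h3⟩ := exists_kernel_equiv T (Y₀ := sobolevOne w)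
    (Z := fun l : Icc (0 : ℝ) l₀ => sobolevTwo w (A l))
    (fun x hx => ((mem_sobolevTwo_iff w hT).1 hx).2)
    (fun l x hx => ((mem_sobolevTwo_iff w hT).1 hx).2) R hR E F hEcont
    (fun l x hx => change_mem_sobolevTwo w fr0 (fr l) (hE l) hx)
    (fun l x hx => change_mem_sobolevTwo w (fr l) fr0 (hF l) hx)
    (fun l => (hEn l).trans ((hKc l).trans q1)) (fun l => (hFn l).trans ((hKc l).trans q1))
    (fun l => (mul_le_mul_of_nonneg_left ((hEn l).trans (hKc l)) (by positivity)).trans q2)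
    (N₀ := kernel w (A 0)) (N := fun l => kernel w (A l))
    (fun x => mem_kernel_iff hT) (fun l x => mem_kernel_iff hT)
  refine ⟨l₀, hl₀, 2 * (‖R‖₊ * ‖T‖₊ + 1) * K, Ψ, fun l x => ?_, h2, h3⟩
  rw [← hc, enorm_eq_nnnorm, enorm_eq_nnnorm, ← ENNReal.coe_mul, ← ENNReal.coe_mul,
    ENNReal.coe_le_coe, ← NNReal.coe_le_coe]
  push_cast
  calc ‖(Ψ l x : WSob w 2) - x‖ ≤ 2 * (‖R‖ * ‖T‖ + 1) * ‖E l‖ * ‖(x : WSob w 2)‖ := h1 l x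
    _ ≤ 2 * (‖R‖ * ‖T‖ + 1) * (K * c l) * ‖(x : WSob w 2)‖ := by gcongr; exact hEn l
    _ = _ := by ring

end KernelBundle

end KernelFamily

end

/-- The frame is the image of the given basis under `Ψ l`. Both directions of the homeomorphism are
the joint continuity statements of `exists_kernel_frames`, composed with the coordinates of the
finite-dimensional kernel at `0`. -/
theorem propositionA3 {n : ℕ} (D : StandardDomain) (μ : D.Puncture → Fin n → ℝ)
    (w : Weight D μ) (A : ℝ → ℂ → Mat n) (hA : IsC2Admissible w A)
    (hsplit : SplitsAtPunctures D μ A) (hsurj : Function.Surjective (dbar w (A 0))) :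
    ∃ l₀ ∈ Set.Ioc (0 : ℝ) 1, ∃ C : ℝ≥0,
      ∀ (k : ℕ) (v : Module.Basis (Fin k) ℝ (kernel w (A 0))),
        ∃ vl : ∀ l : Set.Icc (0 : ℝ) l₀, Module.Basis (Fin k) ℝ (kernel w (A l)),
          (∀ (l : Set.Icc (0 : ℝ) l₀) (i : Fin k),
            ‖((vl l i : WSob w 2) - (v i : WSob w 2))‖ₑ ≤
              C * cNorm 2 D.carrier (A l - A 0) * ‖(v i : WSob w 2)‖ₑ) ∧
          ∃ Φ : (Set.Icc (0 : ℝ) l₀ × (Fin k → ℝ)) ≃ₜ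
              {p : Set.Icc (0 : ℝ) l₀ × WSob w 2 // p.2 ∈ kernel w (A p.1)},
            ∀ (l : Set.Icc (0 : ℝ) l₀) (c : Fin k → ℝ),
              (Φ (l, c)).1 = (l, ∑ i, c i • (vl l i : WSob w 2)) := by
  obtain ⟨l₀, hl₀, C, Ψ, hb, hc, hc'⟩ := exists_kernel_frames w A hA hsplit hsurj
  refine ⟨l₀, hl₀, C, fun k v => ⟨fun l => v.map (Ψ l), fun l i => ?_, ?_⟩⟩
  · simpa only [Module.Basis.map_apply] using hb l (v i)
  have : FiniteDimensional ℝ (kernel w (A 0)) := v.finiteDimensional_of_finite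
  have hv : Continuous v.equivFun.symm := LinearMap.continuous_of_finiteDimensional
    (v.equivFun.symm : (Fin k → ℝ) →ₗ[ℝ] kernel w (A 0))
  have hv' : Continuous v.equivFun := LinearMap.continuous_of_finiteDimensional
    (v.equivFun : kernel w (A 0) →ₗ[ℝ] (Fin k → ℝ))
  refine ⟨{
    toFun := fun p => ⟨(p.1, (Ψ p.1 (v.equivFun.symm p.2) : WSob w 2)), Subtype.coe_prop _⟩
    invFun := fun p => (p.1.1, v.equivFun ((Ψ p.1.1).symm ⟨p.1.2, p.2⟩))
    left_inv := fun p => Prod.ext rfl (by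
      change v.equivFun ((Ψ p.1).symm (Ψ p.1 (v.equivFun.symm p.2))) = p.2
      rw [LinearEquiv.symm_apply_apply, LinearEquiv.apply_symm_apply])
    right_inv := fun p => by simp
    continuous_toFun := (continuous_fst.prodMk (hc.comp (continuous_fst.prodMk
      (hv.comp continuous_snd)))).subtype_mk _
    continuous_invFun := (continuous_fst.comp continuous_subtype_val).prodMk (hv'.comp hc') },
    fun l c => ?_⟩
  change (l, ((Ψ l (v.equivFun.symm c) : kernel w (A l)) : WSob w 2)) = _
  rw [Module.Basis.equivFun_symm_apply, map_sum]
  simp
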